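/- **Theorem 4.1.** Let $\mathcal B$ be a unital $C^*$-algebra. For $j=1,2$ let $(\mathcal A_j,E_j)$ be a $\mathcal B$-valued probability space, i.e. $\mathcal A_j$ is a unital $C^*$-algebra containing $\mathcal B$ unitally and $E_j:\mathcal A_j\to\mathcal B$ is a completely positive $\mathcal B$-bimodule map with $E_j|_{\mathcal B}=\mathrm{id}$, represented on a right Hilbert $\mathcal B$-module $\mathcal H_j$ by adjointable operators with a vector $\xi_j$ such that $E_j[a]=\langle\xi_j,a\xi_j\rangle$. Put $\mathcal H_j^\circ=\{h:\langle\xi_j,h\rangle=0\}$. Let $$\mathcal H=\mathcal B\xi\oplus\bigoplus_{k\ge1,\;j_1\ne j_2\ne\dots\ne j_k}\mathcal H_{j_1}^\circ\otimes_{\mathcal B}\dots\otimes_{\mathcal B}\mathcal H_{j_k}^\circ\;\cong\;\mathcal H_j\otimes_{\mathcal B}\mathcal M_j$$ be the free product of the $(\mathcal H_j,\xi_j)$ (where $\mathcal M_j$ is the sum of $\mathcal B$ and the tensor products with $j_1\neq j$), let $\mathcal A_j$ act on $\mathcal H$ by $a\otimes\mathrm{id}_{\mathcal M_j}$, let $\mathcal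 A$ be the $C^*$-algebra of operators on $\mathcal H$ generated by (the images of) $\mathcal A_1$ and $\mathcal A_2$, let $E[T]=\langle\xi,T\xi\rangle$, and let $\mathcal E_1[T]=J^*TJ$, where $J:\mathcal H_1=\mathcal B\xi_1\oplus\mathcal H_1^\circ\to\mathcal H$ is the natural inclusion; thus $(\mathcal A,E)$ is the free product of $(\mathcal A_1,E_1)$ and $(\mathcal A_2,E_2)$, and $\mathcal E_1$ is the canonical conditional expectation onto (the image in $\mathcal L(\mathcal H_1)$ of) $\mathcal A_1$. Let $X\in\mathcal A_1$ be self-adjoint and let $V\in\mathcal A_2$ and a linear map $\eta:\mathcal B\to\mathcal B$ satisfy $$Vb_1V^*b_2V=Vb_1\eta(b_2)\quad(3.1),\qquad E_2[VbV^*]=b\quad(3.2)\qquad\text{for all } b,b_1,b_2\in\mathcal B.$$ Let $\mathbb H^{(n)}(\mathcal B)=\{z\in M_n(\mathcal B):\tfrac1{2i}(z-z^*)\ge\epsilon1\text{ for some }\epsilon>0\}$, write $X$, $V$ also for $X\otimes I_n$, $V\otimes I_n$, apply $E_1$, $E$ and $\mathcal E_1$ entrywise, and put $$G_\mu^{(n)}(z)=E_1[(z-X)^{-1}],\qquad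 G_\nu^{(n)}(z)=E[V(z-V^*XV)^{-1}V^*]\qquad(z\in\mathbb H^{(n)}(\mathcal B)),$$ the Cauchy transforms of the law $\mu$ of $X$ and of the law $\nu$ of $V^*XV$ with respect to $\tilde E[T]=E[VTV^*]$; the inverses exist. Then there is a fully matricial analytic function $F=(F^{(n)})$, $F^{(n)}:\mathbb H^{(n)}(\mathcal B)\to\mathbb H^{(n)}(\mathcal B)$, such that * $G_\nu^{(n)}=G_\mu^{(n)}\circ F^{(n)}$ for all $n$; * for every $n$, $F^{(n)}(z)^{-1}\to0$ as $z^{-1}\to0$, $z\in\mathbb H^{(n)}(\mathcal B)$: for every $\epsilon>0$ there is $\delta>0$ such that $\|z^{-1}\|<\delta$ implies $\|F^{(n)}(z)^{-1}\|<\epsilon$; * for all $n$ and all $z\in\mathbb H^{(n)}(\mathcal B)$, $$\mathcal E_1[V(z-V^*XV)^{-1}V^*]=(F^{(n)}(z)-X)^{-1}.$$ It is the only fully matricial function from $\mathbb H(\mathcal B)$ to itself with the first two properties, and the only function (sequence of maps $\mathbb H^{(n)}(\mathcal B)\to\mathbb H^{(n)}(\mathcal B)$) with the third. Here $F$ is fully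 matricial analytic if it respects direct sums, $F^{(n+m)}(z\oplus w)=F^{(n)}(z)\oplus F^{(m)}(w)$; respects similarities, $F^{(n)}(SzS^{-1})=SF^{(n)}(z)S^{-1}$ whenever $S\in M_n(\mathbb C)$ is invertible and $z,SzS^{-1}\in\mathbb H^{(n)}(\mathcal B)$; and for every $z\in\mathbb H^{(n)}(\mathcal B)$ there are $\delta,M>0$ such that for all $m$, $\|F^{(mn)}(w)\|\le M$ for all $w\in\mathbb H^{(mn)}(\mathcal B)$ within distance $\delta$ of the direct sum of $m$ copies of $z$. -/

import Mathlib

namespace OpValFree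

open scoped InnerProductSpace
open UniformSpace

/-- A right `B`-module with a `B`-valued semi-inner product, linear in the second variable. -/
class PreHilbertModule (B P : Type*) [CStarAlgebra B] [PartialOrder B] [AddCommGroup P]
    [Module ℂ P] [Module Bᵐᵒᵖ P] extends Inner B P where
  ip_add_right (x y z : P) : inner x (y + z) = inner x y + inner x z
  ip_smul_right (x : P) (c : ℂ) (y : P) : inner x (c • y) = c • inner x y
  ip_op_smul_right (x y : P) (b : B) : inner x (MulOpposite.op b • y) = inner x y * b
  ip_star (x y : P) : star (inner x y) = inner y x
  ip_self_nonneg (x : P) : 0 ≤ inner x x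

/-- A right Hilbert `B`-module (completeness is a separate hypothesis `CompleteSpace H`): the norm
is the one given by the `B`-valued inner product. -/
class RightHilbertModule (B H : Type*) [CStarAlgebra B] [PartialOrder B] [NormedAddCommGroup H]
    [NormedSpace ℂ H] [Module Bᵐᵒᵖ H] extends PreHilbertModule B H where
  norm_sq (x : H) : ‖x‖ ^ 2 = ‖inner x x‖

section Semi

set_option linter.unusedSectionVars false

variable {B P : Type*} [CStarAlgebra B] [PartialOrder B] [StarOrderedRing B] [AddCommGroup P]
  [Module ℂ P] [Module Bᵐᵒᵖ P] [PreHilbertModule B P]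

namespace PreHilbertModule

theorem ip_add_left (x y z : P) : (inner B (x + y) z : B) = inner B x z + inner B y z := by
  rw [← ip_star, ip_add_right, star_add, ip_star, ip_star]

theorem ip_smul_left (c : ℂ) (x y : P) :
    (inner B (c • x) y : B) = star c • inner B x y := by
  rw [← ip_star, ip_smul_right, star_smul, ip_star]

theorem ip_op_smul_left (x y : P) (b : B) :
    (inner B (MulOpposite.op b • x) y : B) = star b * inner B x y := by
  rw [← ip_star, ip_op_smul_right, star_mul, ip_star]

theorem ip_zero_right (x : P) : (inner B x 0 : B) = 0 := by
  have := ip_smul_right (B := B) x 0 0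
  simpa using this

theorem ip_zero_left (x : P) : (inner B 0 x : B) = 0 := by
  rw [← ip_star, ip_zero_right, star_zero]

theorem ip_sub_right (x y z : P) : (inner B x (y - z) : B) = inner B x y - inner B x z := by
  have h : y - z = y + (-1 : ℂ) • z := by simp [sub_eq_add_neg]
  rw [h, ip_add_right, ip_smul_right]; simp [sub_eq_add_neg]

theorem ip_sub_left (x y z : P) : (inner B (x - y) z : B) = inner B x z - inner B y z := by
  rw [← ip_star, ip_sub_right, star_sub, ip_star, ip_star]

theorem ip_sum_right {κ : Type*} (s : Finset κ) (x : P) (f : κ → P) :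
    (inner B x (∑ k ∈ s, f k) : B) = ∑ k ∈ s, inner B x (f k) := by
  classical
  induction s using Finset.induction_on with
  | empty => simp [ip_zero_right]
  | insert a s ha ih => rw [Finset.sum_insert ha, Finset.sum_insert ha, ip_add_right, ih]

theorem ip_sum_left {κ : Type*} (s : Finset κ) (x : P) (f : κ → P) :
    (inner B (∑ k ∈ s, f k) x : B) = ∑ k ∈ s, inner B (f k) x := by
  rw [← ip_star, ip_sum_right, star_sum]
  simp only [ip_star]

/-- The Cauchy-Schwarz inequality for a `B`-valued semi-inner product. -/
theorem norm_ip_sq_le (x y : P) :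
    ‖(inner B x y : B)‖ ^ 2 ≤ ‖(inner B x x : B)‖ * ‖(inner B y y : B)‖ := by
  set c : B := inner B x y with hc
  set X : ℝ := ‖(inner B x x : B)‖ with hX
  set Y : ℝ := ‖(inner B y y : B)‖ with hY
  have hyx : (inner B y x : B) = star c := by rw [hc, ip_star]
  have hX0 : 0 ≤ X := norm_nonneg _
  have hY0 : 0 ≤ Y := norm_nonneg _
  have key : ∀ s : ℝ, (2 * s - X) • (star c * c) ≤ (s ^ 2) • (inner B y y : B) := by
    intro s
    have h0 := ip_self_nonneg (B := B) (MulOpposite.op c • x - (s : ℂ) • y)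
    have h1 : (inner B (MulOpposite.op c • x - (s : ℂ) • y) (MulOpposite.op c • x - (s : ℂ) • y) : B)
        = star c * inner B x x * c - (2 * s) • (star c * c) + (s ^ 2) • (inner B y y : B) := by
      simp only [ip_sub_left, ip_sub_right, ip_op_smul_left, ip_op_smul_right,
        ip_smul_left, ip_smul_right, hyx, ← hc]
      have e : ∀ b : B, (s : ℂ) • b = s • b := fun b => by simp
      have e' : ∀ b : B, star (s : ℂ) • b = s • b := fun b => by simp
      simp only [e, e', smul_sub, sub_mul, smul_mul_assoc, smul_smul, mul_assoc]
      module
    have h2 : star c * inner B x x * c ≤ X • (star c * c) :=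
      CStarAlgebra.star_left_conjugate_le_norm_smul
        (hb := ip_star (B := B) x x)
    rw [h1] at h0
    have h3 := h0.trans (add_le_add_left (sub_le_sub_right h2 ((2 * s) • (star c * c)))
      ((s ^ 2) • (inner B y y : B)))
    have h4 : (2 * s - X) • (star c * c) = (s ^ 2) • (inner B y y : B) -
      (X • (star c * c) - (2 * s) • (star c * c) + (s ^ 2) • (inner B y y : B)) := by module
    rw [h4]
    exact sub_le_self _ h3
  have key2 : ∀ ε : ℝ, 0 < ε → ‖c‖ ^ 2 ≤ (X + ε) * Y := by
    intro ε hε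
    have h := key (X + ε)
    have hpos : 0 < X + 2 * ε := by positivity
    have h5 : (0 : B) ≤ (2 * (X + ε) - X) • (star c * c) :=
      smul_nonneg (by linarith) (star_mul_self_nonneg c)
    have h6 := CStarAlgebra.norm_le_norm_of_nonneg_of_le h5 h
    rw [norm_smul, norm_smul, CStarRing.norm_star_mul_self, Real.norm_of_nonneg (by linarith),
      Real.norm_of_nonneg (by positivity), ← hY] at h6
    have h7 : (X + 2 * ε) * ‖c‖ ^ 2 ≤ (X + 2 * ε) * ((X + ε) * Y) := by
      calc (X + 2 * ε) * ‖c‖ ^ 2 = (2 * (X + ε) - X) * (‖c‖ * ‖c‖) := by ring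
        _ ≤ (X + ε) ^ 2 * Y := h6
        _ ≤ (X + 2 * ε) * ((X + ε) * Y) := by
          rw [pow_two, mul_assoc]
          exact mul_le_mul_of_nonneg_right (by linarith) (by positivity)
    exact le_of_mul_le_mul_left h7 hpos
  refine le_of_forall_pos_le_add fun ε hε => ?_
  have := key2 (ε / (Y + 1)) (by positivity)
  refine this.trans ?_
  rw [add_mul]
  have : ε / (Y + 1) * Y ≤ ε := by
    rw [div_mul_eq_mul_div, div_le_iff₀ (by positivity)]
    nlinarith
  linarith

variable (B P) in
/-- The seminorm `‖x‖ = ‖⟨x, x⟩‖ ^ (1/2)`. -/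
@[reducible]
noncomputable def toNorm : Norm P := ⟨fun x => √‖(inner B x x : B)‖⟩

variable (B P) in
theorem core : @SeminormedSpace.Core ℂ P _ _ (toNorm B P) _ := by
  let _ : Norm P := toNorm B P
  have hn : ∀ x : P, ‖x‖ = √‖(inner B x x : B)‖ := fun _ => rfl
  have hcs : ∀ x y : P, ‖(inner B x y : B)‖ ≤ ‖x‖ * ‖y‖ := by
    intro x y
    rw [hn, hn, ← Real.sqrt_mul (norm_nonneg _)]
    exact Real.le_sqrt_of_sq_le (norm_ip_sq_le x y)
  refine ⟨fun x => Real.sqrt_nonneg _, fun c x => ?_, fun x y => ?_⟩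
  · rw [hn, hn, ip_smul_left, ip_smul_right, norm_smul, norm_smul, norm_star, ← mul_assoc,
      Real.sqrt_mul (by positivity), Real.sqrt_mul_self (norm_nonneg _)]
  · rw [hn (x + y)]
    refine Real.sqrt_le_iff.2 ⟨add_nonneg (Real.sqrt_nonneg _) (Real.sqrt_nonneg _), ?_⟩
    have hs : ∀ x : P, ‖(inner B x x : B)‖ = ‖x‖ ^ 2 := fun x => by
      rw [hn, Real.sq_sqrt (norm_nonneg _)]
    rw [ip_add_left, ip_add_right, ip_add_right]
    calc _ ≤ (‖(inner B x x : B)‖ + ‖(inner B x y : B)‖)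
          + (‖(inner B y x : B)‖ + ‖(inner B y y : B)‖) :=
          (norm_add_le _ _).trans (add_le_add (norm_add_le _ _) (norm_add_le _ _))
      _ ≤ (‖x‖ ^ 2 + ‖x‖ * ‖y‖) + (‖y‖ * ‖x‖ + ‖y‖ ^ 2) := by
          rw [hs, hs]; gcongr <;> apply hcs
      _ = _ := by ring

end PreHilbertModule

end Semi

/-! ### Positivity of matrices over a C⋆-algebra -/

section Positivity

variable {C : Type*} [CStarAlgebra C] [PartialOrder C] [StarOrderedRing C]

theorem exists_star_mul_self {x : C} (h : 0 ≤ x) : ∃ d : C, x = star d * d :=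
  CStarAlgebra.nonneg_iff_eq_star_mul_self.1 h

theorem exists_neg_part {x : C} (hx : star x = x) :
    ∃ p s : C, star p * x * p = - (star s * s) ∧ (s = 0 → 0 ≤ x) := by
  have hsa : IsSelfAdjoint x := hx
  have hp : 0 ≤ x⁻ := CFC.negPart_nonneg x
  obtain ⟨d, hd⟩ := exists_star_mul_self hp
  have hpsa : star (x⁻) = x⁻ := (IsSelfAdjoint.of_nonneg hp)
  refine ⟨x⁻, d * x⁻, ?_, ?_⟩
  · have h1 : x * x⁻ = - (x⁻ * x⁻) := by
      conv_lhs => enter [1]; rw [← CFC.posPart_sub_negPart x hsa]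
      rw [sub_mul, CFC.posPart_mul_negPart, zero_sub]
    rw [hpsa, mul_assoc, h1, star_mul, hpsa, mul_assoc, ← mul_assoc (star d), ← hd]
    simp
  · intro h
    have h2 : x⁻ * x⁻ = 0 := by
      nth_rewrite 1 [hd]; rw [mul_assoc, h, mul_zero]
    have h3 : x⁻ = 0 := by
      have : star (x⁻) * x⁻ = 0 := by rw [hpsa, h2]
      exact CStarRing.star_mul_self_eq_zero_iff _ |>.1 this
    have := CFC.posPart_sub_negPart x hsa
    rw [h3, sub_zero] at this
    rw [← this]; exact CFC.posPart_nonneg x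
end Positivity

section Matrices

set_option linter.unusedSectionVars false

variable {B : Type*} [CStarAlgebra B] [PartialOrder B] [StarOrderedRing B]
  {κ : Type*} [Fintype κ] [DecidableEq κ]

theorem exists_gram {M : CStarMatrix κ κ B} (hM : 0 ≤ M) :
    ∃ d : CStarMatrix κ κ B, ∀ k l, M k l = ∑ m, star (d m k) * d m l := by
  obtain ⟨d, rfl⟩ := exists_star_mul_self hM
  exact ⟨d, fun k l => by simp [CStarMatrix.mul_apply, CStarMatrix.star_apply]⟩

theorem nonneg_of_quadForm (f : κ → κ → B) (hsa : ∀ k l, star (f l k) = f k l)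
    (h : ∀ β : κ → B, 0 ≤ ∑ k, ∑ l, star (β k) * f k l * β l) :
    0 ≤ (CStarMatrix.ofMatrix (Matrix.of f) : CStarMatrix κ κ B) := by
  set M : CStarMatrix κ κ B := CStarMatrix.ofMatrix (Matrix.of f) with hM
  have hMf : ∀ k l, M k l = f k l := fun _ _ => rfl
  simp only [← hMf] at hsa h
  obtain ⟨p, s, h1, h2⟩ := exists_neg_part (x := M) (by
    ext k l; rw [CStarMatrix.star_apply, hsa])
  refine h2 ?_
  ext m j
  have hj : ∀ j, (star p * M * p) j j = -(star s * s) j j := fun j => by rw [h1]; rfl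
  have e1 := hj j
  have e2 : (star p * M * p) j j = ∑ k, ∑ l, star (p k j) * M k l * p l j := by
    simp only [CStarMatrix.mul_apply, CStarMatrix.star_apply, Finset.sum_mul]
    exact Finset.sum_comm
  have e3 : (star s * s) j j = ∑ m, star (s m j) * s m j := by
    simp only [CStarMatrix.mul_apply, CStarMatrix.star_apply]
  have h4 := h (fun k => p k j)
  rw [← e2, e1, e3, neg_nonneg] at h4
  have h5 : ∑ m, star (s m j) * s m j = 0 :=
    le_antisymm h4 (Finset.sum_nonneg fun m _ => star_mul_self_nonneg _)
  have h6 := (Finset.sum_eq_zero_iff_of_nonneg (fun m _ => star_mul_self_nonneg _)).1 h5 m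
    (Finset.mem_univ _)
  exact (CStarRing.star_mul_self_eq_zero_iff _).1 h6

theorem sum_gram (p : κ → κ → B) (β : κ → B) :
    ∑ k, ∑ l, star (β k) * (∑ m, star (p m k) * p m l) * β l
      = ∑ m, star (∑ k, p m k * β k) * (∑ l, p m l * β l) := by
  simp only [star_sum, Finset.mul_sum, Finset.sum_mul, star_mul, mul_assoc]
  refine (Finset.sum_congr rfl fun k _ => Finset.sum_comm).trans (Finset.sum_comm.trans ?_)
  exact Finset.sum_congr rfl fun m _ => Finset.sum_comm

theorem sum_gram_inner {P : Type*} [AddCommGroup P] [Module ℂ P] [Module Bᵐᵒᵖ P]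
    [PreHilbertModule B P] (u : κ → κ → P) (β : κ → B) :
    ∑ k, ∑ l, star (β k) * (∑ m, (inner B (u m k) (u m l) : B)) * β l
      = ∑ m, (inner B (∑ k, MulOpposite.op (β k) • u m k)
          (∑ l, MulOpposite.op (β l) • u m l) : B) := by
  simp only [PreHilbertModule.ip_sum_left, PreHilbertModule.ip_sum_right,
    PreHilbertModule.ip_op_smul_left, PreHilbertModule.ip_op_smul_right, Finset.mul_sum,
    Finset.sum_mul, mul_assoc]
  refine (Finset.sum_congr rfl fun k _ => Finset.sum_comm).trans (Finset.sum_comm.trans ?_)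
  exact Finset.sum_congr rfl fun m _ => Finset.sum_comm

end Matrices

/-! ### `B`-valued probability spaces and pointed correspondences -/

section Spaces

set_option linter.unusedSectionVars false

variable {B : Type*} [CStarAlgebra B] [PartialOrder B] [StarOrderedRing B]

/-- A `B`-valued probability space: a unital C⋆-algebra `A` with a unital inclusion `B ⊆ A` (it is
injective because of `expect_incl`) and a conditional expectation `A → B`. -/
structure ValuedProbSpace (B A : Type*) [CStarAlgebra B] [PartialOrder B] [StarOrderedRing B]
    [CStarAlgebra A] where
  incl : B →⋆ₐ[ℂ] A
  expect : A →ₗ[ℂ] B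
  expect_incl (b : B) : expect (incl b) = b
  expect_bimodule (b₁ : B) (a : A) (b₂ : B) :
    expect (incl b₁ * a * incl b₂) = b₁ * expect a * b₂
  completely_positive (n : ℕ) (M : CStarMatrix (Fin n) (Fin n) A) :
    0 ≤ (star M * M).map expect

/-- A pointed `A`-`B`-correspondence inducing the expectation of the `B`-valued probability space
`S`: a unital `*`-representation of `A` by adjointable operators on a right Hilbert `B`-module `H`,
with a vector `ξ` such that `E[a] = ⟨ξ, a ξ⟩`. Since the expectation is the identity on `B`, the
vector `ξ` is then automatically a `B`-central unit vector. -/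
structure PointedCorrespondence {A : Type*} [CStarAlgebra A] (S : ValuedProbSpace B A)
    (H : Type*) [NormedAddCommGroup H] [NormedSpace ℂ H] [Module Bᵐᵒᵖ H]
    [RightHilbertModule B H] where
  rep : A →ₐ[ℂ] (H →L[ℂ] H)
  inner_rep_left (a : A) (x y : H) : (inner B (rep a x) y : B) = inner B x (rep (star a) y)
  ξ : H
  inner_rep_ξ (a : A) : (inner B ξ (rep a ξ) : B) = S.expect a

namespace PointedCorrespondence

open PreHilbertModule

variable {A : Type*} [CStarAlgebra A] {S : ValuedProbSpace B A}
  {H : Type*} [NormedAddCommGroup H] [NormedSpace ℂ H] [Module Bᵐᵒᵖ H]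
  [RightHilbertModule B H] (C : PointedCorrespondence S H)

/-- The left action of `B` on a correspondence. -/
noncomputable def left (b : B) : H →L[ℂ] H := C.rep (S.incl b)

theorem inner_left_left (b : B) (x y : H) :
    (inner B (C.left b x) y : B) = inner B x (C.left (star b) y) := by
  rw [left, inner_rep_left, left, ← map_star S.incl b]

theorem left_mul (b c : B) (x : H) : C.left (b * c) x = C.left b (C.left c x) := by
  simp [left]

theorem left_add (b c : B) (x : H) : C.left (b + c) x = C.left b x + C.left c x := by
  simp [left]

theorem left_one (x : H) : C.left 1 x = x := by simp [left]

theorem left_zero (x : H) : C.left 0 x = 0 := by simp [left]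

theorem inner_ξ_left (b : B) : (inner B C.ξ (C.left b C.ξ) : B) = b := by
  rw [left, inner_rep_ξ, S.expect_incl]

theorem inner_ξ_ξ : (inner B C.ξ C.ξ : B) = 1 := by
  have := C.inner_ξ_left 1
  rwa [left_one] at this

theorem eq_zero_of_inner_self {x : H} (h : (inner B x x : B) = 0) : x = 0 := by
  have := RightHilbertModule.norm_sq (B := B) x
  rw [h, norm_zero] at this
  simpa using this

theorem left_ξ (b : B) : C.left b C.ξ = MulOpposite.op b • C.ξ := by
  rw [← sub_eq_zero]
  refine eq_zero_of_inner_self (B := B) ?_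
  have h1 : (inner B (C.left b C.ξ) C.ξ : B) = star b := by
    rw [inner_left_left, inner_ξ_left]
  have h2 : (inner B (C.left b C.ξ) (C.left b C.ξ) : B) = star b * b := by
    rw [inner_left_left, ← left_mul, inner_ξ_left]
  simp only [ip_sub_left, ip_sub_right, ip_op_smul_left, ip_op_smul_right,
    inner_ξ_left, inner_ξ_ξ, h1, h2]
  simp

theorem left_op_smul (b c : B) (x : H) :
    C.left b (MulOpposite.op c • x) = MulOpposite.op c • C.left b x := by
  rw [← sub_eq_zero]
  refine eq_zero_of_inner_self (B := B) ?_
  have h : ∀ y : H, (inner B y (C.left b (MulOpposite.op c • x) - MulOpposite.op c • C.left b x) : B)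
      = 0 := fun y => by
    have e : ∀ z : H, (inner B y (C.left b z) : B) = inner B (C.left (star b) y) z := fun z => by
      rw [inner_left_left, star_star]
    rw [ip_sub_right, ip_op_smul_right, e, e, ip_op_smul_right, sub_self]
  exact h _

/-- The submodule `H° = {h : ⟨ξ, h⟩ = 0}`. -/
def Centered : Type _ := {h : H // (inner B C.ξ h : B) = 0}

theorem inner_ξ_left_of_centered (b : B) {h : H} (hh : (inner B C.ξ h : B) = 0) :
    (inner B C.ξ (C.left b h) : B) = 0 := by
  have : (inner B C.ξ (C.left b h) : B) = inner B (C.left (star b) C.ξ) h := by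
    rw [inner_left_left, star_star]
  rw [this, left_ξ, ip_op_smul_left, hh, mul_zero]

/-- The left action of `B` on `H°`. -/
noncomputable def leftCentered (b : B) (h : C.Centered) : C.Centered :=
  ⟨C.left b h.1, C.inner_ξ_left_of_centered b h.2⟩

/-- The projection `h ↦ h - ξ⟨ξ, h⟩` onto `H°`. -/
noncomputable def center (h : H) : C.Centered :=
  ⟨h - MulOpposite.op (inner B C.ξ h : B) • C.ξ, by
    rw [ip_sub_right, ip_op_smul_right, inner_ξ_ξ, one_mul, sub_self]⟩

theorem inner_center (h k : H) : (inner B (C.center h).1 (C.center k).1 : B)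
    = inner B h k - star (inner B C.ξ h : B) * inner B C.ξ k := by
  simp only [center, ip_sub_left, ip_sub_right, ip_op_smul_left, ip_op_smul_right,
    inner_ξ_ξ, ip_star]
  simp

end PointedCorrespondence

end Spaces

/-! ### The free product of pointed correspondences -/

section FreeProduct

set_option linter.unusedSectionVars false

variable {B : Type*} [CStarAlgebra B] [PartialOrder B] [StarOrderedRing B]
  {ι : Type*} [DecidableEq ι] {A H : ι → Type*} [∀ i, CStarAlgebra (A i)]
  [∀ i, NormedAddCommGroup (H i)] [∀ i, NormedSpace ℂ (H i)] [∀ i, Module Bᵐᵒᵖ (H i)]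
  [∀ i, RightHilbertModule B (H i)] {S : ∀ i, ValuedProbSpace B (A i)}
  (C : ∀ i, PointedCorrespondence (S i) (H i))

open PreHilbertModule PointedCorrespondence

/-- A letter is an element of some `H°ᵢ`. -/
abbrev Letter : Type _ := Σ i, (C i).Centered

/-- The value `⟨h, c k⟩` for letters `h`, `k` from the same `H°ᵢ`, and `0` otherwise. -/
noncomputable def letterForm (x y : Letter C) (c : B) : B :=
  if e : y.1 = x.1 then inner B x.2.1 ((C x.1).left c (e ▸ y.2).1) else 0

/-- `wordForm [h₁, …, hₙ] [k₁, …, kₙ] c = ⟨hₙ, ⟨hₙ₋₁, … ⟨h₁, c k₁⟩ … kₙ₋₁⟩ kₙ⟩` if the letters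
`hᵣ`, `kᵣ` are from the same `H°ᵢ` for every `r`, and `0` otherwise: for `c = 1`, the inner product
of the elementary tensors `h₁ ⊗ … ⊗ hₙ` and `k₁ ⊗ … ⊗ kₘ`. -/
noncomputable def wordForm : List (Letter C) → List (Letter C) → B → B
  | [], [], c => c
  | x :: u, y :: v, c => wordForm u v (letterForm C x y c)
  | [], _ :: _, _ => 0
  | _ :: _, [], _ => 0

theorem letterForm_same (i : ι) (h k : (C i).Centered) (c : B) :
    letterForm C ⟨i, h⟩ ⟨i, k⟩ c = inner B h.1 ((C i).left c k.1) := by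
  simp [letterForm]

theorem letterForm_ne {x y : Letter C} (h : y.1 ≠ x.1) (c : B) : letterForm C x y c = 0 := by
  simp [letterForm, h]

theorem letterForm_add (x y : Letter C) (c d : B) :
    letterForm C x y (c + d) = letterForm C x y c + letterForm C x y d := by
  unfold letterForm
  split_ifs
  · rw [left_add, ip_add_right]
  · simp

theorem star_letterForm (x y : Letter C) (c : B) :
    star (letterForm C x y c) = letterForm C y x (star c) := by
  obtain ⟨i, h⟩ := x
  obtain ⟨j, k⟩ := y
  by_cases e : j = i
  · subst e
    rw [letterForm_same, letterForm_same, ip_star, inner_left_left]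
  · rw [letterForm_ne C (by simpa using e), letterForm_ne C (by simpa using Ne.symm e), star_zero]

theorem wordForm_add : ∀ (u v : List (Letter C)) (c d : B),
    wordForm C u v (c + d) = wordForm C u v c + wordForm C u v d
  | [], [], _, _ => by simp [wordForm]
  | x :: u, y :: v, c, d => by simp only [wordForm, letterForm_add, wordForm_add u v]
  | [], _ :: _, _, _ => by simp [wordForm]
  | _ :: _, [], _, _ => by simp [wordForm]

theorem wordForm_zero (u v : List (Letter C)) : wordForm C u v 0 = 0 := by
  have := wordForm_add C u v 0 0
  simpa using this

theorem star_wordForm : ∀ (u v : List (Letter C)) (c : B),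
    star (wordForm C u v c) = wordForm C v u (star c)
  | [], [], _ => by simp [wordForm]
  | x :: u, y :: v, c => by simp only [wordForm, star_letterForm, star_wordForm u v]
  | [], _ :: _, _ => by simp [wordForm]
  | _ :: _, [], _ => by simp [wordForm]

/-- The matrix with entries `⟨h_k, c_{kl} h_l⟩` when the words `k`, `l` have first letters `h_k`,
`h_l`, and with entries `c_{kl}` when both words are empty. -/
noncomputable def headForm : List (Letter C) → List (Letter C) → B → B
  | [], [], c => c
  | x :: _, y :: _, c => letterForm C x y c
  | [], _ :: _, _ => 0
  | _ :: _, [], _ => 0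

theorem wordForm_eq_tail (u v : List (Letter C)) (c : B) :
    wordForm C u v c = wordForm C u.tail v.tail (headForm C u v c) := by
  cases u <;> cases v <;> simp [wordForm, headForm, wordForm_zero]

theorem star_headForm (u v : List (Letter C)) (c : B) :
    star (headForm C u v c) = headForm C v u (star c) := by
  cases u <;> cases v <;> simp [headForm, star_letterForm]

/-- The part of a word that starts in `H°ᵢ`: its first letter, or zero. -/
noncomputable def headIn (i : ι) : List (Letter C) → H i
  | [] => 0
  | x :: _ => if e : x.1 = i then (e ▸ x.2).1 else 0

theorem headForm_sum {κ : Type*} [Fintype κ] [DecidableEq κ] (w : κ → List (Letter C))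
    (d : CStarMatrix κ κ B) :
    ∃ s : Finset ι, ∀ k l, headForm C (w k) (w l) (∑ m, star (d m k) * d m l)
      = (∑ m, star (if w k = [] then d m k else 0) * (if w l = [] then d m l else 0))
        + ∑ i ∈ s, ∑ m, inner B ((C i).left (d m k) (headIn C i (w k)))
            ((C i).left (d m l) (headIn C i (w l))) := by
  classical
  refine ⟨Finset.univ.biUnion fun k => ((w k).map Sigma.fst).toFinset, fun k l => ?_⟩
  set s := Finset.univ.biUnion fun k => ((w k).map Sigma.fst).toFinset with hs
  have hmem : ∀ k x u, w k = x :: u → x.1 ∈ s := fun k x u h => by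
    rw [hs, Finset.mem_biUnion]
    exact ⟨k, Finset.mem_univ _, by simp [h]⟩
  rcases hk : w k with _ | ⟨x, u⟩ <;> rcases hl : w l with _ | ⟨y, v⟩
  · simp [headForm, headIn, ip_zero_right]
  · simp [headForm, headIn, ip_zero_left]
  · simp [headForm, headIn, ip_zero_right]
  · simp only [headForm, reduceCtorEq, if_false, mul_zero, star_zero, Finset.sum_const_zero,
      zero_add]
    rw [Finset.sum_eq_single x.1 (fun i _ hi => by
      simp [headIn, Ne.symm hi, ip_zero_left]) (fun h => absurd (hmem k x u hk) h)]
    by_cases e : y.1 = x.1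
    · obtain ⟨i, h⟩ := x
      obtain ⟨j, k'⟩ := y
      obtain rfl : j = i := e
      rw [letterForm_same]
      simp only [headIn, dif_pos, inner_left_left, ← left_mul]
      rw [← ip_sum_right]
      congr 1
      simp only [left, map_sum, sum_apply]
    · rw [letterForm_ne C e]
      simp [headIn, e, ip_zero_right]

theorem headForm_posSemidef {κ : Type*} [Fintype κ] [DecidableEq κ] (w : κ → List (Letter C))
    {c : CStarMatrix κ κ B} (hc : 0 ≤ c) :
    0 ≤ (CStarMatrix.ofMatrix (Matrix.of fun k l => headForm C (w k) (w l) (c k l)) :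
      CStarMatrix κ κ B) := by
  obtain ⟨d, hd⟩ := exists_gram hc
  have hc' : ∀ k l, star (c l k) = c k l := fun k l => by
    rw [hd, hd, star_sum]
    simp only [star_mul, star_star]
  refine nonneg_of_quadForm _ (fun k l => ?_) fun β => ?_
  · rw [star_headForm, hc']
  · obtain ⟨s, hs⟩ := headForm_sum C w d
    simp only [hd, hs, mul_add, add_mul, Finset.sum_add_distrib]
    refine add_nonneg ?_ ?_
    · rw [sum_gram (fun m k => if w k = [] then d m k else 0) β]
      exact Finset.sum_nonneg fun m _ => star_mul_self_nonneg _
    · have e : ∑ k, ∑ l, star (β k) * (∑ i ∈ s, ∑ m, (inner B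
            ((C i).left (d m k) (headIn C i (w k))) ((C i).left (d m l) (headIn C i (w l))) : B))
            * β l
          = ∑ i ∈ s, ∑ k, ∑ l, star (β k) * (∑ m, (inner B
            ((C i).left (d m k) (headIn C i (w k))) ((C i).left (d m l) (headIn C i (w l))) : B))
            * β l := by
        simp only [Finset.mul_sum (s := s), Finset.sum_mul (s := s)]
        exact (Finset.sum_congr rfl fun k _ => Finset.sum_comm).trans Finset.sum_comm
      rw [e]
      refine Finset.sum_nonneg fun i _ => ?_
      rw [sum_gram_inner (fun m k => (C i).left (d m k) (headIn C i (w k))) β]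
      exact Finset.sum_nonneg fun m _ => ip_self_nonneg _

theorem wordForm_posSemidef {κ : Type*} [Fintype κ] [DecidableEq κ] (n : ℕ) :
    ∀ (w : κ → List (Letter C)) (_ : ∀ k, (w k).length ≤ n) (c : CStarMatrix κ κ B) (_ : 0 ≤ c)
      (β : κ → B), 0 ≤ ∑ k, ∑ l, star (β k) * wordForm C (w k) (w l) (c k l) * β l := by
  induction n with
  | zero =>
    intro w hw c hc β
    have h : ∀ k, w k = [] := fun k => List.length_eq_zero_iff.1 (Nat.le_zero.1 (hw k))
    obtain ⟨d, hd⟩ := exists_gram hc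
    simp only [h, wordForm, hd]
    rw [sum_gram (fun m k => d m k) β]
    exact Finset.sum_nonneg fun m _ => star_mul_self_nonneg _
  | succ n ih =>
    intro w hw c hc β
    have := ih (fun k => (w k).tail) (fun k => by
      have := hw k
      rw [List.length_tail]; omega) _ (headForm_posSemidef C w hc) β
    have e : ∀ k l, wordForm C (w k) (w l) (c k l)
        = wordForm C (w k).tail (w l).tail (headForm C (w k) (w l) (c k l)) :=
      fun k l => wordForm_eq_tail C _ _ _
    simp only [e]
    exact this

/-- Reduced words: consecutive letters are from different `H°ᵢ`. -/
abbrev Word : Type _ := {u : List (Letter C) // u.IsChain fun x y => x.1 ≠ y.1}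

/-- The free right `B`-module on the reduced words. With the semi-inner product below, its
separation-completion is `B ξ ⊕ ⨁ H°_{j₁} ⊗_B … ⊗_B H°_{jₖ}` (sum over `k ≥ 1` and
`j₁ ≠ j₂ ≠ … ≠ jₖ`); the word `[h₁, …, hₖ]` stands for `h₁ ⊗ … ⊗ hₖ`, the empty word for `ξ`. -/
def PreFock : Type _ := Word C →₀ B

noncomputable instance : AddCommGroup (PreFock C) := inferInstanceAs (AddCommGroup (Word C →₀ B))

noncomputable instance : Module ℂ (PreFock C) := inferInstanceAs (Module ℂ (Word C →₀ B))

noncomputable instance : Module Bᵐᵒᵖ (PreFock C) := inferInstanceAs (Module Bᵐᵒᵖ (Word C →₀ B))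

/-- The element `w b` of the free module. -/
noncomputable def single (w : Word C) (b : B) : PreFock C := Finsupp.single w b

/-- The right `B`-linear extension of a map on words. -/
noncomputable def extendWords {P : Type*} [AddCommGroup P] [Module Bᵐᵒᵖ P] (f : Word C → P) :
    PreFock C →+ P :=
  Finsupp.liftAddHom fun w =>
    { toFun := fun b => MulOpposite.op b • f w
      map_zero' := by simp
      map_add' := fun b c => by simp [add_smul] }

theorem extendWords_single {P : Type*} [AddCommGroup P] [Module Bᵐᵒᵖ P] (f : Word C → P)
    (w : Word C) (b : B) : extendWords C f (single C w b) = MulOpposite.op b • f w := by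
  exact Finsupp.liftAddHom_apply_single _ w b

theorem preFock_induction {p : PreFock C → Prop} (x : PreFock C) (h0 : p 0)
    (hs : ∀ w b, p (single C w b)) (ha : ∀ x y, p x → p y → p (x + y)) : p x :=
  Finsupp.induction_linear x h0 ha hs

theorem smul_single (c : ℂ) (w : Word C) (b : B) : c • single C w b = single C w (c • b) :=
  Finsupp.smul_single c w b

theorem op_smul_single (c : B) (w : Word C) (b : B) :
    MulOpposite.op c • single C w b = single C w (b * c) :=
  Finsupp.smul_single (MulOpposite.op c) w b

/-- `⟨∑ w b_w, ∑ w' b'_{w'}⟩ = ∑ b_w⋆ ⟨w, w'⟩ b'_{w'}`. -/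
noncomputable def preForm (x y : Word C →₀ B) : B :=
  x.sum fun w b => y.sum fun w' b' => star b * wordForm C w.1 w'.1 1 * b'

theorem preForm_add_right (x y z : Word C →₀ B) :
    preForm C x (y + z) = preForm C x y + preForm C x z := by
  simp only [preForm]
  rw [← Finsupp.sum_add]
  congr 1
  funext w b
  exact Finsupp.sum_add_index' (by simp) (by intros; rw [mul_add])

theorem preForm_zero_right (x : Word C →₀ B) : preForm C x 0 = 0 := by
  simp [preForm]

theorem preForm_single_right (x : Word C →₀ B) (w' : Word C) (b' : B) :
    preForm C x (Finsupp.single w' b')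
      = x.sum fun w b => star b * wordForm C w.1 w'.1 1 * b' := by
  unfold preForm
  congr 1
  funext w b
  exact Finsupp.sum_single_index (by simp)

theorem preForm_smul_right (x : Word C →₀ B) (c : ℂ) (y : Word C →₀ B) :
    preForm C x (c • y) = c • preForm C x y := by
  induction y using Finsupp.induction_linear with
  | zero => rw [smul_zero, preForm_zero_right, smul_zero]
  | add y z hy hz => rw [smul_add, preForm_add_right, preForm_add_right, hy, hz, smul_add]
  | single w' b' =>
    rw [Finsupp.smul_single, preForm_single_right, preForm_single_right, Finsupp.smul_sum]
    simp only [mul_smul_comm]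

theorem preForm_op_smul_right (x y : Word C →₀ B) (c : B) :
    preForm C x (MulOpposite.op c • y) = preForm C x y * c := by
  induction y using Finsupp.induction_linear with
  | zero => rw [smul_zero, preForm_zero_right, zero_mul]
  | add y z hy hz => rw [smul_add, preForm_add_right, preForm_add_right, hy, hz, add_mul]
  | single w' b' =>
    rw [Finsupp.smul_single, preForm_single_right, preForm_single_right, Finsupp.sum_mul]
    simp only [op_smul_eq_mul, mul_assoc]

theorem star_preForm (x y : Word C →₀ B) : star (preForm C x y) = preForm C y x := by
  simp only [preForm, Finsupp.sum, star_sum]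
  rw [Finset.sum_comm]
  refine Finset.sum_congr rfl fun w _ => Finset.sum_congr rfl fun w' _ => ?_
  simp [star_wordForm, mul_assoc]

theorem preForm_self_nonneg (x : Word C →₀ B) : 0 ≤ preForm C x x := by
  classical
  have h1 := wordForm_posSemidef C (κ := x.support) (x.support.sup fun w => w.1.length)
    (fun k => k.1.1) (fun k => Finset.le_sup (f := fun w : Word C => w.1.length) k.2)
    (CStarMatrix.ofMatrix (Matrix.of fun _ _ => 1)) (by
      refine nonneg_of_quadForm _ (fun _ _ => star_one B) fun β => ?_
      have : ∑ k, ∑ l, star (β k) * 1 * β l = star (∑ k, β k) * ∑ l, β l := by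
        rw [star_sum, Finset.sum_mul_sum]; simp
      rw [this]
      exact star_mul_self_nonneg _) (fun k => x k.1)
  have h2 : preForm C x x = ∑ k : x.support, ∑ l : x.support,
      star (x k.1) * wordForm C k.1.1 l.1.1 1 * x l.1 := by
    simp only [preForm, Finsupp.sum]
    rw [← Finset.sum_coe_sort]
    refine Finset.sum_congr rfl fun k _ => ?_
    rw [← Finset.sum_coe_sort]
  rw [h2]
  exact h1

noncomputable instance : PreHilbertModule B (PreFock C) where
  inner := preForm C
  ip_add_right := preForm_add_right C
  ip_smul_right := preForm_smul_right C
  ip_op_smul_right := preForm_op_smul_right C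
  ip_star := star_preForm C
  ip_self_nonneg := preForm_self_nonneg C

theorem inner_single_single (w w' : Word C) (b b' : B) :
    (inner B (single C w b) (single C w' b') : B) = star b * wordForm C w.1 w'.1 1 * b' :=
  (preForm_single_right C _ w' b').trans (Finsupp.sum_single_index (by simp))

noncomputable instance : SeminormedAddCommGroup (PreFock C) :=
  let _ : Norm (PreFock C) := toNorm B (PreFock C)
  SeminormedAddCommGroup.ofCore (core B (PreFock C))

noncomputable instance : NormedSpace ℂ (PreFock C) where
  norm_smul_le c x := ((core B (PreFock C)).norm_smul c x).le

theorem preFock_norm (x : PreFock C) : ‖x‖ = √‖(inner B x x : B)‖ := rfl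

theorem preFock_norm_sq (x : PreFock C) : ‖x‖ ^ 2 = ‖(inner B x x : B)‖ := by
  rw [preFock_norm, Real.sq_sqrt (norm_nonneg _)]

theorem preFock_norm_inner_le (x y : PreFock C) : ‖(inner B x y : B)‖ ≤ ‖x‖ * ‖y‖ := by
  rw [preFock_norm, preFock_norm, ← Real.sqrt_mul (norm_nonneg _)]
  exact Real.le_sqrt_of_sq_le (norm_ip_sq_le x y)

instance : UniformContinuousConstSMul Bᵐᵒᵖ (PreFock C) where
  uniformContinuous_const_smul b := by
    let f : PreFock C →+ PreFock C := DistribSMul.toAddMonoidHom _ b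
    refine (AddMonoidHomClass.lipschitz_of_bound f ‖b‖ fun x => ?_).uniformContinuous
    refine le_of_sq_le_sq ?_ (by positivity)
    have : f x = MulOpposite.op b.unop • x := rfl
    rw [this, preFock_norm_sq, ip_op_smul_right, ip_op_smul_left, mul_pow, preFock_norm_sq]
    refine (norm_mul_le _ _).trans ?_
    refine (mul_le_mul_of_nonneg_right (norm_mul_le _ _) (norm_nonneg _)).trans (le_of_eq ?_)
    rw [norm_star, MulOpposite.norm_unop]
    ring

/-- The free product `H` of the pointed correspondences, as a right Hilbert `B`-module. -/
abbrev FreeProd : Type _ := UniformSpace.Completion (PreFock C)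

theorem preFock_continuous_inner :
    Continuous fun p : PreFock C × PreFock C => (inner B p.1 p.2 : B) := by
  rw [continuous_iff_continuousAt]
  rintro ⟨x, y⟩
  rw [ContinuousAt, tendsto_iff_norm_sub_tendsto_zero]
  have h : Filter.Tendsto (fun p : PreFock C × PreFock C => ‖p.1 - x‖ * ‖p.2‖ + ‖x‖ * ‖p.2 - y‖)
      (nhds (x, y)) (nhds 0) := by
    have : Continuous fun p : PreFock C × PreFock C =>
        ‖p.1 - x‖ * ‖p.2‖ + ‖x‖ * ‖p.2 - y‖ := by fun_prop
    simpa using this.tendsto (x, y)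
  refine squeeze_zero (fun _ => norm_nonneg _) (fun p => ?_) h
  have e : (inner B p.1 p.2 : B) - inner B x y = inner B (p.1 - x) p.2 + inner B x (p.2 - y) := by
    rw [ip_sub_left, ip_sub_right]; abel
  rw [e]
  exact (norm_add_le _ _).trans (add_le_add (preFock_norm_inner_le C _ _)
    (preFock_norm_inner_le C _ _))

theorem inner_coe_coe (x y : PreFock C) :
    (inner B (x : FreeProd C) (y : FreeProd C) : B) = inner B x y :=
  (UniformSpace.Completion.isDenseInducing_coe.prodMap
    UniformSpace.Completion.isDenseInducing_coe).extend_eq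
    (f := Function.uncurry (inner B)) (preFock_continuous_inner C) (x, y)

theorem continuous_inner_freeProd :
    Continuous fun p : FreeProd C × FreeProd C => (inner B p.1 p.2 : B) := by
  let inner' : PreFock C →+ PreFock C →+ B :=
    { toFun := fun x =>
        { toFun := fun y => inner B x y
          map_zero' := ip_zero_right x
          map_add' := fun y z => ip_add_right x y z }
      map_zero' := by ext y; exact ip_zero_left y
      map_add' := fun x y => by ext z; exact ip_add_left x y z }
  have : Continuous fun p : PreFock C × PreFock C => inner' p.1 p.2 := preFock_continuous_inner C
  exact (UniformSpace.Completion.isDenseInducing_toCompl (PreFock C)).extend_Z_bilin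
    (UniformSpace.Completion.isDenseInducing_toCompl (PreFock C)) this

noncomputable instance : RightHilbertModule B (FreeProd C) where
  ip_add_right x y z := by
    have := continuous_inner_freeProd C
    refine UniformSpace.Completion.induction_on₃ x y z (isClosed_eq ?_ ?_) fun x y z => ?_
    · exact this.comp (f := fun p : FreeProd C × FreeProd C × FreeProd C => (p.1, p.2.1 + p.2.2))
        (by fun_prop)
    · exact (this.comp (f := fun p : FreeProd C × FreeProd C × FreeProd C => (p.1, p.2.1))
        (by fun_prop)).add
        (this.comp (f := fun p : FreeProd C × FreeProd C × FreeProd C => (p.1, p.2.2))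
        (by fun_prop))
    · rw [← UniformSpace.Completion.coe_add, inner_coe_coe, inner_coe_coe, inner_coe_coe,
        ip_add_right]
  ip_smul_right x c y := by
    have := continuous_inner_freeProd C
    refine UniformSpace.Completion.induction_on₂ x y (isClosed_eq ?_ ?_) fun x y => ?_
    · have hs : Continuous fun y : FreeProd C => c • y := continuous_const_smul c
      exact this.comp (continuous_fst.prodMk (hs.comp continuous_snd))
    · exact this.const_smul c
    · rw [← UniformSpace.Completion.coe_smul, inner_coe_coe, inner_coe_coe, ip_smul_right]
  ip_op_smul_right x y b := by
    have := continuous_inner_freeProd C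
    refine UniformSpace.Completion.induction_on₂ x y (isClosed_eq ?_ ?_) fun x y => ?_
    · have hs : Continuous fun y : FreeProd C => MulOpposite.op b • y :=
        UniformSpace.Completion.continuous_map
      exact this.comp (continuous_fst.prodMk (hs.comp continuous_snd))
    · exact this.mul continuous_const
    · rw [← UniformSpace.Completion.coe_smul, inner_coe_coe, inner_coe_coe, ip_op_smul_right]
  ip_star x y := by
    have := continuous_inner_freeProd C
    refine UniformSpace.Completion.induction_on₂ x y (isClosed_eq this.star ?_) fun x y => ?_
    · exact this.comp continuous_swap
    · rw [inner_coe_coe, inner_coe_coe, ip_star]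
  ip_self_nonneg x := by
    have := continuous_inner_freeProd C
    refine UniformSpace.Completion.induction_on x ?_ fun x => ?_
    · exact (CStarAlgebra.isClosed_nonneg (A := B)).preimage
        (this.comp (continuous_id.prodMk continuous_id))
    · rw [inner_coe_coe]; exact ip_self_nonneg x
  norm_sq x := by
    have := continuous_inner_freeProd C
    refine UniformSpace.Completion.induction_on x (isClosed_eq (by fun_prop) ?_) fun x => ?_
    · exact (this.comp (continuous_id.prodMk continuous_id)).norm
    · rw [inner_coe_coe, UniformSpace.Completion.norm_coe, preFock_norm_sq]


theorem op_smul_smul_comm {P : Type*} [NormedAddCommGroup P] [NormedSpace ℂ P] [Module Bᵐᵒᵖ P]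
    [RightHilbertModule B P] (c : ℂ) (b : B) (x : P) :
    MulOpposite.op (c • b) • x = c • (MulOpposite.op b • x) := by
  rw [← sub_eq_zero]
  refine eq_zero_of_inner_self (B := B) ?_
  have h : ∀ y : P, (inner B y (MulOpposite.op (c • b) • x - c • (MulOpposite.op b • x)) : B) = 0 :=
    fun y => by
      rw [ip_sub_right, ip_op_smul_right, ip_smul_right, ip_op_smul_right, mul_smul_comm, sub_self]
  exact h _

/-- Words that do not start with a letter from `H°ᵢ`. -/
abbrev WordNotFrom (i : ι) : Type _ := {w : Word C // ∀ x ∈ w.1.head?, x.1 ≠ i}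

/-- The empty word. -/
def nilWord : Word C := ⟨[], List.IsChain.nil⟩

/-- The word `h ⊗ w` for `h ∈ H°ᵢ` and a word `w` that does not start with a letter from `H°ᵢ`. -/
def consWord (i : ι) (h : (C i).Centered) (w : WordNotFrom C i) : Word C :=
  ⟨⟨i, h⟩ :: w.1.1, List.isChain_cons.2 ⟨fun y hy => (w.2 y hy).symm, w.1.2⟩⟩

/-- The decomposition `H ≅ Hᵢ ⊗_B Mᵢ` on words: a word that starts with `h ∈ H°ᵢ` is `h ⊗ w`, any
other word `w` is `ξᵢ ⊗ w`. -/
def split (i : ι) : Word C → H i × WordNotFrom C i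
  | ⟨[], hw⟩ => ((C i).ξ, ⟨⟨[], hw⟩, by simp⟩)
  | ⟨x :: u, hw⟩ =>
    if e : x.1 = i then
      ((e ▸ x.2).1, ⟨⟨u, (List.isChain_cons.1 hw).2⟩, fun y hy =>
        e ▸ ((List.isChain_cons.1 hw).1 y hy).symm⟩)
    else ((C i).ξ, ⟨⟨x :: u, hw⟩, by simpa using e⟩)

/-- The left action of `B` on words. -/
noncomputable def leftWord (b : B) : Word C → PreFock C
  | ⟨[], hw⟩ => single C ⟨[], hw⟩ b
  | ⟨x :: u, hw⟩ => single C ⟨⟨x.1, (C x.1).leftCentered b x.2⟩ :: u,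
      List.isChain_cons.2 (List.isChain_cons.1 hw)⟩ 1

/-- The vector of the free product that corresponds to `h ⊗ w ∈ Hᵢ ⊗_B Mᵢ`, namely
`⟨ξᵢ, h⟩ w + (h - ξᵢ⟨ξᵢ, h⟩) ⊗ w`. -/
noncomputable def attach (i : ι) (h : H i) (w : WordNotFrom C i) : PreFock C :=
  leftWord C (inner B (C i).ξ h) w.1 + single C (consWord C i ((C i).center h) w) 1

/-- The operator `a ⊗ id` on `Hᵢ ⊗_B Mᵢ`, on words. -/
noncomputable def actWord (i : ι) (a : A i) (w : Word C) : PreFock C :=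
  attach C i ((C i).rep a (split C i w).1) (split C i w).2

/-- The operator `a ⊗ id` on `Hᵢ ⊗_B Mᵢ`, before completion. -/
noncomputable def preAct (i : ι) (a : A i) : PreFock C →ₗ[ℂ] PreFock C :=
  { extendWords C (actWord C i a) with
    map_smul' := fun c x => by
      change extendWords C (actWord C i a) (c • x) = c • extendWords C (actWord C i a) x
      refine preFock_induction C (p := fun x => extendWords C (actWord C i a) (c • x)
        = c • extendWords C (actWord C i a) x) x ?_ (fun w b => ?_) fun x y hx hy => ?_
      · rw [smul_zero, map_zero, smul_zero]
      · rw [smul_single, extendWords_single, extendWords_single]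
        exact Finsupp.ext fun v => (mul_smul_comm c _ b)
      · rw [smul_add, map_add, map_add, hx, hy, smul_add] }

theorem preAct_single (i : ι) (a : A i) (w : Word C) (b : B) :
    preAct C i a (single C w b) = MulOpposite.op b • actWord C i a w :=
  extendWords_single C _ w b

theorem letterForm_left (x y : Letter C) (b c : B) :
    letterForm C x ⟨y.1, (C y.1).leftCentered b y.2⟩ c = letterForm C x y (c * b) := by
  obtain ⟨i, h⟩ := x
  obtain ⟨j, k⟩ := y
  by_cases e : j = i
  · subst e
    rw [letterForm_same, letterForm_same, left_mul]
    rfl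
  · rw [letterForm_ne C (by simpa using e), letterForm_ne C (by simpa using e)]

theorem inner_single_attach (i : ι) (w : Word C) (k : H i) (v : WordNotFrom C i) :
    (inner B (single C w 1) (attach C i k v) : B)
      = wordForm C (split C i w).2.1.1 v.1.1 (inner B (split C i w).1 k) := by
  obtain ⟨⟨v, hv⟩, hv'⟩ := v
  rw [attach, ip_add_right]
  rcases w with ⟨_ | ⟨x, u⟩, hw⟩
  · rcases v with _ | ⟨y, v⟩
    · simp [split, leftWord, inner_single_single, consWord, wordForm]
    · simp [split, leftWord, inner_single_single, consWord, wordForm]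
  · by_cases e : x.1 = i
    · obtain ⟨j, h⟩ := x
      obtain rfl : j = i := e
      have h1 : (inner B h.1 ((C j).center k).1 : B) = inner B h.1 k := by
        have : (inner B h.1 (C j).ξ : B) = 0 := by rw [← ip_star, h.2, star_zero]
        rw [center, ip_sub_right, ip_op_smul_right, this, zero_mul, sub_zero]
      have h2 : (inner B (single C ⟨⟨j, h⟩ :: u, hw⟩ 1)
          (leftWord C (inner B (C j).ξ k) ⟨v, hv⟩) : B) = 0 := by
        rcases v with _ | ⟨y, v⟩
        · simp [leftWord, inner_single_single, wordForm]
        · have hy : y.1 ≠ j := hv' y (by simp)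
          simp [leftWord, inner_single_single, wordForm, letterForm_left, letterForm_ne C
            (x := ⟨j, h⟩) (y := y) hy, wordForm_zero]
      rw [h2, zero_add, inner_single_single]
      simp [split, consWord, wordForm, letterForm_same, left_one, h1]
    · have h2 : (inner B (single C ⟨x :: u, hw⟩ 1)
          (single C (consWord C i ((C i).center k) ⟨⟨v, hv⟩, hv'⟩) 1) : B) = 0 := by
        have : letterForm C x ⟨i, (C i).center k⟩ 1 = 0 := letterForm_ne C (Ne.symm e) 1
        simp [inner_single_single, consWord, wordForm, this, wordForm_zero]
      rw [h2, add_zero]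
      rcases v with _ | ⟨y, v⟩
      · simp [split, e, leftWord, inner_single_single, wordForm]
      · simp [split, e, leftWord, inner_single_single, wordForm, letterForm_left]

theorem inner_attach_attach (i : ι) (h k : H i) (w v : WordNotFrom C i) :
    (inner B (attach C i h w) (attach C i k v) : B) = wordForm C w.1.1 v.1.1 (inner B h k) := by
  rw [attach, ip_add_left]
  have h1 : (inner B (single C (consWord C i ((C i).center h) w) 1) (attach C i k v) : B)
      = wordForm C w.1.1 v.1.1 (inner B ((C i).center h).1 k) := by
    rw [inner_single_attach]
    simp [split, consWord]
  have h2 : (inner B (leftWord C (inner B (C i).ξ h) w.1) (attach C i k v) : B)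
      = wordForm C w.1.1 v.1.1 (star (inner B (C i).ξ h : B) * inner B (C i).ξ k) := by
    obtain ⟨⟨w, hw⟩, hw'⟩ := w
    set b : B := inner B (C i).ξ h with hb
    rcases w with _ | ⟨x, u⟩
    · have e : leftWord C b ⟨[], hw⟩ = MulOpposite.op b • single C ⟨[], hw⟩ 1 := by
        rw [op_smul_single, one_mul]; rfl
      rw [e, ip_op_smul_left, inner_single_attach]
      rcases v with ⟨⟨_ | ⟨y, v⟩, hv⟩, hv'⟩ <;> simp [split, wordForm]
    · have hx : x.1 ≠ i := hw' x (by simp)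
      rw [leftWord, inner_single_attach]
      rcases v with ⟨⟨_ | ⟨y, v⟩, hv⟩, hv'⟩
      · simp [split, hx, wordForm]
      · simp only [split, hx, dif_neg, not_false_eq_true, wordForm]
        rw [← star_star (letterForm C ⟨x.1, _⟩ y _), star_letterForm, letterForm_left,
          star_letterForm, star_mul, star_star]
  rw [h1, h2, ← wordForm_add]
  congr 1
  rw [center, ip_sub_left, ip_op_smul_left]
  simp

theorem wordForm_split (i : ι) (w v : Word C) :
    wordForm C w.1 v.1 1 = wordForm C (split C i w).2.1.1 (split C i v).2.1.1
      (inner B (split C i w).1 (split C i v).1) := by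
  have hl : ∀ h : (C i).Centered, (inner B h.1 (C i).ξ : B) = 0 := fun h => by
    rw [← ip_star, h.2, star_zero]
  rcases w with ⟨_ | ⟨x, u⟩, hw⟩ <;> rcases v with ⟨_ | ⟨y, v⟩, hv⟩
  · simp [split, inner_ξ_ξ]
  · by_cases ey : y.1 = i
    · obtain ⟨j, k⟩ := y
      obtain rfl : j = i := ey
      simp [split, wordForm, k.2, wordForm_zero]
    · simp [split, ey, wordForm]
  · by_cases ex : x.1 = i
    · obtain ⟨j, h⟩ := x
      obtain rfl : j = i := ex
      simp [split, wordForm, hl, wordForm_zero]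
    · simp [split, ex, wordForm]
  · by_cases ex : x.1 = i <;> by_cases ey : y.1 = i
    · obtain ⟨j, h⟩ := x
      obtain rfl : j = i := ex
      obtain ⟨j, k⟩ := y
      obtain rfl : j = _ := ey
      simp [split, wordForm, letterForm_same, left_one]
    · obtain ⟨j, h⟩ := x
      obtain rfl : j = i := ex
      simp [split, ey, wordForm, letterForm_ne C (x := ⟨j, h⟩) (y := y) ey, hl, wordForm_zero]
    · obtain ⟨j, k⟩ := y
      obtain rfl : j = i := ey
      simp [split, ex, wordForm, letterForm_ne C (x := x) (y := ⟨j, k⟩) (Ne.symm ex), k.2,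
        wordForm_zero]
    · simp [split, ex, ey, inner_ξ_ξ]

theorem letterForm_smul (x y : Letter C) (c : ℂ) (b : B) :
    letterForm C x y (c • b) = c • letterForm C x y b := by
  unfold letterForm
  split_ifs
  · simp [left, ip_smul_right]
  · simp

theorem wordForm_smul : ∀ (u v : List (Letter C)) (c : ℂ) (b : B),
    wordForm C u v (c • b) = c • wordForm C u v b
  | [], [], _, _ => by simp [wordForm]
  | x :: u, y :: v, c, b => by simp only [wordForm, letterForm_smul C x y, wordForm_smul u v]
  | [], _ :: _, _, _ => by simp [wordForm]
  | _ :: _, [], _, _ => by simp [wordForm]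

/-- `⟨a x, a' y⟩` for words `x`, `y` with coefficients. -/
theorem inner_preAct_single (i : ι) (a a' : A i) (w v : Word C) (b b' : B) :
    (inner B (preAct C i a (single C w b)) (preAct C i a' (single C v b')) : B)
      = star b * wordForm C (split C i w).2.1.1 (split C i v).2.1.1
          (inner B ((C i).rep a (split C i w).1) ((C i).rep a' (split C i v).1)) * b' := by
  rw [preAct_single, preAct_single, ip_op_smul_left, ip_op_smul_right, actWord, actWord,
    inner_attach_attach, mul_assoc]

theorem preAct_gram (i : ι) (a c : A i) (r : ℂ)
    (h : star a * a + star c * c = algebraMap ℂ (A i) r) (x y : PreFock C) :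
    (inner B (preAct C i a x) (preAct C i a y) : B) + inner B (preAct C i c x) (preAct C i c y)
      = r • inner B x y := by
  refine preFock_induction C (p := fun x => (inner B (preAct C i a x) (preAct C i a y) : B)
    + inner B (preAct C i c x) (preAct C i c y) = r • inner B x y) x ?_ (fun w b => ?_)
    fun x x' hx hx' => ?_
  · simp [ip_zero_left]
  · refine preFock_induction C (p := fun y => (inner B (preAct C i a (single C w b))
      (preAct C i a y) : B) + inner B (preAct C i c (single C w b)) (preAct C i c y)
      = r • inner B (single C w b) y) y ?_ (fun v b' => ?_) fun y y' hy hy' => ?_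
    · simp [ip_zero_right]
    · rw [inner_preAct_single, inner_preAct_single, inner_single_single, ← add_mul, ← mul_add,
        ← wordForm_add, wordForm_split C i, ← smul_mul_assoc, ← mul_smul_comm, ← wordForm_smul,
        inner_rep_left, inner_rep_left, ← ip_add_right, ← ip_smul_right]
      have e : (C i).rep (star a) ((C i).rep a (split C i v).1)
          + (C i).rep (star c) ((C i).rep c (split C i v).1) = r • (split C i v).1 := by
        have := congrArg (fun T => (C i).rep T (split C i v).1) h
        simpa [Algebra.algebraMap_eq_smul_one] using this
      rw [e]
    · rw [map_add, map_add, ip_add_right, ip_add_right, ip_add_right, smul_add, ← hy, ← hy']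
      abel
  · rw [map_add, map_add, ip_add_left, ip_add_left, ip_add_left, smul_add, ← hx, ← hx']
    abel

theorem norm_preAct_le (i : ι) (a : A i) (x : PreFock C) : ‖preAct C i a x‖ ≤ ‖a‖ * ‖x‖ := by
  let _ := CStarAlgebra.spectralOrder (A i)
  let _ := CStarAlgebra.spectralOrderedRing (A i)
  have h0 : star a * a ≤ algebraMap ℝ (A i) (‖a‖ ^ 2) := by
    have := (IsSelfAdjoint.star_mul_self a).le_algebraMap_norm_self
    rwa [CStarRing.norm_star_mul_self, ← pow_two] at this
  obtain ⟨c, hc⟩ := exists_star_mul_self (sub_nonneg.2 h0)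
  have h1 := preAct_gram C i a c ((‖a‖ ^ 2 : ℝ) : ℂ) (by
    rw [← hc, add_sub_cancel]
    rw [Algebra.algebraMap_eq_smul_one, Algebra.algebraMap_eq_smul_one]
    exact (Complex.coe_smul _ _).symm) x x
  have h2 : (inner B (preAct C i a x) (preAct C i a x) : B)
      ≤ ((‖a‖ ^ 2 : ℝ) : ℂ) • inner B x x := by
    rw [← h1]
    exact le_add_of_nonneg_right (ip_self_nonneg _)
  have h3 := CStarAlgebra.norm_le_norm_of_nonneg_of_le (ip_self_nonneg _) h2
  rw [norm_smul, ← preFock_norm_sq, ← preFock_norm_sq, Complex.norm_real,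
    Real.norm_of_nonneg (by positivity), ← mul_pow] at h3
  exact le_of_sq_le_sq h3 (by positivity)

/-- The operator `ρᵢ(a) = a ⊗ id` on the free product `H ≅ Hᵢ ⊗_B Mᵢ`. -/
noncomputable def act (i : ι) (a : A i) : FreeProd C →L[ℂ] FreeProd C :=
  (Completion.toComplL.comp ((preAct C i a).mkContinuous ‖a‖ (norm_preAct_le C i a))).extend
    (Completion.toComplL (𝕜 := ℂ) (E := PreFock C))

theorem act_coe (i : ι) (a : A i) (x : PreFock C) :
    act C i a (x : FreeProd C) = (preAct C i a x : PreFock C) :=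
  ContinuousLinearMap.extend_eq _ Completion.denseRange_coe
    (Completion.isUniformInducing_coe _) x

/-- The inclusion `Hᵢ → H`, before completion. -/
noncomputable def preEmb (i : ι) (h : H i) : PreFock C := attach C i h ⟨nilWord C, by simp [nilWord]⟩

/-- The adjoint of the inclusion `Hᵢ → H` on words: `ξ ↦ ξᵢ`, `h ↦ h` for `h ∈ H°ᵢ`, and all other
words are mapped to `0`. -/
noncomputable def projWord (i : ι) (w : Word C) : H i :=
  match (split C i w).2.1.1 with
  | [] => (split C i w).1
  | _ :: _ => 0

noncomputable def preProj (i : ι) : PreFock C →ₗ[ℂ] H i :=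
  { extendWords C (projWord C i) with
    map_smul' := fun c x => by
      change extendWords C (projWord C i) (c • x) = c • extendWords C (projWord C i) x
      refine preFock_induction C (p := fun x => extendWords C (projWord C i) (c • x)
        = c • extendWords C (projWord C i) x) x ?_ (fun w b => ?_) fun x y hx hy => ?_
      · rw [smul_zero, map_zero, smul_zero]
      · rw [smul_single, extendWords_single, extendWords_single, op_smul_smul_comm]
      · rw [smul_add, map_add, map_add, hx, hy, smul_add] }

theorem preProj_single (i : ι) (w : Word C) (b : B) :
    preProj C i (single C w b) = MulOpposite.op b • projWord C i w :=
  extendWords_single C _ w b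

theorem inner_preEmb (i : ι) (h : H i) (x : PreFock C) :
    (inner B (preEmb C i h) x : B) = inner B h (preProj C i x) := by
  refine preFock_induction C (p := fun x => (inner B (preEmb C i h) x : B)
    = inner B h (preProj C i x)) x ?_ (fun w b => ?_) fun x y hx hy => ?_
  · simp [ip_zero_right]
  · rw [preProj_single, ip_op_smul_right, show single C w b = MulOpposite.op b • single C w 1 by
      rw [op_smul_single, one_mul], ip_op_smul_right, ← ip_star, preEmb, inner_single_attach,
      star_wordForm, ip_star, projWord]
    rcases hs : (split C i w).2.1.1 with _ | ⟨y, v⟩ <;> simp [nilWord, wordForm, ip_zero_right]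
  · rw [map_add, ip_add_right, ip_add_right, hx, hy]

theorem norm_preEmb (i : ι) (h : H i) : ‖preEmb C i h‖ = ‖h‖ := by
  have h1 : ‖preEmb C i h‖ ^ 2 = ‖h‖ ^ 2 := by
    rw [preFock_norm_sq, preEmb, inner_attach_attach, RightHilbertModule.norm_sq (B := B) h]
    simp [nilWord, wordForm]
  exact (pow_left_inj₀ (norm_nonneg _) (norm_nonneg _) two_ne_zero).1 h1

theorem norm_preProj_le (i : ι) (x : PreFock C) : ‖preProj C i x‖ ≤ 1 * ‖x‖ := by
  rw [one_mul]
  have h1 : ‖preProj C i x‖ ^ 2 ≤ ‖preProj C i x‖ * ‖x‖ := by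
    rw [RightHilbertModule.norm_sq (B := B), ← inner_preEmb]
    exact (preFock_norm_inner_le C _ _).trans_eq (by rw [norm_preEmb])
  rcases (norm_nonneg (preProj C i x)).eq_or_lt with h | h
  · rw [← h]; exact norm_nonneg _
  · rw [pow_two] at h1
    exact le_of_mul_le_mul_left h1 h

/-- The natural inclusion of `Hᵢ = B ξᵢ ⊕ H°ᵢ` onto the summands `B ξ ⊕ H°ᵢ` of `H`. -/
noncomputable def emb (i : ι) : H i →L[ℂ] FreeProd C :=
  have ext : ∀ x y : PreFock C, (∀ z, (inner B x z : B) = inner B y z) →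
      (x : FreeProd C) = y := fun x y hxy => by
    rw [← sub_eq_zero, ← Completion.coe_sub]
    refine eq_zero_of_inner_self (B := B) ?_
    rw [inner_coe_coe, ip_sub_left, hxy, sub_self]
  LinearMap.mkContinuous
    { toFun := fun h => (preEmb C i h : FreeProd C)
      map_add' := fun h k => by
        rw [← Completion.coe_add]
        exact ext _ _ fun z => by simp only [ip_add_left, inner_preEmb]
      map_smul' := fun c h => by
        rw [RingHom.id_apply, ← Completion.coe_smul]
        exact ext _ _ fun z => by simp only [ip_smul_left, inner_preEmb] }
    1 fun h => by
      rw [one_mul]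
      exact ((Completion.norm_coe _).trans (norm_preEmb C i h)).le

/-- The adjoint of the inclusion `Hᵢ → H`. -/
noncomputable def proj [∀ i, CompleteSpace (H i)] (i : ι) : FreeProd C →L[ℂ] H i :=
  ((preProj C i).mkContinuous 1 (norm_preProj_le C i)).extend
    (Completion.toComplL (𝕜 := ℂ) (E := PreFock C))

theorem proj_coe [∀ i, CompleteSpace (H i)] (i : ι) (x : PreFock C) :
    proj C i (x : FreeProd C) = preProj C i x :=
  ContinuousLinearMap.extend_eq _ Completion.denseRange_coe
    (Completion.isUniformInducing_coe _) x

theorem inner_emb [∀ i, CompleteSpace (H i)] (i : ι) (h : H i) (x : FreeProd C) :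
    (inner B (emb C i h) x : B) = inner B h (proj C i x) := by
  have hc : Continuous fun y : H i => (inner B h y : B) := by
    let f : H i →ₗ[ℂ] B :=
      { toFun := fun y => inner B h y
        map_add' := ip_add_right h
        map_smul' := ip_smul_right h }
    refine (f.mkContinuous ‖h‖ fun y => ?_).continuous
    refine le_of_sq_le_sq ?_ (by positivity)
    rw [mul_pow, RightHilbertModule.norm_sq (B := B) h, RightHilbertModule.norm_sq (B := B) y]
    exact norm_ip_sq_le h y
  refine Completion.induction_on x (isClosed_eq ?_ ?_) fun x => ?_
  · exact (continuous_inner_freeProd C).comp (continuous_const.prodMk continuous_id)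
  · exact hc.comp (proj C i).continuous
  · rw [proj_coe, ← inner_preEmb]
    exact inner_coe_coe C _ _

/-- The vacuum vector `ξ`. -/
noncomputable def vacuum : FreeProd C := (single C (nilWord C) 1 : PreFock C)

/-- The free product C⋆-algebra: the closed algebra of operators on `H` generated by all `ρᵢ(Aᵢ)`
(it is closed under adjoints since every `Aᵢ` is). -/
noncomputable def freeProductAlgebra : Subalgebra ℂ (FreeProd C →L[ℂ] FreeProd C) :=
  (Algebra.adjoin ℂ (⋃ i, Set.range (act C i))).topologicalClosure

/-- The copy of `a ∈ Aᵢ` in the free product. -/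
noncomputable def freeIncl (i : ι) (a : A i) : freeProductAlgebra C :=
  ⟨act C i a, Subalgebra.le_topologicalClosure _
    (Algebra.subset_adjoin (Set.mem_iUnion.2 ⟨i, a, rfl⟩))⟩

/-- The expectation `E[T] = ⟨ξ, T ξ⟩` of the free product. -/
noncomputable def freeExpect (T : freeProductAlgebra C) : B :=
  inner B (vacuum C) (T.1 (vacuum C))

/-- The canonical conditional expectation of the free product onto `Aᵢ`, as a map into the operators
on `Hᵢ`: the compression `T ↦ J⋆ T J` by the inclusion `J : Hᵢ → H`. -/
noncomputable def condExp [∀ i, CompleteSpace (H i)] (i : ι) (T : freeProductAlgebra C) :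
    H i →L[ℂ] H i :=
  (proj C i).comp (T.1.comp (emb C i))

end FreeProduct

section TwoFactors

variable {B : Type*} [CStarAlgebra B] [PartialOrder B] [StarOrderedRing B]
  {A H : Fin 2 → Type*} [∀ i, CStarAlgebra (A i)]
  [∀ i, NormedAddCommGroup (H i)] [∀ i, NormedSpace ℂ (H i)] [∀ i, Module Bᵐᵒᵖ (H i)]
  [∀ i, RightHilbertModule B (H i)] {S : ∀ i, ValuedProbSpace B (A i)}
  (C : ∀ i, PointedCorrespondence (S i) (H i))

/-- The copy of `B` in the free product (it is the same through either factor). -/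
noncomputable def freeBase (b : B) : freeProductAlgebra C := freeIncl C 0 ((S 0).incl b)

/-- The operator `V⋆ X V` in the free product, for `X` in the first factor and `V` in the second. -/
noncomputable def compressed (X : A 0) (V : A 1) : freeProductAlgebra C :=
  freeIncl C 1 (star V) * freeIncl C 0 X * freeIncl C 1 V

/-- The expectation `T ↦ E[V T V⋆]` on the free product. -/
noncomputable def compressedExpect (V : A 1) (T : freeProductAlgebra C) : B :=
  freeExpect C (freeIncl C 1 V * T * freeIncl C 1 (star V))

end TwoFactors

/-! ### Fully matricial functions and Cauchy transforms -/

section Matricial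

/-- `Mₙ(B)`, with its C⋆-algebra structure. -/
abbrev Mat (n : ℕ) (B : Type*) : Type _ := CStarMatrix (Fin n) (Fin n) B

/-- The matricial upper half-plane: the `z ∈ Mₙ(B)` such that `im z = (z - z⋆) / 2i ≥ ε 1` for some
`ε > 0`. -/
def upperHalf (B : Type*) [CStarAlgebra B] [PartialOrder B] [StarOrderedRing B] (n : ℕ) :
    Set (Mat n B) :=
  {z | ∃ ε : ℝ, 0 < ε ∧ ε • (1 : Mat n B) ≤ (2 * Complex.I)⁻¹ • (z - star z)}

/-- The amplification `x ⊗ Iₙ` of `x`. -/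
def amp {R : Type*} [Zero R] (n : ℕ) (x : R) : Mat n R :=
  CStarMatrix.ofMatrix (Matrix.diagonal fun _ => x)

/-- The direct sum `z ⊕ w` of square matrices. -/
def directSum {R : Type*} [Zero R] {n m : ℕ} (z : Mat n R) (w : Mat m R) : Mat (n + m) R :=
  CStarMatrix.ofMatrix (Matrix.reindex finSumFinEquiv finSumFinEquiv
    (Matrix.fromBlocks (CStarMatrix.ofMatrix.symm z) 0 0 (CStarMatrix.ofMatrix.symm w)))

/-- The direct sum of `m` copies of `z`. -/
def copies {R : Type*} [Zero R] {n : ℕ} (m : ℕ) (z : Mat n R) : Mat (m * n) R :=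
  CStarMatrix.ofMatrix (Matrix.of fun i j =>
    if (finProdFinEquiv.symm i).1 = (finProdFinEquiv.symm j).1 then
      z (finProdFinEquiv.symm i).2 (finProdFinEquiv.symm j).2 else 0)

variable {B : Type*} [CStarAlgebra B] [PartialOrder B] [StarOrderedRing B]

/-- A complex matrix as a matrix over `B`. -/
noncomputable def scalar {n : ℕ} (s : Matrix (Fin n) (Fin n) ℂ) : Mat n B :=
  CStarMatrix.ofMatrix (s.map (algebraMap ℂ B))

/-- A fully matricial function on the domain `Ω` with values in matrices over `B`: it respects direct
sums and similarity by scalar matrices, and it is locally bounded, uniformly in the size of the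
amplification. -/
structure IsFullyMatricial (Ω : ∀ n, Set (Mat n B)) (F : ∀ n, Ω n → Mat n B) : Prop where
  directSum {n m : ℕ} (z : Ω n) (w : Ω m) (u : Ω (n + m)) (hu : u.1 = directSum z.1 w.1) :
    F (n + m) u = OpValFree.directSum (F n z) (F m w)
  similarity {n : ℕ} (z w : Ω n) (s : (Matrix (Fin n) (Fin n) ℂ)ˣ)
    (hw : w.1 = scalar (s : Matrix (Fin n) (Fin n) ℂ) * z.1 *
      scalar ((s⁻¹ : (Matrix (Fin n) (Fin n) ℂ)ˣ) : Matrix (Fin n) (Fin n) ℂ)) :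
    F n w = scalar (s : Matrix (Fin n) (Fin n) ℂ) * F n z *
      scalar ((s⁻¹ : (Matrix (Fin n) (Fin n) ℂ)ˣ) : Matrix (Fin n) (Fin n) ℂ)
  locally_bounded {n : ℕ} (z : Ω n) : ∃ δ > 0, ∃ M > 0, ∀ (m : ℕ) (w : Ω (m * n)),
    ‖w.1 - copies m z.1‖ < δ → ‖F (m * n) w‖ ≤ M

/-- The resolvent `(z - x ⊗ Iₙ)⁻¹` over an algebra `R`, for a matrix `z` over `B`. -/
noncomputable def matResolvent {R : Type*} [Ring R] {n : ℕ} (incl : B → R) (x : R) (z : Mat n B) :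
    Mat n R :=
  Ring.inverse (z.map incl - amp n x)

/-- The Cauchy transform `z ↦ E[(z - x ⊗ Iₙ)⁻¹]`. -/
noncomputable def cauchyTransform {R : Type*} [Ring R] {n : ℕ} (incl : B → R) (E : R → B) (x : R)
    (z : Mat n B) : Mat n B :=
  (matResolvent incl x z).map E

/-- `F(z)⁻¹ → 0` as `z⁻¹ → 0` in the upper half-plane, for every matrix size. -/
def NormalizedAtInfinity (F : ∀ n, upperHalf B n → upperHalf B n) : Prop :=
  ∀ (n : ℕ), ∀ ε > 0, ∃ δ > 0, ∀ z : upperHalf B n,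
    ‖Ring.inverse z.1‖ < δ → ‖Ring.inverse (F n z).1‖ < ε

/-- `F` is a fully matricial function from the upper half-plane to itself, normalized at infinity,
with `Gν = Gμ ∘ F`. -/
structure IsSubordination (Gμ Gν : ∀ n, Mat n B → Mat n B)
    (F : ∀ n, upperHalf B n → upperHalf B n) : Prop where
  fully_matricial : IsFullyMatricial (upperHalf B) fun n z => (F n z).1
  subordination (n : ℕ) (z : upperHalf B n) : Gν n z.1 = Gμ n (F n z).1
  normalized : NormalizedAtInfinity F

end Matricial

section Formula

variable {B : Type*} [CStarAlgebra B] [PartialOrder B] [StarOrderedRing B]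
  {A H : Fin 2 → Type*} [∀ i, CStarAlgebra (A i)]
  [∀ i, NormedAddCommGroup (H i)] [∀ i, NormedSpace ℂ (H i)] [∀ i, CompleteSpace (H i)]
  [∀ i, Module Bᵐᵒᵖ (H i)] [∀ i, RightHilbertModule B (H i)] {S : ∀ i, ValuedProbSpace B (A i)}
  (C : ∀ i, PointedCorrespondence (S i) (H i))

/-- The formula `𝓔[V (z - V⋆ X V)⁻¹ V⋆] = (F(z) - X)⁻¹` for all `z` in the matricial upper
half-plane, where `𝓔` is the canonical conditional expectation onto the first factor. -/
def CondExpFormula (X : A 0) (V : A 1) (F : ∀ n, upperHalf B n → upperHalf B n) : Prop :=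
  ∀ (n : ℕ) (z : upperHalf B n),
    (amp n (freeIncl C 1 V) * matResolvent (freeBase C) (compressed C X V) z.1 *
      amp n (freeIncl C 1 (star V))).map (condExp C 0)
    = (matResolvent (S 0).incl X (F n z).1).map (C 0).rep

end Formula

end OpValFree

open OpValFree

/-! Indices 0 and 1 stand for the first and the second factor. Let P = J J⋆ be the projection of the
free product onto the copy of H₁, and split V⋆XV = T₀ + V⋆XPV with T₀ = V⋆X(1 − P)V. The copy of H₁
reduces the action of A₁, so X commutes with P and T₀ is self-adjoint (`isSelfAdjoint_truncated`).
Multiply the resolvent identity for V⋆XV and T₀ by V and V⋆ and compress it with J. Since P = J J⋆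
factors the compression of a product (`compression_mul_embProj_mul`), this gives W = Q + Q X W,
where W = 𝓔₁[V(z − V⋆XV)⁻¹V⋆] and Q = J⋆V(z − T₀)⁻¹V⋆J.

The heart of the matter is that Q is a matrix over B acting by left multiplication. Consider the
pairs (x, x ⊗ h) with h ∈ H₁°. Operators from A₂ act at the left end of words and never see the
appended letter h (`preservesAppend_act`). An operator a ∈ A₁ can see it only when x is a multiple
of the vacuum, and then both members of the pair are killed by 1 − P, so a(1 − P) respects the pairs
as well (`preservesAppend_act_compl`). An operator T that respects them compresses to left
multiplication by ⟨ξ, Tξ⟩ (`proj_emb_of_preservesAppend`). This identity survives norm limits, and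
the resolvent of T₀ is a limit of polynomials in operators of these kinds
(`proj_truncated_resolvent`).

Hence Q(z) is the Cauchy transform of the self-adjoint T₀ in the vector state of V⋆ξ, which is
unital because ⟨V⋆ξ, V⋆ξ⟩ = E₂[VV⋆] = 1. Its imaginary part is strictly negative, so F = Q⁻¹ exists,
maps the upper half-plane to itself, is fully matricial and is normalized at infinity. The equation
W = Q + Q X W now reads (F − X)W = 1 (`map_compression_resolvent`), which is the formula for the
conditional expectation; the vector state of ξ₁ turns it into subordination.

Uniqueness from the formula: invert the resolvents and recover b from ⟨ξ₁, bξ₁⟩ = b. Uniqueness from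
the first two properties: Gμ is injective where the inverse of the argument is small
(`exists_cauchyTransform_injective`), so two candidates agree near iT for large T. Fully matricial
functions are holomorphic along complex lines, by evaluation at block triangular matrices, so the
identity theorem finishes (`IsFullyMatricial.eq_of_eventuallyEq`, `IsSubordination.unique`). -/

namespace OpValFree

/-! ### Accretive elements of a C⋆-algebra -/

section Accretive

variable {D : Type*} [CStarAlgebra D]

/-- The imaginary part `(w - w⋆) / 2i`. -/
noncomputable def im (w : D) : D := (2 * Complex.I)⁻¹ • (w - star w)

theorem I_smul_sub_star (w : D) : Complex.I • (w - star w) = -((2 : ℝ) • im w) := by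
  rw [im, ← Complex.coe_smul, smul_smul, ← neg_smul]
  congr 1
  push_cast
  field_simp
  rw [Complex.I_sq]

theorem im_neg (w : D) : im (-w) = -im w := by
  rw [im, im, star_neg, ← smul_neg]
  congr 1
  abel

theorem im_sub_of_isSelfAdjoint (w : D) {x : D} (hx : IsSelfAdjoint x) : im (w - x) = im w := by
  rw [im, im, star_sub, hx.star_eq]
  congr 1
  abel

theorem im_add (w v : D) : im (w + v) = im w + im v := by
  rw [im, im, im, star_add, ← smul_add]
  congr 1
  abel

theorem im_real_smul (r : ℝ) (w : D) : im (r • w) = r • im w := by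
  rw [im, im, star_smul, star_trivial, ← smul_sub, smul_comm]

theorem isSelfAdjoint_im (w : D) : IsSelfAdjoint (im w) := by
  rw [isSelfAdjoint_iff, im, star_smul, star_sub, star_star, ← neg_sub w, smul_neg, ← neg_smul]
  congr 1
  simp

theorem norm_im_le (w : D) : ‖im w‖ ≤ ‖w‖ := by
  rw [im, norm_smul]
  have h := norm_sub_le w (star w)
  rw [norm_star] at h
  have : ‖(2 * Complex.I)⁻¹‖ = 2⁻¹ := by simp
  rw [this]
  linarith

theorem map_im {D' : Type*} [CStarAlgebra D'] (f : D →⋆ₐ[ℂ] D') (w : D) :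
    f (im w) = im (f w) := by
  rw [im, im, map_smul, map_sub, map_star]

/-- If `w v = 1` and `v w = 1`, then `-im v = v⋆ (im w) v`. -/
theorem neg_im_inverse {w v : D} (h : w * v = 1) : -im v = star v * im w * v := by
  have h' : star v * star w = 1 := by rw [← star_mul, h, star_one]
  rw [im, im, mul_smul_comm, smul_mul_assoc, ← smul_neg, mul_sub, sub_mul, mul_assoc, h, h',
    mul_one, one_mul, neg_sub]

/-- The C⋆-identity makes the norm of 1 idempotent. Equality can fail: matrices of size 0 form the
trivial algebra, where 1 = 0. -/
theorem norm_one_le : ‖(1 : D)‖ ≤ 1 := by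
  have h : ‖(1 : D)‖ * ‖(1 : D)‖ = ‖(1 : D)‖ := by
    rw [← CStarRing.norm_star_mul_self, star_one, one_mul]
  nlinarith [norm_nonneg (1 : D)]

theorem inverse_neg (q : D) : Ring.inverse (-q) = -Ring.inverse q := by
  by_cases h : IsUnit q
  · obtain ⟨u, rfl⟩ := h
    rw [← Units.val_neg, Ring.inverse_unit, Ring.inverse_unit]
    simp
  · rw [Ring.inverse_non_unit _ h, Ring.inverse_non_unit _ (by rwa [IsUnit.neg_iff]), neg_zero]

variable [PartialOrder D] [StarOrderedRing D]

theorem smul_one_le_smul_one {r s : ℝ} (h : r ≤ s) : r • (1 : D) ≤ s • (1 : D) := by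
  rw [← sub_nonneg, ← sub_smul]
  exact smul_nonneg (sub_nonneg.2 h) zero_le_one

theorem star_mul_self_le (w : D) : star w * w ≤ (‖w‖ ^ 2) • (1 : D) := by
  have := (IsSelfAdjoint.star_mul_self w).le_algebraMap_norm_self
  rwa [CStarRing.norm_star_mul_self, ← pow_two, Algebra.algebraMap_eq_smul_one] at this

theorem norm_le_of_nonneg_of_le_smul_one {a : D} (h0 : 0 ≤ a) {r : ℝ} (hr : 0 ≤ r)
    (h : a ≤ r • (1 : D)) : ‖a‖ ≤ r := by
  refine (CStarAlgebra.norm_le_norm_of_nonneg_of_le h0 h).trans ?_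
  rw [norm_smul, Real.norm_of_nonneg hr]
  exact mul_le_of_le_one_right hr norm_one_le

/-- The squared modulus of 1 + itw is 1 − 2t im w + t² w⋆w, and for small t > 0 the negative
first-order term wins. This is the input of a Neumann series for w⁻¹. -/
theorem exists_norm_one_add_smul_lt {w : D} {ε : ℝ} (hε : 0 < ε) (hw : ε • (1 : D) ≤ im w) :
    ∃ t : ℝ, 0 < t ∧ ‖1 + (t * Complex.I) • w‖ < 1 := by
  -- The summand ε² keeps M positive in the trivial algebra too. The choice t = ε / M minimises 1 −
  -- 2tε + t²M, and the minimum is ‖w‖² / M < 1.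
  set M : ℝ := ‖w‖ ^ 2 + ε ^ 2 with hM
  have hM0 : 0 < M := by positivity
  have ht : 0 < ε / M := by positivity
  refine ⟨ε / M, ht, ?_⟩
  set t : ℝ := ε / M
  have e1 : star (1 + (t * Complex.I) • w) * (1 + (t * Complex.I) • w)
      = 1 - (2 * t) • im w + (t ^ 2) • (star w * w) := by
    have h1 := I_smul_sub_star w
    have e : star (1 + (t * Complex.I) • w) * (1 + (t * Complex.I) • w)
        = 1 + t • (Complex.I • (w - star w)) + (t ^ 2) • (star w * w) := by
      simp only [star_add, star_one, star_smul, RCLike.star_def, map_mul, Complex.conj_ofReal,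
        Complex.conj_I, add_mul, mul_add, one_mul, mul_one, smul_mul_assoc, mul_smul_comm, smul_smul,
        smul_sub, smul_add, ← Complex.coe_smul]
      have : (t : ℂ) * Complex.I * (t * -Complex.I) = ((t ^ 2 : ℝ) : ℂ) := by
        push_cast
        linear_combination -(t : ℂ) ^ 2 * Complex.I_sq
      rw [this]
      module
    rw [e, h1, smul_neg, smul_smul, mul_comm t 2, ← sub_eq_add_neg]
  have e2 : star (1 + (t * Complex.I) • w) * (1 + (t * Complex.I) • w)
      ≤ (1 - 2 * t * ε + t ^ 2 * M) • (1 : D) := by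
    rw [e1]
    have h1 : (2 * t) • (ε • (1 : D)) ≤ (2 * t) • im w := smul_le_smul_of_nonneg_left hw (by positivity)
    have h2 : (t ^ 2) • (star w * w) ≤ (t ^ 2) • (M • (1 : D)) := by
      refine smul_le_smul_of_nonneg_left ((star_mul_self_le w).trans
        (smul_one_le_smul_one ?_)) (by positivity)
      rw [hM]; linarith [sq_nonneg ε]
    calc _ ≤ 1 - (2 * t) • (ε • (1 : D)) + (t ^ 2) • (M • (1 : D)) :=
          add_le_add (sub_le_sub_left h1 _) h2
      _ = _ := by module
  have e3 : 1 - 2 * t * ε + t ^ 2 * M = ‖w‖ ^ 2 / M := by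
    have : t * M = ε := div_mul_cancel₀ _ hM0.ne'
    rw [eq_div_iff hM0.ne']
    have h5 : t * ε * M = ε ^ 2 := by rw [mul_right_comm, this, pow_two]
    have h6 : t ^ 2 * M * M = ε ^ 2 := by rw [← this]; ring
    calc _ = M - 2 * (t * ε * M) + t ^ 2 * M * M := by ring
      _ = _ := by rw [h5, h6, hM]; ring
  have e4 := norm_le_of_nonneg_of_le_smul_one (star_mul_self_nonneg _) (by rw [e3]; positivity) e2
  rw [CStarRing.norm_star_mul_self, e3] at e4
  have e5 : ‖w‖ ^ 2 / M < 1 := by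
    rw [div_lt_one hM0, hM]; linarith [pow_pos hε 2]
  nlinarith [norm_nonneg (1 + (t * Complex.I) • w)]

/-- An element with strictly positive imaginary part is invertible, and its inverse belongs to
every closed subalgebra that contains it. -/
theorem exists_inverse_of_le_im {w : D} {ε : ℝ} (hε : 0 < ε) (hw : ε • (1 : D) ≤ im w) :
    ∃ v : D, w * v = 1 ∧ v * w = 1 ∧
      ∀ K : Subalgebra ℂ D, IsClosed (K : Set D) → w ∈ K → v ∈ K := by
  obtain ⟨t, ht, hu⟩ := exists_norm_one_add_smul_lt hε hw
  set u : D := 1 + (t * Complex.I) • w with hu'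
  have hs := summable_geometric_of_norm_lt_one hu
  have hw' : (t * Complex.I) • w = -(1 - u) := by rw [hu']; abel
  -- Since (it)w = −(1 − u) with ‖u‖ < 1, the inverse is −(it) ∑ uⁿ. The partial sums are
  -- polynomials in w, hence the membership in closed subalgebras.
  refine ⟨-((t * Complex.I) • ∑' n : ℕ, u ^ n), ?_, ?_, fun K hK hwK => ?_⟩
  · rw [mul_neg, mul_smul_comm, ← smul_mul_assoc, hw', neg_mul, neg_neg, mul_neg_geom_series u hu]
  · rw [neg_mul, smul_mul_assoc, ← mul_smul_comm, hw', mul_neg, neg_neg, geom_series_mul_neg u hu]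
  · have huK : u ∈ K := K.add_mem K.one_mem (K.smul_mem hwK _)
    refine K.neg_mem (K.smul_mem ?_ _)
    exact hK.mem_of_tendsto hs.hasSum
      (Filter.Eventually.of_forall fun s => K.sum_mem fun n _ => K.pow_mem huK n)

theorem isUnit_of_le_im {w : D} {ε : ℝ} (hε : 0 < ε) (hw : ε • (1 : D) ≤ im w) : IsUnit w := by
  obtain ⟨v, h1, h2, -⟩ := exists_inverse_of_le_im hε hw
  exact ⟨⟨w, v, h1, h2⟩, rfl⟩

/-- Conjugating the lower bound by v = w⁻¹ gives ε v⋆v ≤ −im v; taking norms, ε‖v‖² ≤ ‖v‖. -/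
theorem norm_inverse_le_of_le_im {w : D} {ε : ℝ} (hε : 0 < ε) (hw : ε • (1 : D) ≤ im w) :
    ‖Ring.inverse w‖ ≤ ε⁻¹ := by
  set v := Ring.inverse w with hv
  have h1 : w * v = 1 := Ring.mul_inverse_cancel w (isUnit_of_le_im hε hw)
  have h2 : ε • (star v * v) ≤ -im v := by
    rw [neg_im_inverse h1]
    have := star_left_conjugate_le_conjugate hw v
    rwa [mul_smul_comm, mul_one, smul_mul_assoc] at this
  have h3 := CStarAlgebra.norm_le_norm_of_nonneg_of_le
    (smul_nonneg hε.le (star_mul_self_nonneg v)) h2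
  rw [norm_neg, norm_smul, CStarRing.norm_star_mul_self, Real.norm_of_nonneg hε.le] at h3
  have h4 := h3.trans (norm_im_le v)
  rcases (norm_nonneg v).eq_or_lt with h | h
  · rw [← h]; positivity
  · rw [le_inv_comm₀ h hε, inv_eq_one_div, le_div_iff₀ h]
    nlinarith

/-- The negative imaginary part of the inverse of an element with strictly positive imaginary part is
strictly positive. -/
theorem le_neg_im_inverse {w : D} {ε M : ℝ} (hε : 0 < ε) (hw : ε • (1 : D) ≤ im w) (hM : 0 < M)
    (hwM : ‖w‖ ≤ M) : (ε / M ^ 2) • (1 : D) ≤ -im (Ring.inverse w) := by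
  set v := Ring.inverse w with hv
  have h1 : w * v = 1 := Ring.mul_inverse_cancel w (isUnit_of_le_im hε hw)
  have h2 : ε • (star v * v) ≤ -im v := by
    rw [neg_im_inverse h1]
    have := star_left_conjugate_le_conjugate hw v
    rwa [mul_smul_comm, mul_one, smul_mul_assoc] at this
  -- Conjugate w⋆w ≤ M² by v; the left side becomes (wv)⋆(wv) = 1.
  have h3 : (1 : D) ≤ (M ^ 2) • (star v * v) := by
    have h4 : star w * w ≤ (M ^ 2) • (1 : D) :=
      (star_mul_self_le w).trans (smul_one_le_smul_one (by gcongr))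
    have := star_left_conjugate_le_conjugate h4 v
    rw [mul_smul_comm, mul_one, smul_mul_assoc] at this
    have e : star v * (star w * w) * v = 1 := by
      rw [mul_assoc, mul_assoc, h1, mul_one, ← star_mul, h1, star_one]
    rwa [e] at this
  refine le_trans ?_ h2
  calc (ε / M ^ 2) • (1 : D) ≤ (ε / M ^ 2) • ((M ^ 2) • (star v * v)) :=
        smul_le_smul_of_nonneg_left h3 (by positivity)
    _ = _ := by rw [smul_smul, div_mul_cancel₀ _ (by positivity)]

/-- The inverse of an element with strictly negative imaginary part. -/
theorem isUnit_of_le_neg_im {q : D} {δ : ℝ} (hδ : 0 < δ) (hq : δ • (1 : D) ≤ -im q) :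
    IsUnit q := by
  rw [← im_neg] at hq
  exact IsUnit.neg_iff q |>.1 (isUnit_of_le_im hδ hq)

theorem norm_inverse_le_of_le_neg_im {q : D} {δ : ℝ} (hδ : 0 < δ) (hq : δ • (1 : D) ≤ -im q) :
    ‖Ring.inverse q‖ ≤ δ⁻¹ := by
  rw [← im_neg] at hq
  have := norm_inverse_le_of_le_im hδ hq
  rwa [inverse_neg, norm_neg] at this

theorem exists_le_im_inverse {q : D} {δ : ℝ} (hδ : 0 < δ) (hq : δ • (1 : D) ≤ -im q) :
    ∃ ε : ℝ, 0 < ε ∧ ε • (1 : D) ≤ im (Ring.inverse q) := by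
  rw [← im_neg] at hq
  have := le_neg_im_inverse hδ hq (M := ‖-q‖ + 1) (by positivity) (by linarith)
  rw [inverse_neg, im_neg, neg_neg] at this
  exact ⟨_, by positivity, this⟩

/-- The imaginary part is a contraction, and a self-adjoint element is at least minus its norm. The
loss depends on δ alone and not on the matrix size, as bounds uniform over amplifications require.
-/
theorem smul_one_le_im_of_norm_sub_le {z w : D} {ε δ : ℝ} (hz : ε • (1 : D) ≤ im z)
    (h : ‖w - z‖ ≤ δ) : (ε - δ) • (1 : D) ≤ im w := by
  have e : im w = im z + im (w - z) := by rw [← im_add]; congr 1; abel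
  have h1 := (isSelfAdjoint_im (w - z)).neg_algebraMap_norm_le_self
  rw [Algebra.algebraMap_eq_smul_one] at h1
  have h2 := smul_one_le_smul_one (D := D) ((norm_im_le (w - z)).trans h)
  rw [e, sub_smul, sub_eq_add_neg]
  exact add_le_add hz ((neg_le_neg h2).trans h1)

end Accretive

/-! ### Entrywise maps of matrices -/

section Entrywise

theorem ringInverse_eq {R : Type*} [Ring R] {a b : R} (h₁ : a * b = 1) (h₂ : b * a = 1) :
    Ring.inverse a = b :=
  Ring.inverse_unit (⟨a, b, h₁, h₂⟩ : Rˣ)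

/-- A ring homomorphism, applied to the entries of a matrix. -/
def mapRingHom {R R' : Type*} [Ring R] [Ring R'] (n : ℕ) (f : R →+* R') : Mat n R →+* Mat n R' where
  toFun M := M.map f
  map_one' := by
    ext i j
    simp only [CStarMatrix.map_apply, CStarMatrix.one_apply]
    split_ifs <;> simp
  map_mul' M N := by
    ext i j
    simp [CStarMatrix.mul_apply]
  map_zero' := by ext i j; simp
  map_add' M N := by ext i j; simp

theorem mapRingHom_apply {R R' : Type*} [Ring R] [Ring R'] {n : ℕ} (f : R →+* R') (M : Mat n R) :
    mapRingHom n f M = M.map f := rfl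

theorem amp_apply {R : Type*} [Zero R] {n : ℕ} (x : R) (i j : Fin n) :
    amp n x i j = if i = j then x else 0 := rfl

theorem map_amp {R R' : Type*} [Zero R] [Zero R'] (n : ℕ) (x : R) (f : R → R') (hf : f 0 = 0) :
    (amp n x).map f = amp n (f x) := by
  ext i j
  rw [CStarMatrix.map_apply, amp_apply, amp_apply]
  split_ifs <;> simp [hf]

theorem amp_mul_apply {R : Type*} [Ring R] {n : ℕ} (x : R) (M : Mat n R) (i j : Fin n) :
    (amp n x * M) i j = x * M i j := by
  simp [CStarMatrix.mul_apply, amp_apply]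

theorem mul_amp_apply {R : Type*} [Ring R] {n : ℕ} (x : R) (M : Mat n R) (i j : Fin n) :
    (M * amp n x) i j = M i j * x := by
  simp [CStarMatrix.mul_apply, amp_apply]

theorem amp_mul_amp {R : Type*} [Ring R] {n : ℕ} (x y : R) : amp n x * amp n y = amp n (x * y) := by
  ext i j
  rw [amp_mul_apply, amp_apply, amp_apply]
  split_ifs <;> simp

theorem star_amp {R : Type*} [Ring R] [StarRing R] {n : ℕ} (x : R) :
    star (amp n x) = amp n (star x) := by
  ext i j
  rw [CStarMatrix.star_apply, amp_apply, amp_apply]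
  by_cases h : i = j
  · simp [h]
  · simp [h, Ne.symm h]

theorem directSum_castAdd_castAdd {R : Type*} [Zero R] {n m : ℕ} (z : Mat n R) (w : Mat m R)
    (i j : Fin n) : directSum z w (Fin.castAdd m i) (Fin.castAdd m j) = z i j := by
  simp [directSum]

theorem directSum_castAdd_natAdd {R : Type*} [Zero R] {n m : ℕ} (z : Mat n R) (w : Mat m R)
    (i : Fin n) (j : Fin m) : directSum z w (Fin.castAdd m i) (Fin.natAdd n j) = 0 := by
  simp [directSum]

theorem directSum_natAdd_castAdd {R : Type*} [Zero R] {n m : ℕ} (z : Mat n R) (w : Mat m R)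
    (i : Fin m) (j : Fin n) : directSum z w (Fin.natAdd n i) (Fin.castAdd m j) = 0 := by
  simp [directSum]

theorem directSum_natAdd_natAdd {R : Type*} [Zero R] {n m : ℕ} (z : Mat n R) (w : Mat m R)
    (i j : Fin m) : directSum z w (Fin.natAdd n i) (Fin.natAdd n j) = w i j := by
  simp [directSum]

theorem ext_blocks {R : Type*} {n m : ℕ} {a b : Mat (n + m) R}
    (h₁₁ : ∀ i j, a (Fin.castAdd m i) (Fin.castAdd m j) = b (Fin.castAdd m i) (Fin.castAdd m j))
    (h₁₂ : ∀ i j, a (Fin.castAdd m i) (Fin.natAdd n j) = b (Fin.castAdd m i) (Fin.natAdd n j))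
    (h₂₁ : ∀ i j, a (Fin.natAdd n i) (Fin.castAdd m j) = b (Fin.natAdd n i) (Fin.castAdd m j))
    (h₂₂ : ∀ i j, a (Fin.natAdd n i) (Fin.natAdd n j) = b (Fin.natAdd n i) (Fin.natAdd n j)) :
    a = b := by
  ext i j
  refine Fin.addCases (fun i => ?_) (fun i => ?_) i <;>
    refine Fin.addCases (fun j => ?_) (fun j => ?_) j
  exacts [h₁₁ i j, h₁₂ i j, h₂₁ i j, h₂₂ i j]

theorem directSum_mul {R : Type*} [Ring R] {n m : ℕ} (z z' : Mat n R) (w w' : Mat m R) :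
    directSum z w * directSum z' w' = directSum (z * z') (w * w') := by
  refine ext_blocks ?_ ?_ ?_ ?_ <;> intro i j <;>
    simp [CStarMatrix.mul_apply, Fin.sum_univ_add, directSum_castAdd_castAdd,
      directSum_castAdd_natAdd, directSum_natAdd_castAdd, directSum_natAdd_natAdd]

theorem directSum_one {R : Type*} [Ring R] {n m : ℕ} :
    directSum (1 : Mat n R) (1 : Mat m R) = 1 := by
  refine ext_blocks ?_ ?_ ?_ ?_ <;> intro i j <;>
    simp [CStarMatrix.one_apply, directSum_castAdd_castAdd, Fin.ext_iff,
      directSum_castAdd_natAdd, directSum_natAdd_castAdd, directSum_natAdd_natAdd] <;> omega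

theorem directSum_inverse {R : Type*} [Ring R] {n m : ℕ} {z : Mat n R} {w : Mat m R}
    (hz : IsUnit z) (hw : IsUnit w) :
    Ring.inverse (directSum z w) = directSum (Ring.inverse z) (Ring.inverse w) := by
  refine ringInverse_eq ?_ ?_
  · rw [directSum_mul, Ring.mul_inverse_cancel _ hz, Ring.mul_inverse_cancel _ hw, directSum_one]
  · rw [directSum_mul, Ring.inverse_mul_cancel _ hz, Ring.inverse_mul_cancel _ hw, directSum_one]

theorem map_directSum {R R' : Type*} [Zero R] [Zero R'] {n m : ℕ} (z : Mat n R) (w : Mat m R)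
    (f : R → R') (hf : f 0 = 0) :
    (directSum z w).map f = directSum (z.map f) (w.map f) := by
  refine ext_blocks ?_ ?_ ?_ ?_ <;> intro i j <;>
    simp [directSum_castAdd_castAdd, hf,
      directSum_castAdd_natAdd, directSum_natAdd_castAdd, directSum_natAdd_natAdd]

theorem directSum_sub_amp {R : Type*} [Ring R] {n m : ℕ} (z : Mat n R) (w : Mat m R) (x : R) :
    directSum z w - amp (n + m) x = directSum (z - amp n x) (w - amp m x) := by
  refine ext_blocks ?_ ?_ ?_ ?_ <;> intro i j <;>
    simp [directSum_castAdd_castAdd, amp_apply, Fin.ext_iff,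
      directSum_castAdd_natAdd, directSum_natAdd_castAdd, directSum_natAdd_natAdd] <;> omega

theorem scalar_apply {B : Type*} [CStarAlgebra B] {n : ℕ} (s : Matrix (Fin n) (Fin n) ℂ)
    (i j : Fin n) : (scalar s : Mat n B) i j = algebraMap ℂ B (s i j) := rfl

theorem scalar_mul_scalar {B : Type*} [CStarAlgebra B] {n : ℕ} (s t : Matrix (Fin n) (Fin n) ℂ) :
    (scalar s : Mat n B) * scalar t = scalar (s * t) := by
  ext i j
  simp [CStarMatrix.mul_apply, Matrix.mul_apply, scalar_apply]

theorem scalar_one {B : Type*} [CStarAlgebra B] {n : ℕ} :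
    (scalar 1 : Mat n B) = 1 := by
  ext i j
  rw [scalar_apply, Matrix.one_apply, CStarMatrix.one_apply]
  split_ifs <;> simp

theorem scalar_conj_mul {B : Type*} [CStarAlgebra B] {n : ℕ} (s : (Matrix (Fin n) (Fin n) ℂ)ˣ)
    (a b : Mat n B) :
    (scalar s.1 * a * scalar s⁻¹.1) * (scalar s.1 * b * scalar s⁻¹.1)
      = scalar s.1 * (a * b) * scalar s⁻¹.1 := by
  have : (scalar s⁻¹.1 : Mat n B) * scalar s.1 = 1 := by
    rw [scalar_mul_scalar, Units.inv_mul, scalar_one]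
  calc _ = scalar s.1 * a * (scalar s⁻¹.1 * scalar s.1) * (b * scalar s⁻¹.1) := by
        simp only [mul_assoc]
    _ = _ := by rw [this, mul_one]; simp only [mul_assoc]

theorem scalar_conj_one {B : Type*} [CStarAlgebra B] {n : ℕ} (s : (Matrix (Fin n) (Fin n) ℂ)ˣ) :
    scalar s.1 * (1 : Mat n B) * scalar s⁻¹.1 = 1 := by
  rw [mul_one, scalar_mul_scalar, Units.mul_inv, scalar_one]

theorem scalar_conj_inverse {B : Type*} [CStarAlgebra B] {n : ℕ}
    (s : (Matrix (Fin n) (Fin n) ℂ)ˣ) {a : Mat n B} (ha : IsUnit a) :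
    Ring.inverse (scalar s.1 * a * scalar s⁻¹.1) = scalar s.1 * Ring.inverse a * scalar s⁻¹.1 := by
  refine ringInverse_eq ?_ ?_
  · rw [scalar_conj_mul, Ring.mul_inverse_cancel _ ha, scalar_conj_one]
  · rw [scalar_conj_mul, Ring.inverse_mul_cancel _ ha, scalar_conj_one]

/-- Complex linearity suffices, because the entries of a scalar matrix are complex multiples of 1.
This is how similarities pass through an expectation. -/
theorem map_scalar_conj {B D : Type*} [CStarAlgebra B] [CStarAlgebra D] {n : ℕ} (f : D →ₗ[ℂ] B)
    (s t : Matrix (Fin n) (Fin n) ℂ) (M : Mat n D) :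
    (scalar s * M * scalar t).map f = scalar s * M.map f * scalar t := by
  ext i j
  have h₁ : ∀ (c : ℂ) (a : D), f (algebraMap ℂ D c * a) = algebraMap ℂ B c * f a := fun c a => by
    rw [← Algebra.smul_def, map_smul, Algebra.smul_def]
  have h₂ : ∀ (c : ℂ) (a : D), f (a * algebraMap ℂ D c) = f a * algebraMap ℂ B c := fun c a => by
    rw [← Algebra.commutes, h₁, Algebra.commutes]
  simp only [CStarMatrix.map_apply, CStarMatrix.mul_apply, scalar_apply, map_sum, h₁, h₂]

theorem scalar_commute_amp {B : Type*} [CStarAlgebra B] {n : ℕ} (s : Matrix (Fin n) (Fin n) ℂ)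
    (x : B) : scalar s * amp n x = amp n x * scalar s := by
  ext i j
  rw [mul_amp_apply, amp_mul_apply, scalar_apply, Algebra.commutes]

theorem scalar_conj_amp {B : Type*} [CStarAlgebra B] {n : ℕ} (s : (Matrix (Fin n) (Fin n) ℂ)ˣ)
    (x : B) : scalar s.1 * amp n x * scalar s⁻¹.1 = amp n x := by
  rw [scalar_commute_amp, mul_assoc, scalar_mul_scalar, Units.mul_inv, scalar_one, mul_one]

end Entrywise

/-! ### Star-homomorphisms between matrix algebras and their contractivity -/

section StarMaps

variable {B D : Type*} [CStarAlgebra B] [CStarAlgebra D]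

/-- A `*`-homomorphism, applied to the entries of a matrix. -/
noncomputable def mapStarHom (n : ℕ) (f : B →⋆ₐ[ℂ] D) : Mat n B →⋆ₐ[ℂ] Mat n D :=
  { mapRingHom n (f : B →+* D) with
    commutes' := fun r => by
      ext i j
      change f (algebraMap ℂ (Mat n B) r i j) = _
      rw [CStarMatrix.algebraMap_apply, CStarMatrix.algebraMap_apply]
      split_ifs
      exacts [AlgHomClass.commutes f r, map_zero f]
    map_star' := fun M => by
      ext i j
      change f (star M i j) = star (M.map f) i j
      rw [CStarMatrix.star_apply, CStarMatrix.star_apply, CStarMatrix.map_apply, map_star] }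

theorem mapStarHom_apply {n : ℕ} (f : B →⋆ₐ[ℂ] D) (M : Mat n B) : mapStarHom n f M = M.map f := rfl

/-- The amplification `x ↦ x ⊗ Iₙ`. -/
noncomputable def ampStarHom (n : ℕ) (D : Type*) [CStarAlgebra D] : D →⋆ₐ[ℂ] Mat n D where
  toFun := amp n
  map_one' := rfl
  map_mul' x y := (amp_mul_amp x y).symm
  map_zero' := by ext i j; simp [amp_apply]
  map_add' x y := by
    ext i j
    rw [CStarMatrix.add_apply, amp_apply, amp_apply, amp_apply]
    split_ifs <;> simp
  commutes' r := by
    ext i j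
    rw [CStarMatrix.algebraMap_apply, amp_apply]
  map_star' x := (star_amp x).symm

theorem copies_apply {R : Type*} [Zero R] {n m : ℕ} (z : Mat n R) (i j : Fin m × Fin n) :
    copies m z (finProdFinEquiv i) (finProdFinEquiv j) = if i.1 = j.1 then z i.2 j.2 else 0 := by
  simp only [copies, CStarMatrix.ofMatrix_apply, Matrix.of_apply, Equiv.symm_apply_apply]

theorem ext_copies {R : Type*} {n m : ℕ} {a b : Mat (m * n) R}
    (h : ∀ i j : Fin m × Fin n, a (finProdFinEquiv i) (finProdFinEquiv j)
      = b (finProdFinEquiv i) (finProdFinEquiv j)) : a = b := by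
  ext i j
  have := h (finProdFinEquiv.symm i) (finProdFinEquiv.symm j)
  simpa only [Equiv.apply_symm_apply] using this

/-- The direct sum of `m` copies, as a `*`-homomorphism. -/
noncomputable def copiesStarHom (m n : ℕ) (D : Type*) [CStarAlgebra D] :
    Mat n D →⋆ₐ[ℂ] Mat (m * n) D where
  toFun := copies m
  map_one' := ext_copies fun i j => by
    rw [copies_apply, CStarMatrix.one_apply, CStarMatrix.one_apply]
    simp only [EmbeddingLike.apply_eq_iff_eq, Prod.ext_iff]
    split_ifs <;> simp_all
  map_mul' z w := ext_copies fun i j => by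
    rw [copies_apply, CStarMatrix.mul_apply, CStarMatrix.mul_apply, ← finProdFinEquiv.sum_comp]
    simp only [copies_apply, Fintype.sum_prod_type]
    by_cases h : i.1 = j.1
    · simp [h]
    · simp [h]
  map_zero' := ext_copies fun i j => by simp [copies_apply]
  map_add' z w := ext_copies fun i j => by
    rw [CStarMatrix.add_apply, copies_apply, copies_apply, copies_apply]
    split_ifs <;> simp
  commutes' r := ext_copies fun i j => by
    rw [copies_apply, CStarMatrix.algebraMap_apply, CStarMatrix.algebraMap_apply]
    simp only [EmbeddingLike.apply_eq_iff_eq, Prod.ext_iff]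
    split_ifs <;> simp_all
  map_star' z := ext_copies fun i j => by
    change _ = star (copies m z (finProdFinEquiv j) (finProdFinEquiv i))
    rw [copies_apply, copies_apply, CStarMatrix.star_apply]
    by_cases h : i.1 = j.1
    · simp [h]
    · simp [h, Ne.symm h]

theorem norm_starHom_le (f : B →⋆ₐ[ℂ] D) (b : B) : ‖f b‖ ≤ ‖b‖ :=
  NonUnitalStarAlgHom.norm_apply_le f b

variable [PartialOrder B] [StarOrderedRing B] [PartialOrder D] [StarOrderedRing D]

theorem starHom_mono (f : B →⋆ₐ[ℂ] D) {a b : B} (h : a ≤ b) : f a ≤ f b := by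
  obtain ⟨d, hd⟩ := exists_star_mul_self (sub_nonneg.2 h)
  rw [← sub_nonneg, ← map_sub, hd, map_mul, map_star]
  exact star_mul_self_nonneg _

theorem starHom_real_smul (f : B →⋆ₐ[ℂ] D) (r : ℝ) (b : B) : f (r • b) = r • f b := by
  rw [← Complex.coe_smul, map_smul, Complex.coe_smul]

theorem smul_one_le_im_map (f : B →⋆ₐ[ℂ] D) {z : B} {ε : ℝ} (h : ε • (1 : B) ≤ im z) :
    ε • (1 : D) ≤ im (f z) := by
  have := starHom_mono f h
  rwa [starHom_real_smul, map_one, map_im] at this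

theorem norm_map_le (n : ℕ) (f : B →⋆ₐ[ℂ] D) (z : Mat n B) : ‖z.map f‖ ≤ ‖z‖ :=
  norm_starHom_le (mapStarHom n f) z

theorem norm_amp_le (n : ℕ) (x : D) : ‖amp n x‖ ≤ ‖x‖ := norm_starHom_le (ampStarHom n D) x

theorem norm_copies_le {n : ℕ} (m : ℕ) (z : Mat n B) : ‖copies m z‖ ≤ ‖z‖ :=
  norm_starHom_le (copiesStarHom m n B) z

end StarMaps

/-! ### Reciprocal Cauchy transforms -/

section Reciprocal

set_option linter.unusedSectionVars false

variable {B D : Type*} [CStarAlgebra B] [CStarAlgebra D]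

/-- A linear map, applied to the entries of a matrix. -/
noncomputable def mapLin (n : ℕ) (φ : D →ₗ[ℂ] B) : Mat n D →ₗ[ℂ] Mat n B where
  toFun M := M.map φ
  map_add' M N := by ext i j; simp
  map_smul' c M := by ext i j; simp

theorem mapLin_apply {n : ℕ} (φ : D →ₗ[ℂ] B) (M : Mat n D) : mapLin n φ M = M.map φ := rfl

theorem map_scalar (j : B →⋆ₐ[ℂ] D) {n : ℕ} (s : Matrix (Fin n) (Fin n) ℂ) :
    (scalar s : Mat n B).map j = scalar s := by
  ext i k
  exact AlgHomClass.commutes j _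

variable [PartialOrder B] [StarOrderedRing B] [PartialOrder D] [StarOrderedRing D]

/-- A unital completely positive map. -/
structure IsUCP (φ : D →ₗ[ℂ] B) : Prop where
  map_one : φ 1 = 1
  map_star (a : D) : φ (star a) = star (φ a)
  nonneg (n : ℕ) (M : Mat n D) : 0 ≤ (star M * M).map φ

theorem mapLin_mono {φ : D →ₗ[ℂ] B} (h : ∀ (n : ℕ) (M : Mat n D), 0 ≤ (star M * M).map φ) {n : ℕ}
    {M N : Mat n D} (hMN : M ≤ N) : mapLin n φ M ≤ mapLin n φ N := by
  obtain ⟨d, hd⟩ := exists_star_mul_self (sub_nonneg.2 hMN)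
  rw [← sub_nonneg, ← map_sub, hd]
  exact h n d

/-- Positive maps between C⋆-algebras are automatically bounded. The constant may depend on n, which
is harmless: it serves only normalization and injectivity near infinity, both of which fix the size.
-/
theorem exists_norm_mapLin_le {φ : D →ₗ[ℂ] B}
    (h : ∀ (n : ℕ) (M : Mat n D), 0 ≤ (star M * M).map φ) (n : ℕ) :
    ∃ K : ℝ, 0 < K ∧ ∀ M : Mat n D, ‖M.map φ‖ ≤ K * ‖M‖ := by
  let f : Mat n D →ₚ[ℂ] Mat n B :=
    { mapLin n φ with monotone' := fun M N hMN => mapLin_mono h hMN }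
  obtain ⟨K, hK⟩ := PositiveLinearMap.exists_norm_apply_le f
  refine ⟨K + 1, by positivity, fun M => (hK M).trans ?_⟩
  gcongr
  linarith

theorem mapLin_real_smul (φ : D →ₗ[ℂ] B) {n : ℕ} (r : ℝ) (M : Mat n D) :
    mapLin n φ (r • M) = r • mapLin n φ M := by
  ext i j
  change φ (r • M i j) = r • φ (M i j)
  rw [← Complex.coe_smul, map_smul, Complex.coe_smul]

namespace IsUCP

variable {φ : D →ₗ[ℂ] B} (hφ : IsUCP φ)
include hφ

theorem mapLin_one (n : ℕ) : mapLin n φ 1 = 1 := by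
  ext i j
  rw [mapLin_apply, CStarMatrix.map_apply, CStarMatrix.one_apply, CStarMatrix.one_apply]
  split_ifs
  exacts [hφ.map_one, _root_.map_zero φ]

theorem im_mapLin {n : ℕ} (M : Mat n D) : im (mapLin n φ M) = mapLin n φ (im M) := by
  have : mapLin n φ (star M) = star (mapLin n φ M) := by
    ext i j
    rw [CStarMatrix.star_apply]
    exact hφ.map_star _
  rw [im, im, map_smul, map_sub, this]

end IsUCP

/-- Subtracting a self-adjoint element leaves the imaginary part unchanged, and a unital
star-homomorphism preserves lower bounds by multiples of 1. -/
theorem smul_one_le_im_sub_amp (j : B →⋆ₐ[ℂ] D) {x : D} (hx : IsSelfAdjoint x) {n : ℕ} {z : Mat n B}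
    {ε : ℝ} (hz : ε • (1 : Mat n B) ≤ im z) : ε • (1 : Mat n D) ≤ im (z.map j - amp n x) := by
  have hx' : IsSelfAdjoint (amp n x) := hx.map (ampStarHom n D)
  rw [im_sub_of_isSelfAdjoint _ hx']
  exact smul_one_le_im_map (mapStarHom n j) hz

theorem isUnit_sub_amp (j : B →⋆ₐ[ℂ] D) {x : D} (hx : IsSelfAdjoint x) {n : ℕ}
    (z : upperHalf B n) : IsUnit (z.1.map j - amp n x) := by
  obtain ⟨ε, hε, hz⟩ := z.2
  exact isUnit_of_le_im hε (smul_one_le_im_sub_amp j hx hz)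

theorem norm_sub_amp_le (j : B →⋆ₐ[ℂ] D) (x : D) {n : ℕ} (z : Mat n B) :
    ‖z.map j - amp n x‖ ≤ ‖z‖ + ‖x‖ :=
  (norm_sub_le _ _).trans (add_le_add (norm_map_le n j z) (norm_amp_le n x))

/-- The resolvent is small near infinity. -/
theorem norm_matResolvent_le (j : B →⋆ₐ[ℂ] D) {x : D} (hx : IsSelfAdjoint x) {n : ℕ}
    (z : upperHalf B n) (h : ‖x‖ * ‖Ring.inverse z.1‖ ≤ 1 / 2) :
    ‖matResolvent j x z.1‖ ≤ 2 * ‖Ring.inverse z.1‖ := by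
  obtain ⟨ε, hε, hz⟩ := z.2
  set u := Ring.inverse z.1 with hu
  set a := matResolvent j x z.1 with ha
  have h1 : (mapStarHom n j z.1) * mapStarHom n j u = 1 := by
    rw [← map_mul, hu, Ring.mul_inverse_cancel _ (isUnit_of_le_im hε hz), map_one]
  have h2 : a * (mapStarHom n j z.1 - amp n x) = 1 :=
    Ring.inverse_mul_cancel _ (isUnit_sub_amp j hx z)
  -- With u = z⁻¹ and a the resolvent, a(z − x) = 1 gives a = u + a x u. The correction has norm at
  -- most ‖a‖ / 2 and is absorbed on the left.
  have h3 : a = mapStarHom n j u + a * amp n x * mapStarHom n j u := by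
    have h4 : a * mapStarHom n j z.1 = 1 + a * amp n x := by
      rw [mul_sub, sub_eq_iff_eq_add] at h2
      exact h2
    calc a = a * mapStarHom n j z.1 * mapStarHom n j u := by rw [mul_assoc, h1, mul_one]
      _ = _ := by rw [h4, add_mul, one_mul]
  have h5 : ‖a‖ ≤ ‖u‖ + ‖a‖ * (1 / 2) := by
    calc ‖a‖ ≤ ‖mapStarHom n j u‖ + ‖a * amp n x * mapStarHom n j u‖ := by
          conv_lhs => rw [h3]
          exact norm_add_le _ _
      _ ≤ ‖u‖ + ‖a‖ * ‖x‖ * ‖u‖ := by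
          refine add_le_add (norm_starHom_le _ _) ((norm_mul_le _ _).trans ?_)
          refine mul_le_mul ((norm_mul_le _ _).trans ?_) (norm_starHom_le _ _) (norm_nonneg _)
            (by positivity)
          exact mul_le_mul_of_nonneg_left (norm_amp_le n x) (norm_nonneg _)
      _ ≤ _ := by
          rw [mul_assoc]
          gcongr
  linarith

variable (j : B →⋆ₐ[ℂ] D) {φ : D →ₗ[ℂ] B} (hφ : IsUCP φ) {x : D} (hx : IsSelfAdjoint x)

include hφ hx in
-- A unital positive map carries the lower bound for −im of the resolvent over to the Cauchy
-- transform. The constant involves only ε and M, never n.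
theorem smul_one_le_neg_im_cauchyTransform {n : ℕ} {z : Mat n B} {ε M : ℝ} (hε : 0 < ε)
    (hz : ε • (1 : Mat n B) ≤ im z) (hM : 0 < M) (hzM : ‖z‖ + ‖x‖ ≤ M) :
    (ε / M ^ 2) • (1 : Mat n B) ≤ -im (cauchyTransform j φ x z) := by
  have h1 : (ε / M ^ 2) • (1 : Mat n D) ≤ -im (matResolvent j x z) :=
    le_neg_im_inverse hε (smul_one_le_im_sub_amp j hx hz) hM ((norm_sub_amp_le j x z).trans hzM)
  have h2 := mapLin_mono hφ.nonneg h1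
  rwa [mapLin_real_smul, hφ.mapLin_one, map_neg, ← hφ.im_mapLin] at h2

include hφ hx in
theorem exists_smul_one_le_neg_im_cauchyTransform {n : ℕ} (z : upperHalf B n) :
    ∃ δ : ℝ, 0 < δ ∧ δ • (1 : Mat n B) ≤ -im (cauchyTransform j φ x z.1) := by
  obtain ⟨ε, hε, hz⟩ := z.2
  exact ⟨_, by positivity, smul_one_le_neg_im_cauchyTransform j hφ hx hε hz
    (M := ‖z.1‖ + ‖x‖ + 1) (by positivity) (by linarith)⟩

include hφ hx in
theorem isUnit_cauchyTransform {n : ℕ} (z : upperHalf B n) :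
    IsUnit (cauchyTransform j φ x z.1) := by
  obtain ⟨δ, hδ, h⟩ := exists_smul_one_le_neg_im_cauchyTransform j hφ hx z
  exact isUnit_of_le_neg_im hδ h

/-- The reciprocal `z ↦ φ[(z - x)⁻¹]⁻¹` of the Cauchy transform, as a map of the upper half-plane. -/
noncomputable def reciprocal (n : ℕ) (z : upperHalf B n) : upperHalf B n :=
  ⟨Ring.inverse (cauchyTransform j φ x z.1), by
    obtain ⟨δ, hδ, h⟩ := exists_smul_one_le_neg_im_cauchyTransform j hφ hx z
    exact exists_le_im_inverse hδ h⟩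

theorem inverse_reciprocal (n : ℕ) (z : upperHalf B n) :
    Ring.inverse (reciprocal j hφ hx n z).1 = cauchyTransform j φ x z.1 := by
  have h := isUnit_cauchyTransform j hφ hx z
  exact ringInverse_eq (Ring.inverse_mul_cancel _ h) (Ring.mul_inverse_cancel _ h)

include hx in
theorem cauchyTransform_directSum {n m : ℕ} (z : upperHalf B n) (w : upperHalf B m) :
    cauchyTransform j φ x (directSum z.1 w.1)
      = directSum (cauchyTransform j φ x z.1) (cauchyTransform j φ x w.1) := by
  rw [cauchyTransform, matResolvent, map_directSum _ _ _ (map_zero j), directSum_sub_amp,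
    directSum_inverse (isUnit_sub_amp j hx z) (isUnit_sub_amp j hx w),
    map_directSum _ _ _ (map_zero φ)]
  rfl

include hx in
theorem cauchyTransform_similarity {n : ℕ} (z : upperHalf B n) (s : (Matrix (Fin n) (Fin n) ℂ)ˣ) :
    cauchyTransform j φ x (scalar s.1 * z.1 * scalar s⁻¹.1)
      = scalar s.1 * cauchyTransform j φ x z.1 * scalar s⁻¹.1 := by
  have e : (scalar s.1 * z.1 * scalar s⁻¹.1).map j - amp n x
      = scalar s.1 * (z.1.map j - amp n x) * scalar s⁻¹.1 := by
    rw [← mapStarHom_apply, map_mul, map_mul, mapStarHom_apply, mapStarHom_apply, mapStarHom_apply,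
      map_scalar, map_scalar, mul_sub, sub_mul, scalar_conj_amp]
  rw [cauchyTransform, matResolvent, e, scalar_conj_inverse s (isUnit_sub_amp j hx z),
    map_scalar_conj]
  rfl

/-- Direct sums and scalar similarities pass through subtraction of x ⊗ Iₙ, inversion and entrywise
linear maps. Local boundedness is uniform in the number of copies because every estimate on
imaginary parts is independent of the size. -/
theorem isFullyMatricial_reciprocal :
    IsFullyMatricial (upperHalf B) fun n z => (reciprocal j hφ hx n z).1 where
  directSum z w u hu := by
    simp only [reciprocal, hu]
    rw [cauchyTransform_directSum j hx, directSum_inverse (isUnit_cauchyTransform j hφ hx z)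
      (isUnit_cauchyTransform j hφ hx w)]
  similarity z w s hw := by
    simp only [reciprocal, hw]
    rw [cauchyTransform_similarity j hx, scalar_conj_inverse s (isUnit_cauchyTransform j hφ hx z)]
  locally_bounded {n} z := by
    obtain ⟨ε, hε, hz⟩ := z.2
    have hM : 0 < ‖z.1‖ + ε + ‖x‖ := by positivity
    -- A ball of radius ε / 2 keeps half of the imaginary part, and on it ‖w‖ + ‖x‖ ≤ ‖z‖ + ε + ‖x‖.
    -- The bound is the reciprocal of the resulting lower estimate for −im of the Cauchy transform.
    refine ⟨ε / 2, half_pos hε, (ε / 2 / (‖z.1‖ + ε + ‖x‖) ^ 2)⁻¹, by positivity,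
      fun m w hw => ?_⟩
    have h1 : ε • (1 : Mat (m * n) B) ≤ im (copies m z.1) :=
      smul_one_le_im_map (copiesStarHom m n B) hz
    have h2 := smul_one_le_im_of_norm_sub_le h1 hw.le
    rw [sub_half] at h2
    have h3 : ‖w.1‖ + ‖x‖ ≤ ‖z.1‖ + ε + ‖x‖ := by
      have h4 : ‖w.1‖ ≤ ‖copies m z.1‖ + ‖w.1 - copies m z.1‖ := by
        have := norm_add_le (copies m z.1) (w.1 - copies m z.1)
        rwa [add_sub_cancel] at this
      have h5 := norm_copies_le m z.1
      linarith
    exact norm_inverse_le_of_le_neg_im (by positivity)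
      (smul_one_le_neg_im_cauchyTransform j hφ hx (half_pos hε) h2 hM h3)

/-- The inverse of the reciprocal is the Cauchy transform itself, which near infinity is at most
K‖(z − x)⁻¹‖ ≤ 2K‖z⁻¹‖. -/
theorem normalizedAtInfinity_reciprocal : NormalizedAtInfinity (reciprocal j hφ hx) := by
  intro n ε hε
  obtain ⟨K, hK, h⟩ := exists_norm_mapLin_le hφ.nonneg n
  -- The first bound ensures ‖x‖‖z⁻¹‖ ≤ 1/2, as the resolvent estimate requires; the second makes
  -- 2K‖z⁻¹‖ < ε.
  refine ⟨min (1 / (2 * (‖x‖ + 1))) (ε / (2 * K)), by positivity, fun z hz => ?_⟩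
  rw [inverse_reciprocal]
  have h1 : ‖x‖ * ‖Ring.inverse z.1‖ ≤ 1 / 2 := by
    have := (hz.trans_le (min_le_left _ _)).le
    rw [le_div_iff₀ (by positivity)] at this
    nlinarith [norm_nonneg (Ring.inverse z.1), norm_nonneg x]
  have h2 := (hz.trans_le (min_le_right _ _))
  rw [lt_div_iff₀ (by positivity)] at h2
  refine (h _).trans_lt ?_
  have := norm_matResolvent_le j hx z h1
  nlinarith

end Reciprocal

open Filter Topology

/-! ### Uniqueness of the subordination function -/

section Injectivity

set_option linter.unusedSectionVars false

variable {B D : Type*} [CStarAlgebra B] [PartialOrder B] [StarOrderedRing B]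
  [CStarAlgebra D] [PartialOrder D] [StarOrderedRing D]
  (j : B →⋆ₐ[ℂ] D) {φ : D →ₗ[ℂ] B} {x : D}

/-- `(w - x)⁻¹ - (w' - x)⁻¹ = (1 + a x) (w⁻¹ - w'⁻¹) (1 + x a')` for `a = (w - x)⁻¹`,
`a' = (w' - x)⁻¹`. -/
theorem resolvent_sub_resolvent {R : Type*} [Ring R] {w w' u u' x a a' : R}
    (hu : w * u = 1) (hu' : u' * w' = 1) (ha : a * (w - x) = 1) (ha' : (w' - x) * a' = 1) :
    a - a' = (1 + a * x) * (u - u') * (1 + x * a') := by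
  -- The outer factors equal a w and w' a', so the right side collapses to a(w' − w)a', which is the
  -- usual resolvent identity.
  have h1 : 1 + a * x = a * w := by rw [mul_sub, sub_eq_iff_eq_add] at ha; exact ha.symm
  have h2 : 1 + x * a' = w' * a' := by rw [sub_mul, sub_eq_iff_eq_add] at ha'; exact ha'.symm
  have h3 : a - a' = a * (w' - w) * a' := by
    calc a - a' = a * ((w' - x) * a') - (a * (w - x)) * a' := by rw [ha, ha', one_mul, mul_one]
      _ = _ := by noncomm_ring
  rw [h1, h2, h3]
  calc a * (w' - w) * a' = a * w' * a' - a * w * a' := by noncomm_ring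
    _ = a * (w * u) * w' * a' - a * w * (u' * w') * a' := by rw [hu, hu', mul_one, mul_one]
    _ = _ := by noncomm_ring

/-- Near infinity, the Cauchy transform is injective. -/
theorem exists_cauchyTransform_injective (hj : ∀ b, φ (j b) = b)
    (hφ : ∀ (n : ℕ) (M : Mat n D), 0 ≤ (star M * M).map φ) (hx : IsSelfAdjoint x) (n : ℕ) :
    ∃ r : ℝ, 0 < r ∧ ∀ w w' : upperHalf B n, ‖Ring.inverse w.1‖ < r → ‖Ring.inverse w'.1‖ < r →
      cauchyTransform j φ x w.1 = cauchyTransform j φ x w'.1 → w = w' := by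
  obtain ⟨K, hK, hb⟩ := exists_norm_mapLin_le hφ n
  -- The bound 1/2 makes the resolvent estimate available and the quadratic error term dominated by
  -- a linear one. The bound 1 / (12K) makes the total error K · 6s at most 1/2.
  set s : ℝ := min (1 / 2) (1 / (12 * K)) with hs
  have hs0 : 0 < s := by positivity
  have hs1 : s ≤ 1 / 2 := min_le_left _ _
  have hs2 : s * (12 * K) ≤ 1 := by
    rw [← le_div_iff₀ (by positivity)]; exact min_le_right _ _
  refine ⟨s / (‖x‖ + 1), by positivity, fun w w' hw hw' h => ?_⟩
  have key : ∀ w : upperHalf B n, ‖Ring.inverse w.1‖ < s / (‖x‖ + 1) →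
      ‖matResolvent j x w.1‖ * ‖x‖ ≤ 2 * s := by
    intro w hw
    rw [lt_div_iff₀ (by positivity)] at hw
    have h1 := norm_nonneg (Ring.inverse w.1)
    have := norm_matResolvent_le j hx w (by nlinarith [norm_nonneg x])
    nlinarith [norm_nonneg x]
  have hwu : IsUnit w.1 := by obtain ⟨ε, hε, hz⟩ := w.2; exact isUnit_of_le_im hε hz
  have hwu' : IsUnit w'.1 := by obtain ⟨ε, hε, hz⟩ := w'.2; exact isUnit_of_le_im hε hz
  set u := Ring.inverse w.1 with hu
  set u' := Ring.inverse w'.1 with hu'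
  set a := matResolvent j x w.1 with ha
  set a' := matResolvent j x w'.1 with ha'
  set d := mapStarHom n j (u - u') with hd
  have h1 : a - a' = (1 + a * amp n x) * d * (1 + amp n x * a') := by
    rw [hd, map_sub]
    refine resolvent_sub_resolvent (w := mapStarHom n j w.1) (w' := mapStarHom n j w'.1)
      ?_ ?_ ?_ ?_
    · rw [← map_mul, hu, Ring.mul_inverse_cancel _ hwu, map_one]
    · rw [← map_mul, hu', Ring.inverse_mul_cancel _ hwu', map_one]
    · exact Ring.inverse_mul_cancel _ (isUnit_sub_amp j hx w)
    · exact Ring.mul_inverse_cancel _ (isUnit_sub_amp j hx w')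
  have h2 : mapLin n φ (a - a') = 0 := by rw [map_sub]; exact sub_eq_zero.2 h
  have h3 : mapLin n φ d = u - u' := by ext i k; exact hj _
  -- The map φ kills a − a' and fixes u − u', since it is the identity on B. What remains are three
  -- terms, each containing a x or x a' and of norm at most 2s‖u − u'‖, so that ‖u − u'‖ ≤ ‖u − u'‖
  -- / 2.
  have h4 : u - u' = -mapLin n φ (a * amp n x * d + d * (amp n x * a')
      + a * amp n x * d * (amp n x * a')) := by
    have e : a * amp n x * d + d * (amp n x * a') + a * amp n x * d * (amp n x * a')
        = (a - a') - d := by rw [h1]; noncomm_ring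
    rw [e, map_sub, h2, h3, zero_sub, neg_neg]
  have hdn : ‖d‖ ≤ ‖u - u'‖ := norm_starHom_le _ _
  have hp : ‖a * amp n x‖ ≤ 2 * s := ((norm_mul_le _ _).trans
    (mul_le_mul_of_nonneg_left (norm_amp_le n x) (norm_nonneg _))).trans (key w hw)
  have hq : ‖amp n x * a'‖ ≤ 2 * s := by
    refine ((norm_mul_le _ _).trans
      (mul_le_mul_of_nonneg_right (norm_amp_le n x) (norm_nonneg _))).trans ?_
    rw [mul_comm]; exact key w' hw'
  have h5 : ‖u - u'‖ ≤ K * (6 * s * ‖u - u'‖) := by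
    conv_lhs => rw [h4, norm_neg]
    refine (hb _).trans (mul_le_mul_of_nonneg_left ?_ hK.le)
    refine (norm_add₃_le).trans ?_
    have e1 : ‖a * amp n x * d‖ ≤ 2 * s * ‖u - u'‖ :=
      (norm_mul_le _ _).trans (mul_le_mul hp hdn (norm_nonneg _) (by positivity))
    have e2 : ‖d * (amp n x * a')‖ ≤ ‖u - u'‖ * (2 * s) :=
      (norm_mul_le _ _).trans (mul_le_mul hdn hq (norm_nonneg _) (by positivity))
    have e3 : ‖a * amp n x * d * (amp n x * a')‖ ≤ 2 * s * ‖u - u'‖ * (2 * s) :=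
      (norm_mul_le _ _).trans (mul_le_mul e1 hq (norm_nonneg _) (by positivity))
    have e4 : 2 * s * ‖u - u'‖ * (2 * s) ≤ 2 * s * ‖u - u'‖ * 1 :=
      mul_le_mul_of_nonneg_left (by linarith) (by positivity)
    linarith
  have h6 : K * (6 * s * ‖u - u'‖) ≤ ‖u - u'‖ / 2 := by
    nlinarith [norm_nonneg (u - u')]
  have h7 : u = u' := by
    rw [← sub_eq_zero, ← norm_le_zero_iff]
    linarith [norm_nonneg (u - u')]
  refine Subtype.ext ?_
  calc w.1 = w.1 * (u' * w'.1) := by rw [hu', Ring.inverse_mul_cancel _ hwu', mul_one]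
    _ = w'.1 := by rw [← h7, ← mul_assoc, hu, Ring.mul_inverse_cancel _ hwu, one_mul]

end Injectivity

/-! ### Fully matricial functions are analytic -/

section Analytic

variable {B : Type*} [CStarAlgebra B] [PartialOrder B] [StarOrderedRing B]

theorem mem_upperHalf_iff {n : ℕ} {z : Mat n B} :
    z ∈ upperHalf B n ↔ ∃ ε : ℝ, 0 < ε ∧ ε • (1 : Mat n B) ≤ im z := Iff.rfl

theorem isOpen_upperHalf (n : ℕ) : IsOpen (upperHalf B n) := by
  rw [Metric.isOpen_iff]
  rintro z ⟨ε, hε, hz⟩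
  refine ⟨ε / 2, half_pos hε, fun w hw => ?_⟩
  rw [Metric.mem_ball, dist_eq_norm] at hw
  have := smul_one_le_im_of_norm_sub_le (z := z) hz hw.le
  exact ⟨ε - ε / 2, by linarith, this⟩

theorem add_mem_upperHalf {n : ℕ} {z w : Mat n B} (hz : z ∈ upperHalf B n)
    (hw : w ∈ upperHalf B n) {s t : ℝ} (hs : 0 ≤ s) (ht : 0 ≤ t) (hst : s + t = 1) :
    s • z + t • w ∈ upperHalf B n := by
  obtain ⟨ε, hε, hz⟩ := mem_upperHalf_iff.1 hz
  obtain ⟨δ, hδ, hw⟩ := mem_upperHalf_iff.1 hw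
  refine mem_upperHalf_iff.2 ⟨min ε δ, lt_min hε hδ, ?_⟩
  have e : im (s • z + t • w) = s • im z + t • im w := by
    rw [im_add]; exact congrArg₂ _ (im_real_smul s z) (im_real_smul t w)
  have h1 : min ε δ • (1 : Mat n B) ≤ im z :=
    (smul_one_le_smul_one (D := Mat n B) (min_le_left _ _)).trans hz
  have h2 : min ε δ • (1 : Mat n B) ≤ im w :=
    (smul_one_le_smul_one (D := Mat n B) (min_le_right _ _)).trans hw
  rw [e]
  calc min ε δ • (1 : Mat n B) = s • (min ε δ • (1 : Mat n B)) + t • (min ε δ • (1 : Mat n B)) := by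
        rw [← add_smul, hst, one_smul]
    _ ≤ _ := add_le_add (smul_le_smul_of_nonneg_left h1 hs) (smul_le_smul_of_nonneg_left h2 ht)

end Analytic

/-! ### Block triangular matrices, difference quotients and the identity theorem -/

section Analytic

set_option linter.unusedSectionVars false

variable {B : Type*} [CStarAlgebra B]

/-- The block matrix with rows `(a, b)` and `(0, d)`. -/
def upperTri {R : Type*} [Zero R] {n : ℕ} (a b d : Mat n R) : Mat (n + n) R :=
  CStarMatrix.ofMatrix (Matrix.reindex finSumFinEquiv finSumFinEquiv
    (Matrix.fromBlocks (CStarMatrix.ofMatrix.symm a) (CStarMatrix.ofMatrix.symm b) 0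
      (CStarMatrix.ofMatrix.symm d)))

section

variable {R : Type*} [Zero R] {n : ℕ} (a b d : Mat n R) (i j : Fin n)

theorem upperTri₁₁ : upperTri a b d (Fin.castAdd n i) (Fin.castAdd n j) = a i j := by
  simp [upperTri, -Fin.natAdd_eq_addNat]

theorem upperTri₁₂ : upperTri a b d (Fin.castAdd n i) (Fin.natAdd n j) = b i j := by
  simp [upperTri, -Fin.natAdd_eq_addNat]

theorem upperTri₂₁ : upperTri a b d (Fin.natAdd n i) (Fin.castAdd n j) = 0 := by
  simp [upperTri, -Fin.natAdd_eq_addNat]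

theorem upperTri₂₂ : upperTri a b d (Fin.natAdd n i) (Fin.natAdd n j) = d i j := by
  simp [upperTri, -Fin.natAdd_eq_addNat]

theorem upperTri_zero : upperTri a 0 d = directSum a d := by
  refine ext_blocks ?_ ?_ ?_ ?_ <;> intro i j <;>
    simp only [directSum_castAdd_castAdd, directSum_castAdd_natAdd, directSum_natAdd_castAdd,
      directSum_natAdd_natAdd, upperTri₁₁, upperTri₁₂, upperTri₂₁, upperTri₂₂]
  rfl

end

theorem upperTri_mul {R : Type*} [Ring R] {n : ℕ} (a b d a' b' d' : Mat n R) :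
    upperTri a b d * upperTri a' b' d' = upperTri (a * a') (a * b' + b * d') (d * d') := by
  refine ext_blocks ?_ ?_ ?_ ?_ <;> intro i j <;>
    simp [CStarMatrix.mul_apply, Fin.sum_univ_add, upperTri₁₁, upperTri₁₂, upperTri₂₁, upperTri₂₂,
      -Fin.natAdd_eq_addNat]

/-- The scalar matrix with rows `(1, t)` and `(0, 1)`. -/
noncomputable def shear (n : ℕ) (t : ℂ) : (Matrix (Fin (n + n)) (Fin (n + n)) ℂ)ˣ :=
  have h : ∀ s : ℂ, (upperTri 1 (s • 1) 1 : Mat (n + n) ℂ) * upperTri 1 (-s • 1) 1 = 1 := fun s => by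
    rw [upperTri_mul, one_mul, one_mul, mul_one, ← add_smul, neg_add_cancel, zero_smul,
      upperTri_zero, directSum_one]
  { val := CStarMatrix.ofMatrix.symm (upperTri 1 (t • 1) 1)
    inv := CStarMatrix.ofMatrix.symm (upperTri 1 (-t • 1) 1)
    val_inv := h t
    inv_val := by
      have := h (-t)
      rwa [neg_neg] at this }

theorem scalar_upperTri {n : ℕ} (t : ℂ) :
    (scalar (CStarMatrix.ofMatrix.symm (upperTri 1 (t • 1) 1 : Mat (n + n) ℂ)) : Mat (n + n) B)
      = upperTri 1 (t • 1) 1 := by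
  have h : ∀ i j : Fin n, algebraMap ℂ B ((1 : Mat n ℂ) i j) = (1 : Mat n B) i j := fun i j => by
    rw [CStarMatrix.one_apply, CStarMatrix.one_apply]
    split_ifs <;> simp
  refine ext_blocks ?_ ?_ ?_ ?_ <;> intro i j <;>
    simp only [scalar_apply, CStarMatrix.ofMatrix_symm_apply, upperTri₁₁, upperTri₁₂, upperTri₂₁,
      upperTri₂₂, h, map_zero, CStarMatrix.smul_apply, smul_eq_mul, map_mul]
  rw [Algebra.smul_def]

/-- A scalar similarity turns a direct sum into a block matrix whose corner is a multiple of the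
difference of the diagonal blocks. Applied to arguments and values alike, it lets a fully matricial
function compute its own difference quotients. -/
theorem shear_conj {n : ℕ} (t : ℂ) (a d : Mat n B) :
    scalar (shear n t).1 * directSum a d * scalar (shear n t)⁻¹.1
      = upperTri a (t • (d - a)) d := by
  change scalar (CStarMatrix.ofMatrix.symm (upperTri 1 (t • 1) 1 : Mat (n + n) ℂ)) * directSum a d *
    scalar (CStarMatrix.ofMatrix.symm (upperTri 1 (-t • 1) 1 : Mat (n + n) ℂ)) = _
  rw [scalar_upperTri, scalar_upperTri, ← upperTri_zero, upperTri_mul, upperTri_mul]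
  congr 1
  · simp
  · simp [smul_sub]
    abel
  · simp

variable [PartialOrder B] [StarOrderedRing B]

theorem continuous_of_entries {X : Type*} [TopologicalSpace X] {n : ℕ} {f : X → Mat n B}
    (h : ∀ i j, Continuous fun x => f x i j) : Continuous f :=
  continuous_pi fun i => continuous_pi fun j => h i j

theorem continuous_entry {n : ℕ} (i j : Fin n) : Continuous fun M : Mat n B => M i j :=
  continuous_apply_apply (ρ := fun _ _ => B) i j

/-- `upperTri` as a continuous linear map. -/
noncomputable def upperTriL (B : Type*) [CStarAlgebra B] [PartialOrder B] [StarOrderedRing B]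
    (n : ℕ) : (Mat n B × Mat n B × Mat n B) →L[ℂ] Mat (n + n) B where
  toFun p := upperTri p.1 p.2.1 p.2.2
  map_add' p q := by
    refine ext_blocks ?_ ?_ ?_ ?_ <;> intro i j <;>
      simp [upperTri₁₁, upperTri₁₂, upperTri₂₁, upperTri₂₂, -Fin.natAdd_eq_addNat]
  map_smul' c p := by
    refine ext_blocks ?_ ?_ ?_ ?_ <;> intro i j <;>
      simp [upperTri₁₁, upperTri₁₂, upperTri₂₁, upperTri₂₂, -Fin.natAdd_eq_addNat]
  cont := by
    refine continuous_of_entries fun i j => ?_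
    refine Fin.addCases (fun i => ?_) (fun i => ?_) i <;>
      refine Fin.addCases (fun j => ?_) (fun j => ?_) j
    · simp only [upperTri₁₁]
      exact (continuous_entry i j).comp continuous_fst
    · simp only [upperTri₁₂]
      exact (continuous_entry i j).comp (continuous_fst.comp continuous_snd)
    · simp only [upperTri₂₁]
      exact continuous_const
    · simp only [upperTri₂₂]
      exact (continuous_entry i j).comp (continuous_snd.comp continuous_snd)

theorem upperTriL_apply {n : ℕ} (a b d : Mat n B) :
    upperTriL B n (a, b, d) = upperTri a b d := rfl

/-- The upper right block. -/
noncomputable def cornerL (B : Type*) [CStarAlgebra B] [PartialOrder B] [StarOrderedRing B]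
    (n : ℕ) : Mat (n + n) B →L[ℂ] Mat n B where
  toFun M := CStarMatrix.ofMatrix (Matrix.of fun i j => M (Fin.castAdd n i) (Fin.natAdd n j))
  map_add' M N := by ext i j; rfl
  map_smul' c M := by ext i j; rfl
  cont := continuous_of_entries fun i j => continuous_entry (Fin.castAdd n i) (Fin.natAdd n j)

theorem cornerL_upperTri {n : ℕ} (a b d : Mat n B) : cornerL B n (upperTri a b d) = b := by
  ext i j
  exact upperTri₁₂ a b d i j

/-- Local boundedness is stated for sizes m * n, direct sums have size n + n. For m = 2 the two
matrices agree up to a cast of the indices. -/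
theorem directSum_self_eq {n : ℕ} (z : Mat n B) (i j : Fin (n + n)) :
    directSum z z i j = copies 2 z (Fin.cast (two_mul n).symm i) (Fin.cast (two_mul n).symm j) := by
  have h₁ : ∀ i : Fin n, Fin.cast (two_mul n).symm (Fin.castAdd n i)
      = finProdFinEquiv ((0 : Fin 2), i) := fun i => by ext; simp
  have h₂ : ∀ i : Fin n, Fin.cast (two_mul n).symm (Fin.natAdd n i)
      = finProdFinEquiv ((1 : Fin 2), i) := fun i => by ext; simp
  refine Fin.addCases (fun i => ?_) (fun i => ?_) i <;>
    refine Fin.addCases (fun j => ?_) (fun j => ?_) j <;>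
    simp only [h₁, h₂, copies_apply, directSum_castAdd_castAdd, directSum_castAdd_natAdd,
      directSum_natAdd_castAdd, directSum_natAdd_natAdd, if_true] <;> simp

/-- The extension by zero of a function on the upper half-plane. -/
noncomputable def extendZero (F : ∀ n, upperHalf B n → Mat n B) (n : ℕ) (z : Mat n B) : Mat n B :=
  open Classical in if h : z ∈ upperHalf B n then F n ⟨z, h⟩ else 0

theorem extendZero_of_mem (F : ∀ n, upperHalf B n → Mat n B) {n : ℕ} {z : Mat n B}
    (h : z ∈ upperHalf B n) : extendZero F n z = F n ⟨z, h⟩ := dif_pos h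

theorem copies_mem_upperHalf {n : ℕ} (m : ℕ) {z : Mat n B} (hz : z ∈ upperHalf B n) :
    copies m z ∈ upperHalf B (m * n) := by
  obtain ⟨ε, hε, hz⟩ := hz
  exact ⟨ε, hε, smul_one_le_im_map (copiesStarHom m n B) hz⟩

/-! ### Continuity and complex differentiability of fully matricial functions -/

namespace IsFullyMatricial

variable {F : ∀ n, upperHalf B n → Mat n B} (hF : IsFullyMatricial (upperHalf B) F)
include hF

theorem exists_bound_directSum_self {n : ℕ} {z : Mat n B} (hz : z ∈ upperHalf B n) :
    OpValFree.directSum z z ∈ upperHalf B (n + n) ∧ ∃ δ > 0, ∃ M > 0, ∀ w : Mat (n + n) B,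
      w ∈ upperHalf B (n + n) → ‖w - OpValFree.directSum z z‖ < δ → ‖extendZero F (n + n) w‖ ≤ M := by
  obtain ⟨δ, hδ, M, hM, h⟩ := hF.locally_bounded ⟨z, hz⟩
  -- The size n + n is generalized to a variable k with k = 2 * n, so that the equation between
  -- sizes can be substituted.
  have key : ∀ (k : ℕ) (hk : k = 2 * n) (y : Mat k B),
      (∀ i j, y i j = copies 2 z (Fin.cast hk i) (Fin.cast hk j)) →
      y ∈ upperHalf B k ∧ ∃ δ > 0, ∃ M > 0, ∀ w : Mat k B,
        w ∈ upperHalf B k → ‖w - y‖ < δ → ‖extendZero F k w‖ ≤ M := by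
    intro k hk y hy
    subst hk
    obtain rfl : y = copies 2 z := by ext i j; exact hy i j
    refine ⟨copies_mem_upperHalf 2 hz, δ, hδ, M, hM, fun w hw hwδ => ?_⟩
    rw [extendZero_of_mem F hw]
    exact h 2 ⟨w, hw⟩ hwδ
  exact key (n + n) (two_mul n).symm (OpValFree.directSum z z) (directSum_self_eq z)

/-- The argument is the shear conjugate of w ⊕ z, so the value is the same conjugate of F(w) ⊕ F(z).
-/
theorem apply_upperTri {n : ℕ} {z w : Mat n B} (hz : z ∈ upperHalf B n) (hw : w ∈ upperHalf B n)
    (hd : OpValFree.directSum w z ∈ upperHalf B (n + n)) (t : ℂ)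
    (hu : upperTri w (t • (z - w)) z ∈ upperHalf B (n + n)) :
    extendZero F (n + n) (upperTri w (t • (z - w)) z)
      = upperTri (extendZero F n w) (t • (extendZero F n z - extendZero F n w))
          (extendZero F n z) := by
  rw [extendZero_of_mem F hu, extendZero_of_mem F hz, extendZero_of_mem F hw,
    hF.similarity ⟨_, hd⟩ ⟨_, hu⟩ (shear n t) (shear_conj t w z).symm,
    hF.directSum ⟨w, hw⟩ ⟨z, hz⟩ ⟨_, hd⟩ rfl, shear_conj]

/-- For fixed t the block matrix with diagonal w, z and corner t(z − w) tends to z ⊕ z as w → z, so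
its value stays bounded. The corner of that value is t(F(z) − F(w)), and t may be chosen as large as
desired. -/
theorem continuousAt {n : ℕ} {z : Mat n B} (hz : z ∈ upperHalf B n) :
    ContinuousAt (extendZero F n) z := by
  obtain ⟨hzz, δ, hδ, M, hM, h⟩ := hF.exists_bound_directSum_self hz
  have hev : ∀ᶠ w in 𝓝 (OpValFree.directSum z z), w ∈ upperHalf B (n + n) ∧ ‖w - OpValFree.directSum z z‖ < δ :=
    Filter.Eventually.and ((isOpen_upperHalf (n + n)).mem_nhds hzz)
      (Filter.Eventually.mono (Metric.ball_mem_nhds _ hδ) fun w hw => by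
        rwa [← dist_eq_norm])
  rw [Metric.continuousAt_iff']
  intro ε hε
  set K : ℝ := ‖cornerL B n‖ * M with hK
  have hK0 : 0 ≤ K := by positivity
  -- This gives tε = K + ε > K, while the corner estimate gives t‖F(z) − F(w)‖ ≤ K.
  set t : ℝ := K / ε + 1 with ht
  have ht0 : 0 < t := by positivity
  have hcont : ContinuousAt (fun w : Mat n B => upperTriL B n (w, (t : ℂ) • (z - w), z)) z := by
    fun_prop
  have hcont' : ContinuousAt (fun w : Mat n B => upperTriL B n (w, 0, z)) z := by fun_prop
  have e : ∀ w : Mat n B, upperTriL B n (w, 0, z) = OpValFree.directSum w z := fun w => upperTri_zero w z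
  have hlim : Tendsto (fun w : Mat n B => upperTriL B n (w, (t : ℂ) • (z - w), z)) (𝓝 z)
      (𝓝 (OpValFree.directSum z z)) := by
    have := hcont.tendsto
    rwa [sub_self, smul_zero, e] at this
  have hlim' : Tendsto (fun w : Mat n B => upperTriL B n (w, 0, z)) (𝓝 z)
      (𝓝 (OpValFree.directSum z z)) := by
    have := hcont'.tendsto
    rwa [e] at this
  filter_upwards [hlim.eventually hev, hlim'.eventually hev,
    (isOpen_upperHalf n).mem_nhds hz] with w h1 h2 hw
  rw [e] at h2
  have h3 := h _ h1.1 h1.2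
  rw [upperTriL_apply, hF.apply_upperTri hz hw h2.1 t h1.1] at h3
  have h4 := (cornerL B n).le_opNorm (upperTri (extendZero F n w)
    ((t : ℂ) • (extendZero F n z - extendZero F n w)) (extendZero F n z))
  rw [cornerL_upperTri, norm_smul, Complex.norm_real, Real.norm_of_nonneg ht0.le] at h4
  have h5 : t * ‖extendZero F n z - extendZero F n w‖ ≤ K :=
    h4.trans (mul_le_mul_of_nonneg_left h3 (norm_nonneg _))
  rw [dist_comm, dist_eq_norm]
  have h6 : t * ε = K + ε := by rw [ht, add_mul, div_mul_cancel₀ _ hε.ne', one_mul]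
  by_contra! h7
  have := mul_le_mul_of_nonneg_left h7 ht0.le
  linarith

/-- The block matrix with diagonal z + tk, z and corner ck has a value whose corner is c times the
difference quotient at t. Continuity of F at size n + n yields the limit as t → 0. -/
theorem differentiableAt_line {n : ℕ} {z : Mat n B} (hz : z ∈ upperHalf B n) (k : Mat n B) :
    DifferentiableAt ℂ (fun t : ℂ => extendZero F n (z + t • k)) 0 := by
  obtain ⟨hzz, -⟩ := hF.exists_bound_directSum_self hz
  have hzz' : upperTriL B n (z, 0, z) ∈ upperHalf B (n + n) := by
    rwa [upperTriL_apply, upperTri_zero]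
  -- The direction k is arbitrary, so it is rescaled to keep the block matrix in the upper
  -- half-plane; c is divided out of the derivative afterwards.
  obtain ⟨c, hc0, hc⟩ : ∃ c : ℂ, c ≠ 0 ∧ upperTriL B n (z, c • k, z) ∈ upperHalf B (n + n) := by
    have hcont : ContinuousAt (fun c : ℂ => upperTriL B n (z, c • k, z)) 0 := by fun_prop
    have : ∀ᶠ c in 𝓝 (0 : ℂ), upperTriL B n (z, c • k, z) ∈ upperHalf B (n + n) :=
      hcont.eventually_mem ((isOpen_upperHalf (n + n)).mem_nhds (by simpa using hzz'))
    obtain ⟨c, hc, hc0⟩ := ((this.filter_mono nhdsWithin_le_nhds).and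
      (self_mem_nhdsWithin : ({0}ᶜ : Set ℂ) ∈ 𝓝[≠] 0)).exists
    exact ⟨c, hc0, hc⟩
  refine HasDerivAt.differentiableAt
    (f' := c⁻¹ • cornerL B n (extendZero F (n + n) (upperTriL B n (z, c • k, z)))) ?_
  rw [hasDerivAt_iff_tendsto_slope_zero]
  have hcont : ContinuousAt (fun t : ℂ => upperTriL B n (z + t • k, c • k, z)) 0 := by fun_prop
  have hcont' : ContinuousAt (fun t : ℂ => upperTriL B n (z + t • k, 0, z)) 0 := by fun_prop
  have hcont₁ : ContinuousAt (fun t : ℂ => z + t • k) 0 := by fun_prop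
  have e0 : z + (0 : ℂ) • k = z := by rw [zero_smul, add_zero]
  have hlim : Tendsto (fun t : ℂ => c⁻¹ • cornerL B n (extendZero F (n + n)
      (upperTriL B n (z + t • k, c • k, z)))) (𝓝 0)
      (𝓝 (c⁻¹ • cornerL B n (extendZero F (n + n) (upperTriL B n (z, c • k, z))))) := by
    have h1 : ContinuousAt (extendZero F (n + n)) (upperTriL B n (z + (0 : ℂ) • k, c • k, z)) := by
      rw [e0]; exact hF.continuousAt hc
    have h2 : ContinuousAt (fun t : ℂ => extendZero F (n + n)
        (upperTriL B n (z + t • k, c • k, z))) 0 :=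
      ContinuousAt.comp (f := fun t : ℂ => upperTriL B n (z + t • k, c • k, z)) h1 hcont
    have h3 : ContinuousAt (fun t : ℂ => c⁻¹ • cornerL B n (extendZero F (n + n)
        (upperTriL B n (z + t • k, c • k, z)))) 0 :=
      ((cornerL B n).continuous.continuousAt.comp h2).const_smul c⁻¹
    have := h3.tendsto
    simpa only [e0] using this
  refine (hlim.mono_left nhdsWithin_le_nhds).congr' ?_
  have ev1 : ∀ᶠ t in 𝓝 (0 : ℂ), upperTriL B n (z + t • k, c • k, z) ∈ upperHalf B (n + n) :=
    hcont.eventually_mem ((isOpen_upperHalf (n + n)).mem_nhds (by simpa using hc))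
  have ev2 : ∀ᶠ t in 𝓝 (0 : ℂ), upperTriL B n (z + t • k, 0, z) ∈ upperHalf B (n + n) :=
    hcont'.eventually_mem ((isOpen_upperHalf (n + n)).mem_nhds (by simpa using hzz'))
  have ev3 : ∀ᶠ t in 𝓝 (0 : ℂ), z + t • k ∈ upperHalf B n :=
    hcont₁.eventually_mem ((isOpen_upperHalf n).mem_nhds (by simpa using hz))
  filter_upwards [ev1.filter_mono nhdsWithin_le_nhds, ev2.filter_mono nhdsWithin_le_nhds,
    ev3.filter_mono nhdsWithin_le_nhds, self_mem_nhdsWithin] with t h1 h2 h3 ht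
  have ht0 : t ≠ 0 := ht
  rw [upperTriL_apply, upperTri_zero] at h2
  rw [upperTriL_apply] at h1 ⊢
  -- The corner ck is a multiple of the difference −tk of the diagonal blocks, which is the form
  -- that the shear identity requires.
  have e : c • k = (-(c / t)) • (z - (z + t • k)) := by
    rw [sub_add_cancel_left, smul_neg, neg_smul, neg_neg, smul_smul, div_mul_cancel₀ _ ht0]
  rw [e] at h1 ⊢
  rw [hF.apply_upperTri hz h3 h2 _ h1, cornerL_upperTri, zero_add, zero_smul, add_zero, smul_smul,
    ← neg_sub (extendZero F n (z + t • k)), smul_neg, ← neg_smul]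
  congr 1
  field_simp

theorem differentiableOn_line {n : ℕ} (p k : Mat n B) :
    DifferentiableOn ℂ (fun t : ℂ => extendZero F n (p + t • k))
      {t | p + t • k ∈ upperHalf B n} := by
  intro s hs
  refine DifferentiableAt.differentiableWithinAt ?_
  have h := hF.differentiableAt_line hs k
  have h' : DifferentiableAt ℂ (fun t : ℂ => t - s) s := by fun_prop
  have h2 := DifferentiableAt.comp s (g := fun t : ℂ => extendZero F n (p + s • k + t • k))
    (f := fun t : ℂ => t - s) (by rwa [sub_self]) h'
  refine h2.congr_of_eventuallyEq (Eventually.of_forall fun t => ?_)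
  simp only [Function.comp_apply]
  congr 1
  rw [sub_smul]
  abel

end IsFullyMatricial

/-- The identity theorem for fully matricial functions on the upper half-plane. -/
theorem IsFullyMatricial.eq_of_eventuallyEq {F F' : ∀ n, upperHalf B n → Mat n B}
    (hF : IsFullyMatricial (upperHalf B) F) (hF' : IsFullyMatricial (upperHalf B) F') {n : ℕ}
    {p : Mat n B} (hp : p ∈ upperHalf B n) (h : extendZero F n =ᶠ[𝓝 p] extendZero F' n) :
    F n = F' n := by
  funext ⟨z, hz⟩
  -- The slice of the half-plane by the complex line through p and z is open and convex and contains
  -- 0 and 1, the parameters of p and z. The one-variable identity theorem therefore suffices.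
  set U : Set ℂ := {t | p + t • (z - p) ∈ upperHalf B n} with hU
  have hcont : Continuous fun t : ℂ => p + t • (z - p) := by fun_prop
  have hUo : IsOpen U := (isOpen_upperHalf n).preimage hcont
  have hUc : Convex ℝ U := by
    intro s hs t ht a b ha hb hab
    have := add_mem_upperHalf hs ht ha hb hab
    have e : p + (a • s + b • t) • (z - p) = a • (p + s • (z - p)) + b • (p + t • (z - p)) := by
      obtain rfl : b = 1 - a := by linarith
      ext i j
      change p i j + (a • s + (1 - a) • t) • (z i j - p i j)
        = a • (p i j + s • (z i j - p i j)) + (1 - a) • (p i j + t • (z i j - p i j))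
      simp only [← Complex.coe_smul]
      push_cast
      module
    change p + (a • s + b • t) • (z - p) ∈ upperHalf B n
    rwa [e]
  have h0 : (0 : ℂ) ∈ U := by
    change p + (0 : ℂ) • (z - p) ∈ upperHalf B n
    rwa [zero_smul, add_zero]
  have h1 : (1 : ℂ) ∈ U := by
    change p + (1 : ℂ) • (z - p) ∈ upperHalf B n
    rwa [one_smul, add_sub_cancel]
  have hev : (fun t : ℂ => extendZero F n (p + t • (z - p))) =ᶠ[𝓝 0]
      fun t => extendZero F' n (p + t • (z - p)) := by
    have ht : Tendsto (fun t : ℂ => p + t • (z - p)) (𝓝 0) (𝓝 p) := by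
      have := hcont.tendsto 0
      rwa [zero_smul, add_zero] at this
    exact ht.eventually h
  have := ((hF.differentiableOn_line p (z - p)).analyticOnNhd hUo).eqOn_of_preconnected_of_eventuallyEq
    ((hF'.differentiableOn_line p (z - p)).analyticOnNhd hUo) hUc.isPreconnected h0 hev h1
  simpa only [one_smul, add_sub_cancel, extendZero_of_mem _ hz] using this

theorem I_smul_one_mem_upperHalf {n : ℕ} {T : ℝ} (hT : 0 < T) :
    (T * Complex.I) • (1 : Mat n B) ∈ upperHalf B n := by
  refine mem_upperHalf_iff.2 ⟨T, hT, le_of_eq ?_⟩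
  have e : (2 * Complex.I)⁻¹ * (T * Complex.I - star (T * Complex.I)) = (T : ℂ) := by
    simp only [RCLike.star_def, map_mul, Complex.conj_ofReal, Complex.conj_I]
    field_simp
    ring
  rw [im, star_smul, star_one, ← sub_smul, smul_smul, e]
  ext i j
  change T • (1 : Mat n B) i j = (T : ℂ) • (1 : Mat n B) i j
  rw [Complex.coe_smul]

/-- A subordination function is determined by the Cauchy transforms if `Gμ` is injective near
infinity. -/
theorem IsSubordination.unique {Gμ Gν : ∀ n, Mat n B → Mat n B}
    (hG : ∀ n, ∃ r : ℝ, 0 < r ∧ ∀ w w' : upperHalf B n, ‖Ring.inverse w.1‖ < r →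
      ‖Ring.inverse w'.1‖ < r → Gμ n w.1 = Gμ n w'.1 → w = w')
    {F F' : ∀ n, upperHalf B n → upperHalf B n} (hF : IsSubordination Gμ Gν F)
    (hF' : IsSubordination Gμ Gν F') : F' = F := by
  funext n z
  obtain ⟨r, hr, hinj⟩ := hG n
  obtain ⟨δ, hδ, h⟩ := hF.normalized n r hr
  obtain ⟨δ', hδ', h'⟩ := hF'.normalized n r hr
  have hmin : 0 < min δ δ' := lt_min hδ hδ'
  -- For p = iT this makes ‖p⁻¹‖ at most half of min δ δ', hence strictly below both thresholds.
  set T : ℝ := 2 / min δ δ' with hT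
  have hT0 : 0 < T := by positivity
  set p : Mat n B := (T * Complex.I) • 1 with hp
  have hpm : p ∈ upperHalf B n := I_smul_one_mem_upperHalf hT0
  have hTI : (T * Complex.I : ℂ) ≠ 0 := mul_ne_zero (by exact_mod_cast hT0.ne') Complex.I_ne_zero
  have hpu : IsUnit p := by
    obtain ⟨ε, hε, hz⟩ := mem_upperHalf_iff.1 hpm
    exact isUnit_of_le_im hε hz
  have hpi : ‖Ring.inverse p‖ < min δ δ' := by
    have e : Ring.inverse p = (T * Complex.I : ℂ)⁻¹ • 1 := by
      refine ringInverse_eq ?_ ?_ <;>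
        simp only [hp, smul_mul_assoc, mul_smul_comm, one_mul, smul_smul]
      · rw [inv_mul_cancel₀ hTI, one_smul]
      · rw [mul_inv_cancel₀ hTI, one_smul]
    rw [e, norm_smul]
    have h1 : ‖(T * Complex.I : ℂ)⁻¹‖ = min δ δ' / 2 := by
      rw [norm_inv, norm_mul, Complex.norm_I, mul_one, Complex.norm_real,
        Real.norm_of_nonneg hT0.le, hT, inv_div]
    rw [h1]
    have := norm_one_le (D := Mat n B)
    nlinarith
  have hev : ∀ᶠ w in 𝓝 p, ‖Ring.inverse w‖ < min δ δ' := by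
    obtain ⟨u, hu⟩ := hpu
    have hc : ContinuousAt Ring.inverse p := by
      rw [← hu]; exact NormedRing.inverse_continuousAt u
    exact hc.norm.eventually (gt_mem_nhds hpi)
  -- Near p both functions take values with inverse of norm below r, where Gμ is injective, and Gμ
  -- sends both values to Gν.
  have hFF : (fun z => (F' n z).1) = fun z => (F n z).1 := by
    refine hF'.fully_matricial.eq_of_eventuallyEq hF.fully_matricial hpm ?_
    filter_upwards [hev, (isOpen_upperHalf n).mem_nhds hpm] with w hw hwm
    rw [extendZero_of_mem _ hwm, extendZero_of_mem _ hwm]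
    refine congrArg Subtype.val (hinj _ _ (h' ⟨w, hwm⟩ (hw.trans_le (min_le_right _ _)))
      (h ⟨w, hwm⟩ (hw.trans_le (min_le_left _ _))) ?_)
    rw [← hF'.subordination, ← hF.subordination]
  exact Subtype.ext (congrFun hFF z)

end Analytic

open PreHilbertModule PointedCorrespondence

/-! ### Adjointable operators -/

section Adjointable

set_option linter.unusedSectionVars false

variable (B P : Type*) [CStarAlgebra B] [PartialOrder B] [StarOrderedRing B]
  [NormedAddCommGroup P] [NormedSpace ℂ P] [Module Bᵐᵒᵖ P] [RightHilbertModule B P]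

theorem norm_inner_le (x y : P) : ‖(inner B x y : B)‖ ≤ ‖x‖ * ‖y‖ := by
  refine le_of_sq_le_sq ?_ (by positivity)
  rw [mul_pow, RightHilbertModule.norm_sq (B := B) x, RightHilbertModule.norm_sq (B := B) y]
  exact norm_ip_sq_le x y

variable {P} in
theorem ext_inner {x y : P} (h : ∀ z, (inner B z x : B) = inner B z y) : x = y := by
  rw [← sub_eq_zero]
  refine eq_zero_of_inner_self (B := B) ?_
  rw [ip_sub_right, h, sub_self]

/-- The inner product as a continuous map of the second variable. -/
theorem continuous_inner_right (x : P) : Continuous fun y : P => (inner B x y : B) := by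
  let f : P →ₗ[ℂ] B :=
    { toFun := fun y => inner B x y
      map_add' := ip_add_right x
      map_smul' := ip_smul_right x }
  exact (f.mkContinuous ‖x‖ fun y => norm_inner_le B P x y).continuous

theorem continuous_inner_left (y : P) : Continuous fun x : P => (inner B x y : B) := by
  have : (fun x : P => (inner B x y : B)) = fun x => star (inner B y x : B) := by
    funext x; rw [ip_star]
  rw [this]
  exact (continuous_inner_right B P y).star

/-- The adjointable operators on a right Hilbert `B`-module. -/
def adjointable : Subalgebra ℂ (P →L[ℂ] P) where
  carrier := {T | ∃ T' : P →L[ℂ] P, ∀ x y, (inner B (T x) y : B) = inner B x (T' y)}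
  mul_mem' := by
    rintro S T ⟨S', hS⟩ ⟨T', hT⟩
    exact ⟨T' * S', fun x y => by
      rw [mul_apply_eq_comp, hS, hT, mul_apply_eq_comp]⟩
  add_mem' := by
    rintro S T ⟨S', hS⟩ ⟨T', hT⟩
    exact ⟨S' + T', fun x y => by
      rw [add_apply, add_apply, ip_add_left, ip_add_right, hS, hT]⟩
  algebraMap_mem' c := ⟨star c • 1, fun x y => by
    rw [Algebra.algebraMap_eq_smul_one]
    simp only [smul_apply, one_apply_eq_self, ip_smul_left, ip_smul_right]⟩

variable {B P}

theorem adjoint_unique {T S S' : P →L[ℂ] P} (h : ∀ x y, (inner B (T x) y : B) = inner B x (S y))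
    (h' : ∀ x y, (inner B (T x) y : B) = inner B x (S' y)) : S = S' :=
  ContinuousLinearMap.ext fun y => ext_inner B fun x => by rw [← h, h']

/-- An adjoint is merely chosen; `adjoint_unique` makes the choice immaterial. -/
noncomputable instance : Star (adjointable B P) where
  star T := ⟨T.2.choose, T.1, fun x y => by
    rw [← ip_star, ← T.2.choose_spec, ip_star]⟩

theorem inner_adjointable (T : adjointable B P) (x y : P) :
    (inner B (T.1 x) y : B) = inner B x ((star T).1 y) := T.2.choose_spec x y

theorem star_eq_of_inner {T T' : adjointable B P}
    (h : ∀ x y, (inner B (T.1 x) y : B) = inner B x (T'.1 y)) : star T = T' :=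
  Subtype.ext (adjoint_unique (inner_adjointable T) h)

noncomputable instance : StarRing (adjointable B P) where
  star_involutive T := star_eq_of_inner fun x y => by
    rw [← ip_star, ← inner_adjointable, ip_star]
  star_mul S T := star_eq_of_inner fun x y => by
    change (inner B (S.1 (T.1 x)) y : B) = inner B x ((star T).1 ((star S).1 y))
    rw [inner_adjointable, inner_adjointable]
  star_add S T := star_eq_of_inner fun x y => by
    change (inner B (S.1 x + T.1 x) y : B) = inner B x ((star S).1 y + (star T).1 y)
    rw [ip_add_left, ip_add_right, inner_adjointable, inner_adjointable]

instance : StarModule ℂ (adjointable B P) where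
  star_smul c T := star_eq_of_inner fun x y => by
    change (inner B (c • T.1 x) y : B) = inner B x (star c • (star T).1 y)
    rw [ip_smul_left, ip_smul_right, inner_adjointable]

/-- By Cauchy–Schwarz, ‖Tx‖² = ‖⟨x, T⋆Tx⟩‖ ≤ ‖T⋆T‖‖x‖². -/
instance : CStarRing (adjointable B P) where
  norm_mul_self_le T := by
    change ‖T.1‖ * ‖T.1‖ ≤ ‖(star T * T).1‖
    have h : ‖T.1‖ ≤ √‖(star T * T).1‖ := by
      refine T.1.opNorm_le_bound (Real.sqrt_nonneg _) fun x => ?_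
      refine le_of_sq_le_sq ?_ (by positivity)
      rw [mul_pow, Real.sq_sqrt (norm_nonneg _), RightHilbertModule.norm_sq (B := B),
        inner_adjointable]
      refine (norm_inner_le B P _ _).trans ?_
      have := (star T * T).1.le_opNorm x
      calc ‖x‖ * ‖(star T).1 (T.1 x)‖ ≤ ‖x‖ * (‖(star T * T).1‖ * ‖x‖) :=
            mul_le_mul_of_nonneg_left this (norm_nonneg _)
        _ = _ := by ring
    calc ‖T.1‖ * ‖T.1‖ ≤ √‖(star T * T).1‖ * √‖(star T * T).1‖ :=
          mul_le_mul h h (norm_nonneg _) (Real.sqrt_nonneg _)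
      _ = _ := Real.mul_self_sqrt (norm_nonneg _)

/-- The adjoint is isometric, so the adjoints of a Cauchy sequence converge too, and their limit is
an adjoint of the limit. -/
instance [CompleteSpace P] : CompleteSpace (adjointable B P) := by
  refine Metric.complete_of_cauchySeq_tendsto fun u hu => ?_
  have h1 : CauchySeq fun n => (u n).1 := hu.map uniformContinuous_subtype_val
  have h2 : CauchySeq fun n => (star (u n)).1 := by
    have hs : ∀ T : adjointable B P, ‖(star T).1‖ = ‖T.1‖ := fun T => norm_star T
    have hd : ∀ n m, dist (star (u n)).1 (star (u m)).1 = dist (u n).1 (u m).1 := fun n m => by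
      rw [dist_eq_norm, dist_eq_norm]
      have := hs (u n - u m)
      rw [star_sub] at this
      exact this
    rw [Metric.cauchySeq_iff] at h1 ⊢
    simpa only [hd] using h1
  obtain ⟨T, hT⟩ := cauchySeq_tendsto_of_complete h1
  obtain ⟨T', hT'⟩ := cauchySeq_tendsto_of_complete h2
  have e : ∀ x, Continuous fun S : P →L[ℂ] P => S x := fun x => by fun_prop
  refine ⟨⟨T, T', fun x y => ?_⟩, tendsto_subtype_rng.2 hT⟩
  refine tendsto_nhds_unique
    ((((continuous_inner_left B P y).comp (e x)).tendsto T).comp hT) ?_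
  have := (((continuous_inner_right B P x).comp (e y)).tendsto T').comp hT'
  refine this.congr fun n => ?_
  exact (inner_adjointable (u n) x y).symm

noncomputable instance [CompleteSpace P] : CStarAlgebra (adjointable B P) where

noncomputable instance [CompleteSpace P] : PartialOrder (adjointable B P) :=
  CStarAlgebra.spectralOrder _

instance [CompleteSpace P] : StarOrderedRing (adjointable B P) :=
  CStarAlgebra.spectralOrderedRing _

end Adjointable

open UniformSpace

/-! ### The operators on the free product -/

section FreeProductOperators

set_option linter.unusedSectionVars false

variable {B : Type*} [CStarAlgebra B] [PartialOrder B] [StarOrderedRing B]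
  {ι : Type*} [DecidableEq ι] {A H : ι → Type*} [∀ i, CStarAlgebra (A i)]
  [∀ i, NormedAddCommGroup (H i)] [∀ i, NormedSpace ℂ (H i)] [∀ i, Module Bᵐᵒᵖ (H i)]
  [∀ i, RightHilbertModule B (H i)] {S : ∀ i, ValuedProbSpace B (A i)}
  (C : ∀ i, PointedCorrespondence (S i) (H i))

section

variable {C} (x y z : FreeProd C)

theorem fock_add_right : (inner B x (y + z) : B) = inner B x y + inner B x z :=
  ip_add_right (B := B) (P := FreeProd C) x y z

theorem fock_add_left : (inner B (x + y) z : B) = inner B x z + inner B y z :=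
  ip_add_left (B := B) (P := FreeProd C) x y z

theorem fock_zero_right : (inner B x 0 : B) = 0 := ip_zero_right (B := B) (P := FreeProd C) x

theorem fock_zero_left : (inner B 0 x : B) = 0 := ip_zero_left (B := B) (P := FreeProd C) x

theorem fock_smul_right (c : ℂ) : (inner B x (c • y) : B) = c • inner B x y :=
  ip_smul_right (B := B) (P := FreeProd C) x c y

theorem fock_op_smul_right (b : B) : (inner B x (MulOpposite.op b • y) : B) = inner B x y * b :=
  ip_op_smul_right (P := FreeProd C) x y b

theorem fock_op_smul_left (b : B) :
    (inner B (MulOpposite.op b • x) y : B) = star b * inner B x y :=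
  ip_op_smul_left (P := FreeProd C) x y b

theorem fock_star : star (inner B x y : B) = inner B y x :=
  ip_star (B := B) (P := FreeProd C) x y

theorem fock_adjoint (T : adjointable B (FreeProd C)) :
    (inner B (T.1 x) y : B) = inner B x ((star T).1 y) := inner_adjointable T x y

theorem fock_adjoint' (T : adjointable B (FreeProd C)) :
    (inner B x (T.1 y) : B) = inner B ((star T).1 x) y := by rw [fock_adjoint, star_star]

end

/-- The vector `w b` of the free product. -/
noncomputable def vec (w : Word C) (b : B) : FreeProd C := (single C w b : PreFock C)

theorem freeProd_induction {p : FreeProd C → Prop} (x : FreeProd C) (hc : IsClosed {x | p x})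
    (h0 : p 0) (hs : ∀ w b, p (vec C w b)) (ha : ∀ x y, p x → p y → p (x + y)) : p x := by
  refine Completion.induction_on x hc fun x => ?_
  refine preFock_induction C (p := fun x : PreFock C => p x) x ?_ hs fun x y hx hy => ?_
  · rwa [Completion.coe_zero]
  · rw [Completion.coe_add]; exact ha _ _ hx hy

theorem ext_vec {T T' : FreeProd C →L[ℂ] FreeProd C} (h : ∀ w b, T (vec C w b) = T' (vec C w b)) :
    T = T' := by
  ext x
  refine freeProd_induction C (p := fun x => T x = T' x) x
    (isClosed_eq T.continuous T'.continuous) ?_ h fun x y hx hy => ?_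
  · rw [map_zero, map_zero]
  · rw [map_add, map_add, hx, hy]

theorem vec_eq (w : Word C) (b : B) : vec C w b = MulOpposite.op b • vec C w 1 := by
  rw [vec, vec, ← Completion.coe_smul, op_smul_single, one_mul]

theorem ext_inner_vec {x y : FreeProd C}
    (h : ∀ w, (inner B (vec C w 1) x : B) = inner B (vec C w 1) y) : x = y := by
  refine ext_inner B fun z => ?_
  refine freeProd_induction C (p := fun z => (inner B z x : B) = inner B z y) z
    (isClosed_eq (continuous_inner_left B _ x) (continuous_inner_left B _ y)) ?_ (fun w b => ?_)
    fun z z' hz hz' => ?_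
  · rw [fock_zero_left, fock_zero_left]
  · rw [vec_eq, fock_op_smul_left, fock_op_smul_left, h]
  · rw [fock_add_left, fock_add_left, hz, hz']

theorem inner_vec_vec (w v : Word C) (b c : B) :
    (inner B (vec C w b) (vec C v c) : B) = star b * wordForm C w.1 v.1 1 * c := by
  rw [vec, vec, inner_coe_coe, inner_single_single]

theorem act_vec (i : ι) (a : A i) (w : Word C) (b : B) :
    act C i a (vec C w b) = MulOpposite.op b • (actWord C i a w : FreeProd C) := by
  rw [vec, act_coe, preAct_single, Completion.coe_smul]

/-- These are the matrix coefficients of a ⊗ id on Hᵢ ⊗ Mᵢ: the operator a enters only through its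
action on Hᵢ. Additivity, homogeneity, adjoints and products of the operators are all checked on
them. -/
theorem inner_vec_act (i : ι) (a : A i) (w v : Word C) (b c : B) :
    (inner B (vec C w b) (act C i a (vec C v c)) : B)
      = star b * wordForm C (split C i w).2.1.1 (split C i v).2.1.1
          (inner B (split C i w).1 ((C i).rep a (split C i v).1)) * c := by
  rw [act_vec, fock_op_smul_right, vec_eq, fock_op_smul_left, vec, inner_coe_coe, actWord,
    inner_single_attach]

theorem inner_act_vec_act (i : ι) (a a' : A i) (w v : Word C) (b c : B) :
    (inner B (act C i a (vec C w b)) (act C i a' (vec C v c)) : B)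
      = star b * wordForm C (split C i w).2.1.1 (split C i v).2.1.1
          (inner B ((C i).rep a (split C i w).1) ((C i).rep a' (split C i v).1)) * c := by
  rw [vec, vec, act_coe, act_coe, inner_coe_coe, inner_preAct_single]

theorem act_one (i : ι) : act C i 1 = 1 := by
  refine ext_vec C fun v c => ext_inner_vec C fun w => ?_
  rw [inner_vec_act, map_one, one_apply_eq_self, one_apply_eq_self, inner_vec_vec,
    wordForm_split C i]

theorem act_add (i : ι) (a a' : A i) : act C i (a + a') = act C i a + act C i a' := by
  refine ext_vec C fun v c => ext_inner_vec C fun w => ?_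
  rw [add_apply, fock_add_right, inner_vec_act, inner_vec_act, inner_vec_act, map_add, add_apply,
    ip_add_right, wordForm_add, mul_add, add_mul]

theorem act_smul (i : ι) (r : ℂ) (a : A i) : act C i (r • a) = r • act C i a := by
  refine ext_vec C fun v c => ext_inner_vec C fun w => ?_
  rw [smul_apply, fock_smul_right, inner_vec_act, inner_vec_act, map_smul, smul_apply,
    ip_smul_right, wordForm_smul, mul_smul_comm, smul_mul_assoc]

theorem inner_act_left (i : ι) (a : A i) (x y : FreeProd C) :
    (inner B (act C i a x) y : B) = inner B x (act C i (star a) y) := by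
  refine freeProd_induction C
    (p := fun x => (inner B (act C i a x) y : B) = inner B x (act C i (star a) y)) x
    (isClosed_eq ((continuous_inner_left B _ y).comp (act C i a).continuous)
      (continuous_inner_left B _ _)) ?_ (fun w b => ?_) fun x x' hx hx' => ?_
  · rw [map_zero, fock_zero_left, fock_zero_left]
  · refine freeProd_induction C (p := fun y => (inner B (act C i a (vec C w b)) y : B)
      = inner B (vec C w b) (act C i (star a) y)) y
      (isClosed_eq (continuous_inner_right B _ _)
        ((continuous_inner_right B _ _).comp (act C i (star a)).continuous)) ?_ (fun v c => ?_)
      fun y y' hy hy' => ?_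
    · rw [map_zero, fock_zero_right, fock_zero_right]
    · have h := inner_act_vec_act C i a 1 w v b c
      rw [act_one, map_one, one_apply_eq_self, one_apply_eq_self] at h
      rw [h, inner_vec_act, inner_rep_left]
    · rw [map_add, fock_add_right, fock_add_right, hy, hy']
  · rw [map_add, fock_add_left, fock_add_left, hx, hx']

theorem act_mul (i : ι) (a a' : A i) : act C i (a * a') = act C i a * act C i a' := by
  refine ext_vec C fun v c => ext_inner_vec C fun w => ?_
  have h : ∀ y, (inner B (vec C w 1) (act C i a y) : B)
      = inner B (act C i (star a) (vec C w 1)) y := fun y => by rw [inner_act_left, star_star]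
  rw [mul_apply_eq_comp, h, inner_act_vec_act, inner_vec_act, inner_rep_left, star_star, map_mul,
    mul_apply_eq_comp]

/-- The representation of `Aᵢ` by adjointable operators on the free product. -/
noncomputable def actHom (i : ι) : A i →⋆ₐ[ℂ] adjointable B (FreeProd C) where
  toFun a := ⟨act C i a, ⟨act C i (star a), inner_act_left C i a⟩⟩
  map_one' := Subtype.ext (act_one C i)
  map_mul' a a' := Subtype.ext (act_mul C i a a')
  map_zero' := Subtype.ext (by
    have := act_smul C i 0 0
    rwa [zero_smul, zero_smul] at this)
  map_add' a a' := Subtype.ext (act_add C i a a')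
  commutes' r := Subtype.ext (by
    change act C i (algebraMap ℂ (A i) r) = algebraMap ℂ _ r
    rw [Algebra.algebraMap_eq_smul_one, act_smul, act_one, Algebra.algebraMap_eq_smul_one])
  map_star' a := Eq.symm (star_eq_of_inner (B := B) (P := FreeProd C) (inner_act_left C i a))

theorem coe_actHom (i : ι) (a : A i) : (actHom C i a).1 = act C i a := rfl

theorem adjointable_op_smul (T : adjointable B (FreeProd C)) (b : B) (x : FreeProd C) :
    T.1 (MulOpposite.op b • x) = MulOpposite.op b • T.1 x := by
  refine ext_inner B fun z => ?_
  rw [fock_adjoint', fock_op_smul_right, fock_op_smul_right, fock_adjoint']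

/-- `⟨w, b v⟩` may be computed in `Hᵢ ⊗ Mᵢ` for every `i`. -/
theorem wordForm_split_left (i : ι) (w v : Word C) (b : B) :
    wordForm C w.1 v.1 b = wordForm C (split C i w).2.1.1 (split C i v).2.1.1
      (inner B (split C i w).1 ((C i).left b (split C i v).1)) := by
  have hl : ∀ h : (C i).Centered, (inner B h.1 ((C i).left b (C i).ξ) : B) = 0 := fun h => by
    rw [left_ξ, ip_op_smul_right, ← ip_star, h.2, star_zero, zero_mul]
  have hr : ∀ h : (C i).Centered, (inner B (C i).ξ ((C i).left b h.1) : B) = 0 :=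
    fun h => (C i).inner_ξ_left_of_centered b h.2
  rcases w with ⟨_ | ⟨x, u⟩, hw⟩ <;> rcases v with ⟨_ | ⟨y, v⟩, hv⟩
  · simp [split, wordForm, inner_ξ_left]
  · by_cases ey : y.1 = i
    · obtain ⟨j, k⟩ := y
      obtain rfl : j = i := ey
      simp [split, wordForm, hr, wordForm_zero]
    · simp [split, ey, wordForm]
  · by_cases ex : x.1 = i
    · obtain ⟨j, h⟩ := x
      obtain rfl : j = i := ex
      simp [split, wordForm, hl, wordForm_zero]
    · simp [split, ex, wordForm]
  · by_cases ex : x.1 = i <;> by_cases ey : y.1 = i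
    · obtain ⟨j, h⟩ := x
      obtain rfl : j = i := ex
      obtain ⟨j, k⟩ := y
      obtain rfl : j = _ := ey
      simp [split, wordForm, letterForm_same]
    · obtain ⟨j, h⟩ := x
      obtain rfl : j = i := ex
      simp [split, ey, wordForm, letterForm_ne C (x := ⟨j, h⟩) (y := y) ey, hl, wordForm_zero]
    · obtain ⟨j, k⟩ := y
      obtain rfl : j = i := ey
      simp [split, ex, wordForm, letterForm_ne C (x := x) (y := ⟨j, k⟩) (Ne.symm ex), hr,
        wordForm_zero]
    · simp [split, ex, ey, inner_ξ_left]

/-- The left action of `B` on the free product does not depend on the factor. -/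
theorem act_incl_eq (i k : ι) (b : B) : act C i ((S i).incl b) = act C k ((S k).incl b) := by
  refine ext_vec C fun v c => ext_inner_vec C fun w => ?_
  have h : ∀ i, (inner B (vec C w 1) (act C i ((S i).incl b) (vec C v c)) : B)
      = star 1 * wordForm C w.1 v.1 b * c := fun i => by
    rw [inner_vec_act, wordForm_split_left C i w v]
    rfl
  rw [h, h]

variable [∀ i, CompleteSpace (H i)]

theorem emb_apply (i : ι) (h : H i) : emb C i h = (preEmb C i h : FreeProd C) := rfl

theorem proj_vec (i : ι) (w : Word C) (b : B) :
    proj C i (vec C w b) = MulOpposite.op b • projWord C i w := by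
  rw [vec, proj_coe, preProj_single]

theorem inner_proj_left (i : ι) (x : FreeProd C) (h : H i) :
    (inner B (proj C i x) h : B) = inner B x (emb C i h) := by
  rw [← ip_star, ← inner_emb, fock_star]

theorem proj_emb (i : ι) (h : H i) : proj C i (emb C i h) = h := by
  refine ext_inner B fun k => ?_
  rw [← inner_emb, emb_apply, emb_apply, inner_coe_coe, preEmb, preEmb, inner_attach_attach]
  simp [nilWord, wordForm]

theorem act_emb (i : ι) (a : A i) (h : H i) :
    act C i a (emb C i h) = emb C i ((C i).rep a h) := by
  refine ext_inner_vec C fun w => ?_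
  have h1 : (inner B (vec C w 1) (act C i a (emb C i h)) : B)
      = inner B (act C i (star a) (vec C w 1)) (emb C i h) := by rw [inner_act_left, star_star]
  rw [h1, act_vec, MulOpposite.op_one, one_smul, emb_apply, emb_apply, vec, inner_coe_coe,
    inner_coe_coe, preEmb, preEmb, actWord, inner_attach_attach, inner_single_attach,
    inner_rep_left, star_star]

theorem proj_act (i : ι) (a : A i) (x : FreeProd C) :
    proj C i (act C i a x) = (C i).rep a (proj C i x) := by
  refine ext_inner B fun h => ?_
  have h1 : (inner B h ((C i).rep a (proj C i x)) : B)
      = inner B ((C i).rep (star a) h) (proj C i x) := by rw [inner_rep_left, star_star]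
  have h2 : (inner B (emb C i h) (act C i a x) : B)
      = inner B (act C i (star a) (emb C i h)) x := by rw [inner_act_left, star_star]
  rw [h1, ← inner_emb, ← inner_emb, h2, act_emb]

/-- The projection of the free product onto the image of `Hᵢ`. -/
noncomputable def embProj (i : ι) : adjointable B (FreeProd C) :=
  ⟨(emb C i).comp (proj C i), (emb C i).comp (proj C i), fun x y => by
    rw [ContinuousLinearMap.comp_apply, ContinuousLinearMap.comp_apply, inner_emb,
      inner_proj_left]⟩

theorem embProj_apply (i : ι) (x : FreeProd C) : (embProj C i).1 x = emb C i (proj C i x) := rfl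

theorem isSelfAdjoint_embProj (i : ι) : IsSelfAdjoint (embProj C i) :=
  star_eq_of_inner fun x y => by
    rw [embProj_apply, embProj_apply, inner_emb, inner_proj_left]

/-- The copy of Hᵢ is the summand Hᵢ ⊗ B of Hᵢ ⊗ Mᵢ, which reduces a ⊗ id. -/
theorem commute_actHom_embProj (i : ι) (a : A i) : Commute (actHom C i a) (embProj C i) := by
  refine Subtype.ext (ContinuousLinearMap.ext fun x => ?_)
  change act C i a (emb C i (proj C i x)) = emb C i (proj C i (act C i a x))
  rw [act_emb, proj_act]

end FreeProductOperators

/-! ### Compressions of operators that act on the left tensor factors -/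

section Compression

set_option linter.unusedSectionVars false

variable {B : Type*} [CStarAlgebra B] [PartialOrder B] [StarOrderedRing B]
  {ι : Type*} [DecidableEq ι] {A H : ι → Type*} [∀ i, CStarAlgebra (A i)]
  [∀ i, NormedAddCommGroup (H i)] [∀ i, NormedSpace ℂ (H i)] [∀ i, Module Bᵐᵒᵖ (H i)]
  [∀ i, RightHilbertModule B (H i)] {S : ∀ i, ValuedProbSpace B (A i)}
  (C : ∀ i, PointedCorrespondence (S i) (H i))

theorem actWord_nil (m : ι) (a : A m) (hw) :
    actWord C m a ⟨[], hw⟩ = attach C m ((C m).rep a (C m).ξ) ⟨⟨[], hw⟩, by simp⟩ := rfl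

theorem actWord_cons_of_eq (m : ι) (a : A m) (g : (C m).Centered) (u : List (Letter C)) (hw) :
    actWord C m a ⟨⟨m, g⟩ :: u, hw⟩ = attach C m ((C m).rep a g.1)
      ⟨⟨u, (List.isChain_cons.1 hw).2⟩, fun y hy => ((List.isChain_cons.1 hw).1 y hy).symm⟩ := by
  simp [actWord, split]

theorem actWord_cons_of_ne (m : ι) (a : A m) (x : Letter C) (u : List (Letter C)) (hw)
    (hx : x.1 ≠ m) : actWord C m a ⟨x :: u, hw⟩ = attach C m ((C m).rep a (C m).ξ)
      ⟨⟨x :: u, hw⟩, by simpa using hx⟩ := by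
  simp [actWord, split, hx]

/-- The pairs `(w b, w ⊗ b h)` for words `w` and `b ∈ B`. -/
def appendPairs (i : ι) (h : (C i).Centered) : Set (FreeProd C × FreeProd C) :=
  {p | ∃ (u : List (Letter C)) (b : B) (hu : u.IsChain fun x y => x.1 ≠ y.1)
    (hu' : (u ++ [(⟨i, (C i).leftCentered b h⟩ : Letter C)]).IsChain fun x y => x.1 ≠ y.1),
    p = (vec C ⟨u, hu⟩ b, vec C ⟨u ++ [⟨i, (C i).leftCentered b h⟩], hu'⟩ 1)}

/-- The additive relation `(x, x ⊗ h)` on the free product. -/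
noncomputable def appendRel (i : ι) (h : (C i).Centered) : AddSubgroup (FreeProd C × FreeProd C) :=
  AddSubgroup.closure (appendPairs C i h)

theorem op_smul_coe_single (w : Word C) (b c : B) :
    MulOpposite.op b • ((single C w c : PreFock C) : FreeProd C) = vec C w (c * b) := by
  rw [← Completion.coe_smul, op_smul_single, vec]

/-- Attaching on the left commutes with appending on the right, one summand of `attach` at a time.
For the empty word the left coefficient c passes into the appended letter, by c(bh) = (cb)h. Working
with an additive relation instead of an operator x ↦ x ⊗ h avoids any question of its domain or
boundedness. -/
theorem attach_mem_appendRel {i : ι} {h : (C i).Centered} {m : ι} (k : H m) (u : List (Letter C))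
    (b : B) (hu : u.IsChain fun x y => x.1 ≠ y.1)
    (hu' : (u ++ [(⟨i, (C i).leftCentered b h⟩ : Letter C)]).IsChain fun x y => x.1 ≠ y.1)
    (hn : ∀ x ∈ u.head?, x.1 ≠ m)
    (hn' : ∀ x ∈ (u ++ [(⟨i, (C i).leftCentered b h⟩ : Letter C)]).head?, x.1 ≠ m) :
    (MulOpposite.op b • (attach C m k ⟨⟨u, hu⟩, hn⟩ : FreeProd C),
      (attach C m k ⟨⟨_, hu'⟩, hn'⟩ : FreeProd C)) ∈ appendRel C i h := by
  rw [attach, attach, Completion.coe_add, Completion.coe_add, smul_add, ← Prod.mk_add_mk]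
  refine add_mem ?_ (AddSubgroup.subset_closure ⟨⟨m, (C m).center k⟩ :: u, b, ?_, ?_, ?_⟩)
  · set c : B := inner B (C m).ξ k
    rcases u with _ | ⟨y, t⟩
    · refine AddSubgroup.subset_closure ⟨[], c * b, hu, ?_, ?_⟩
      · exact List.isChain_singleton _
      · refine Prod.ext (op_smul_coe_single C _ _ _) ?_
        have e : (C i).leftCentered (c * b) h = (C i).leftCentered c ((C i).leftCentered b h) :=
          Subtype.ext ((C i).left_mul c b h.1)
        simp only [e]
        rfl
    · refine AddSubgroup.subset_closure ⟨⟨y.1, (C y.1).leftCentered c y.2⟩ :: t, b,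
        List.isChain_cons.2 (List.isChain_cons.1 hu), List.isChain_cons.2 (List.isChain_cons.1 hu'),
        Prod.ext ?_ rfl⟩
      refine (op_smul_coe_single C _ _ _).trans ?_
      rw [one_mul]
  · exact (consWord C m ((C m).center k) ⟨⟨u, hu⟩, hn⟩).2
  · exact (consWord C m ((C m).center k) ⟨⟨_, hu'⟩, hn'⟩).2
  · refine Prod.ext ?_ rfl
    refine (op_smul_coe_single C _ _ _).trans ?_
    rw [one_mul]
    rfl

/-- The operators that preserve all the relations `(x, x ⊗ h)`. -/
def PreservesAppend (i : ι) (T : FreeProd C →L[ℂ] FreeProd C) : Prop :=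
  ∀ h : (C i).Centered, ∀ p ∈ appendRel C i h, (T p.1, T p.2) ∈ appendRel C i h

variable {C}

theorem preservesAppend_of_pairs {i : ι} {T : FreeProd C →L[ℂ] FreeProd C}
    (hT : ∀ h : (C i).Centered, ∀ p ∈ appendPairs C i h, (T p.1, T p.2) ∈ appendRel C i h) :
    PreservesAppend C i T := by
  intro h p hp
  induction hp using AddSubgroup.closure_induction with
  | mem p hp => exact hT h p hp
  | zero =>
    rw [Prod.fst_zero, Prod.snd_zero, map_zero]
    exact zero_mem _
  | add p q _ _ hp hq =>
    rw [Prod.fst_add, Prod.snd_add, map_add, map_add, ← Prod.mk_add_mk]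
    exact add_mem hp hq
  | neg p _ hp =>
    rw [Prod.fst_neg, Prod.snd_neg, map_neg, map_neg, ← Prod.neg_mk]
    exact neg_mem hp

/-- An operator from Aₖ changes at most a first letter from H°ₖ. The appended letter comes from H°ᵢ
with i ≠ k, so even when it is the whole word b h it only plays the role of the factor in Mₖ. -/
theorem preservesAppend_act {i k : ι} (hk : k ≠ i) (a : A k) :
    PreservesAppend C i (act C k a) := by
  refine preservesAppend_of_pairs fun h p hp => ?_
  obtain ⟨u, b, hu, hu', rfl⟩ := hp
  change (act C k a (vec C ⟨u, hu⟩ b), act C k a (vec C ⟨_, hu'⟩ 1)) ∈ appendRel C i h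
  rw [act_vec, act_vec, MulOpposite.op_one, one_smul]
  rcases u with _ | ⟨x, t⟩
  · rw [actWord_nil]
    have e := actWord_cons_of_ne C k a ⟨i, (C i).leftCentered b h⟩ [] hu' hk.symm
    simp only [List.nil_append]
    rw [e]
    exact attach_mem_appendRel C _ [] b hu hu' _ _
  · by_cases hx : x.1 = k
    · obtain ⟨m, g⟩ := x
      obtain rfl : m = k := hx
      have e := actWord_cons_of_eq C m a g (t ++ [(⟨i, (C i).leftCentered b h⟩ : Letter C)]) hu'
      simp only [List.cons_append]
      rw [e, actWord_cons_of_eq]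
      exact attach_mem_appendRel C _ t b _ _ _ _
    · have e := actWord_cons_of_ne C k a x (t ++ [(⟨i, (C i).leftCentered b h⟩ : Letter C)]) hu' hx
      simp only [List.cons_append]
      rw [e, actWord_cons_of_ne C k a x t hu hx]
      exact attach_mem_appendRel C _ (x :: t) b hu hu' _ _

/-! ### Compressions to one factor of operators that respect appending -/

variable [∀ i, CompleteSpace (H i)]

theorem vec_eq_emb {i : ι} {w : Word C} (hw : (split C i w).2.1.1 = []) :
    vec C w 1 = emb C i (split C i w).1 := by
  refine ext_inner_vec C fun v => ?_
  rw [inner_vec_vec, emb_apply, preEmb, vec, inner_coe_coe, inner_single_attach,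
    wordForm_split C i, hw, star_one, one_mul, mul_one]
  rfl

theorem emb_op_smul (i : ι) (b : B) (h : H i) :
    emb C i (MulOpposite.op b • h) = MulOpposite.op b • emb C i h := by
  refine ext_inner B fun z => ?_
  rw [fock_op_smul_right, ← inner_proj_left, ← inner_proj_left, ip_op_smul_right]

theorem proj_op_smul (i : ι) (b : B) (x : FreeProd C) :
    proj C i (MulOpposite.op b • x) = MulOpposite.op b • proj C i x := by
  refine ext_inner B fun z => ?_
  rw [ip_op_smul_right, ← inner_emb, ← inner_emb, fock_op_smul_right]

theorem embProj_vec_of_eq_nil {i : ι} {w : Word C} (hw : (split C i w).2.1.1 = []) (b : B) :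
    (embProj C i).1 (vec C w b) = vec C w b := by
  rw [vec_eq, vec_eq_emb hw, ← emb_op_smul, embProj_apply, proj_emb]

theorem proj_vec_of_ne_nil {i : ι} {w : Word C} (hw : (split C i w).2.1.1 ≠ []) (b : B) :
    proj C i (vec C w b) = 0 := by
  rw [proj_vec, projWord]
  split
  · contradiction
  · rw [smul_zero]

theorem split_snd_ne_nil {i : ι} {x : Letter C} {u : List (Letter C)} {hw}
    (h : x.1 ≠ i ∨ u ≠ []) : (split C i ⟨x :: u, hw⟩).2.1.1 ≠ [] := by
  by_cases hx : x.1 = i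
  · simpa [split, hx] using h
  · simp [split, hx]

/-- Reducedness forbids a word consisting of a single letter from H°ᵢ in front of another such
letter. -/
theorem head_ne_of_append {i : ι} {g : (C i).Centered} {x : Letter C} {u : List (Letter C)}
    (hu : (x :: u ++ [(⟨i, g⟩ : Letter C)]).IsChain fun x y => x.1 ≠ y.1) :
    x.1 ≠ i ∨ u ≠ [] := by
  rcases u with _ | ⟨y, t⟩
  · left
    simpa using hu
  · right
    simp

/-- The empty word is the only one for which a acts on the appended letter itself; there both ξ b
and b h lie in the copy of Hᵢ and are killed by 1 − P. For every other admissible word P vanishes on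
both members of the pair, and a acts at the left end only. -/
theorem preservesAppend_act_compl {i : ι} (a : A i) :
    PreservesAppend C i (act C i a * (1 - embProj C i).1) := by
  refine preservesAppend_of_pairs fun h p hp => ?_
  obtain ⟨u, b, hu, hu', rfl⟩ := hp
  change (act C i a (vec C ⟨u, hu⟩ b - (embProj C i).1 (vec C ⟨u, hu⟩ b)),
    act C i a (vec C ⟨_, hu'⟩ 1 - (embProj C i).1 (vec C ⟨_, hu'⟩ 1))) ∈ appendRel C i h
  rcases u with _ | ⟨x, t⟩
  · rw [embProj_vec_of_eq_nil (by simp [split]), embProj_vec_of_eq_nil (by simp [split]), sub_self,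
      sub_self, map_zero]
    exact zero_mem _
  · have hx := head_ne_of_append hu'
    have hx' : x.1 ≠ i ∨ t ++ [(⟨i, (C i).leftCentered b h⟩ : Letter C)] ≠ [] := by simp
    have e1 := proj_vec_of_ne_nil (split_snd_ne_nil (hw := hu) hx) b
    have e2 : proj C i (vec C ⟨x :: (t ++ [(⟨i, (C i).leftCentered b h⟩ : Letter C)]), hu'⟩ 1) = 0 :=
      proj_vec_of_ne_nil (split_snd_ne_nil hx') 1
    simp only [List.cons_append]
    rw [embProj_apply, embProj_apply, e1, e2, map_zero, sub_zero, sub_zero, act_vec, act_vec,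
      MulOpposite.op_one, one_smul]
    by_cases hxi : x.1 = i
    · obtain ⟨m, g⟩ := x
      obtain rfl : m = i := hxi
      have e := actWord_cons_of_eq C m a g (t ++ [(⟨m, (C m).leftCentered b h⟩ : Letter C)]) hu'
      rw [e, actWord_cons_of_eq]
      exact attach_mem_appendRel C _ t b _ _ _ _
    · have e := actWord_cons_of_ne C i a x (t ++ [(⟨i, (C i).leftCentered b h⟩ : Letter C)]) hu' hxi
      rw [e, actWord_cons_of_ne C i a x t hu hxi]
      exact attach_mem_appendRel C _ (x :: t) b hu hu' _ _

theorem vacuum_eq : vacuum C = vec C (nilWord C) 1 := rfl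

theorem emb_eq (i : ι) (h : H i) : emb C i h = MulOpposite.op (inner B (C i).ξ h : B) • vacuum C
    + vec C ⟨[⟨i, (C i).center h⟩], List.isChain_singleton _⟩ 1 := by
  rw [emb_apply, preEmb, attach, Completion.coe_add, vacuum, op_smul_coe_single, one_mul]
  rfl

/-- Only generators from the empty word survive the projection: (ξ b, b h) becomes (b ξᵢ, b h), with
b = ⟨ξ, ξ b⟩. The other generators project to zero and have first member orthogonal to ξ. -/
theorem proj_of_mem_appendRel {i : ι} {h : (C i).Centered} {p : FreeProd C × FreeProd C}
    (hp : p ∈ appendRel C i h) :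
    proj C i p.1 = (C i).left (inner B (vacuum C) p.1) (C i).ξ ∧
      proj C i p.2 = (C i).left (inner B (vacuum C) p.1) h.1 := by
  induction hp using AddSubgroup.closure_induction with
  | mem p hp =>
    obtain ⟨u, b, hu, hu', rfl⟩ := hp
    simp only [vacuum_eq, inner_vec_vec]
    rcases u with _ | ⟨x, t⟩
    · rw [proj_vec, proj_vec, left_ξ]
      simp [nilWord, wordForm, projWord, split, leftCentered]
    · have hx := head_ne_of_append hu'
      have hx' : x.1 ≠ i ∨ t ++ [(⟨i, (C i).leftCentered b h⟩ : Letter C)] ≠ [] := by simp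
      have e1 := proj_vec_of_ne_nil (split_snd_ne_nil (hw := hu) hx) b
      have e2 : proj C i (vec C ⟨x :: (t ++ [(⟨i, (C i).leftCentered b h⟩ : Letter C)]), hu'⟩ 1) = 0 :=
        proj_vec_of_ne_nil (split_snd_ne_nil hx') 1
      simp only [List.cons_append]
      rw [e1, e2]
      simp [nilWord, wordForm, left_zero]
  | zero => simp [fock_zero_right, left_zero]
  | add p q _ _ hp hq =>
    simp only [Prod.fst_add, Prod.snd_add, map_add, fock_add_right, left_add, hp.1, hp.2, hq.1,
      hq.2, and_self]
  | neg p _ hp =>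
    have e : (inner B (vacuum C) (-p).1 : B) = -inner B (vacuum C) p.1 := by
      have := fock_add_right (vacuum C) p.1 (-p).1
      rw [Prod.fst_neg, add_neg_cancel, fock_zero_right] at this
      exact (neg_eq_of_add_eq_zero_right this.symm).symm
    have e' : ∀ (b : B) (x : H i), (C i).left (-b) x = -(C i).left b x := fun b x => by
      simp [left]
    rw [e, e', e', Prod.fst_neg, Prod.snd_neg, map_neg, map_neg, hp.1, hp.2]
    exact ⟨rfl, rfl⟩

/-- If `T` preserves the relations `(x, x ⊗ h)`, then its compression to `Hᵢ` is the left
multiplication by `⟨ξ, T ξ⟩`. -/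
theorem proj_emb_of_preservesAppend {i : ι} {T : adjointable B (FreeProd C)}
    (hT : PreservesAppend C i T.1) (h : H i) :
    proj C i (T.1 (emb C i h)) = (C i).left (inner B (vacuum C) (T.1 (vacuum C))) h := by
  -- Decompose h = ξᵢ⟨ξᵢ, h⟩ + h°. The pair (ξ, h°) is in the relation, and its image under T
  -- determines the compression on both summands.
  have hmem : (vacuum C, vec C ⟨[⟨i, (C i).center h⟩], List.isChain_singleton _⟩ 1)
      ∈ appendRel C i ((C i).center h) := by
    have e : (C i).leftCentered 1 ((C i).center h) = (C i).center h :=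
      Subtype.ext ((C i).left_one _)
    refine AddSubgroup.subset_closure ⟨[], 1, List.isChain_nil, List.isChain_singleton _, ?_⟩
    simp only [e]
    rfl
  obtain ⟨h1, h2⟩ := proj_of_mem_appendRel (hT _ _ hmem)
  set c : B := inner B (vacuum C) (T.1 (vacuum C))
  rw [emb_eq, map_add, adjointable_op_smul, map_add, proj_op_smul, h1, h2, ← left_op_smul,
    ← map_add, center]
  exact congrArg _ (add_sub_cancel _ _)

/-- The subalgebra of operators that preserve the relations `(x, x ⊗ h)`. -/
def preserving (C : ∀ i, PointedCorrespondence (S i) (H i)) {i k : ι} (hk : k ≠ i) :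
    Subalgebra ℂ (adjointable B (FreeProd C)) where
  carrier := {T | PreservesAppend C i T.1}
  mul_mem' {T T'} hT hT' h p hp := hT h _ (hT' h p hp)
  add_mem' {T T'} hT hT' h p hp := by
    have := add_mem (hT h p hp) (hT' h p hp)
    rwa [Prod.mk_add_mk] at this
  -- The relation is only additive, so scalars are treated as elements of Aₖ, which respect it.
  algebraMap_mem' r := by
    have := preservesAppend_act hk (algebraMap ℂ (A k) r) (C := C)
    have e : actHom C k (algebraMap ℂ (A k) r) = algebraMap ℂ _ r := AlgHomClass.commutes _ r
    rw [← coe_actHom, e] at this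
    exact this

theorem continuous_coe_adjointable {P : Type*} [NormedAddCommGroup P] [NormedSpace ℂ P]
    [Module Bᵐᵒᵖ P] [RightHilbertModule B P] (x : P) :
    Continuous fun T : adjointable B P => T.1 x :=
  (ContinuousLinearMap.apply ℂ P x).continuous.comp continuous_subtype_val

/-- The left action on Hᵢ is the compression of a star-homomorphism from B into the adjointable
operators on the free product, and such homomorphisms are contractive. -/
theorem continuous_left (i : ι) (h : H i) : Continuous fun b : B => (C i).left b h := by
  have hle : ∀ b : B, ‖(C i).left b h‖ ≤ ‖b‖ * ‖h‖ := fun b => by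
    have h1 : (C i).left b h = proj C i (act C i ((S i).incl b) (emb C i h)) := by
      rw [proj_act, proj_emb]; rfl
    have hp : ∀ x : FreeProd C, ‖proj C i x‖ ≤ ‖x‖ := fun x => by
      have h2 : ‖proj C i x‖ ^ 2 ≤ ‖x‖ * ‖proj C i x‖ := by
        rw [RightHilbertModule.norm_sq (B := B), inner_proj_left]
        refine (norm_inner_le B _ _ _).trans (le_of_eq ?_)
        rw [emb_apply, Completion.norm_coe, norm_preEmb]
      rcases (norm_nonneg (proj C i x)).eq_or_lt with h | h
      · rw [← h]; exact norm_nonneg _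
      · exact le_of_mul_le_mul_right (by rwa [pow_two] at h2) h
    let f : B →⋆ₐ[ℂ] adjointable B (FreeProd C) := (actHom C i).comp (S i).incl
    have hf : ‖(f b).1‖ ≤ ‖b‖ := norm_starHom_le f b
    rw [h1]
    refine (hp _).trans (((f b).1.le_opNorm _).trans ?_)
    rw [emb_apply, Completion.norm_coe, norm_preEmb]
    exact mul_le_mul_of_nonneg_right hf (norm_nonneg _)
  let g : B →ₗ[ℂ] H i :=
    { toFun := fun b => (C i).left b h
      map_add' := fun b c => (C i).left_add b c h
      map_smul' := fun r b => by simp [left] }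
  exact (g.mkContinuous ‖h‖ fun b => (hle b).trans_eq (mul_comm _ _)).continuous

/-- Resolvents are only limits of operators that respect the relations. Both sides of the identity
are continuous in T, so nothing about closedness of the relations is needed. -/
theorem proj_emb_of_mem_closure {i k : ι} (hk : k ≠ i) {T : adjointable B (FreeProd C)}
    (hT : T ∈ (preserving C hk).topologicalClosure) (h : H i) :
    proj C i (T.1 (emb C i h)) = (C i).left (inner B (vacuum C) (T.1 (vacuum C))) h := by
  have hcl : IsClosed {T : adjointable B (FreeProd C) | proj C i (T.1 (emb C i h))
      = (C i).left (inner B (vacuum C) (T.1 (vacuum C))) h} := by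
    refine isClosed_eq ((proj C i).continuous.comp (continuous_coe_adjointable _)) ?_
    exact (continuous_left i h).comp ((continuous_inner_right B _ (vacuum C)).comp
      (continuous_coe_adjointable _))
  exact closure_minimal (fun T hT => proj_emb_of_preservesAppend hT h) hcl hT

end Compression

/-! ### The resolvent identity -/

theorem mapRingHom_amp {R R' : Type*} [Ring R] [Ring R'] {n : ℕ} (f : R →+* R') (x : R) :
    mapRingHom n f (amp n x) = amp n (f x) := map_amp n x f (map_zero f)

theorem amp_sub {R : Type*} [Ring R] {n : ℕ} (x y : R) : amp n (x - y) = amp n x - amp n y := by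
  ext i j
  rw [CStarMatrix.sub_apply, amp_apply, amp_apply, amp_apply]
  split_ifs <;> simp

/-- The resolvent identity, multiplied from both sides. -/
theorem sandwich_inverse {R : Type*} [Ring R] {w w' v v' x : R} (hw : IsUnit w) (hw' : IsUnit w')
    (h : w' - w = v' * x * v) : v * Ring.inverse w * v' = v * Ring.inverse w' * v'
      + v * Ring.inverse w' * v' * x * (v * Ring.inverse w * v') := by
  have e : Ring.inverse w = Ring.inverse w' + Ring.inverse w' * (v' * x * v) * Ring.inverse w := by
    rw [← h, mul_sub, sub_mul, Ring.inverse_mul_cancel _ hw', mul_assoc _ w,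
      Ring.mul_inverse_cancel _ hw, one_mul, mul_one]
    abel
  conv_lhs => rw [e]
  noncomm_ring

/-! ### Vector states -/

section VectorState

variable {B P : Type*} [CStarAlgebra B] [PartialOrder B] [StarOrderedRing B]
  [NormedAddCommGroup P] [NormedSpace ℂ P] [Module Bᵐᵒᵖ P] [RightHilbertModule B P]

variable (B) in
/-- The map `T ↦ ⟨x, T x⟩`. -/
noncomputable def vectorState (x : P) : adjointable B P →ₗ[ℂ] B where
  toFun T := inner B x (T.1 x)
  map_add' T T' := ip_add_right x (T.1 x) (T'.1 x)
  map_smul' r T := ip_smul_right x r (T.1 x)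

theorem vectorState_apply (x : P) (T : adjointable B P) :
    vectorState B x T = inner B x (T.1 x) := rfl

/-- The image of M⋆M has the Gram entries ∑ ⟨Mₘₖ x, Mₘₗ x⟩, so its quadratic form is a sum of terms
⟨y, y⟩. -/
theorem isUCP_vectorState [CompleteSpace P] {x : P} (hx : (inner B x x : B) = 1) :
    IsUCP (vectorState B x) where
  map_one := hx
  map_star T := by
    rw [vectorState_apply, vectorState_apply, ip_star, inner_adjointable]
  nonneg n M := by
    have e : ∀ k l, vectorState B x ((star M * M) k l)
        = ∑ m, inner B ((M m k).1 x) ((M m l).1 x) := fun k l => by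
      rw [CStarMatrix.mul_apply, map_sum]
      refine Finset.sum_congr rfl fun m _ => ?_
      rw [inner_adjointable]
      rfl
    have h := nonneg_of_quadForm (fun k l => vectorState B x ((star M * M) k l))
      (fun k l => by simp only [e, star_sum, ip_star]) fun β => by
        simp only [e]
        rw [sum_gram_inner fun m k => (M m k).1 x]
        exact Finset.sum_nonneg fun m _ => ip_self_nonneg _
    exact h

end VectorState

/-! ### Matrices with entries in a closed subalgebra -/

section Entries

variable {D : Type*} [CStarAlgebra D]

/-- The matrices with entries in a subalgebra. -/
def matSubalgebra (n : ℕ) (K : Subalgebra ℂ D) : Subalgebra ℂ (Mat n D) where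
  carrier := {M | ∀ i j, M i j ∈ K}
  mul_mem' {M N} hM hN i j := by
    rw [CStarMatrix.mul_apply]
    exact sum_mem fun k _ => mul_mem (hM i k) (hN k j)
  add_mem' {M N} hM hN i j := add_mem (hM i j) (hN i j)
  algebraMap_mem' r i j := by
    have : (algebraMap ℂ (Mat n D) r) i j = r • (1 : Mat n D) i j := by
      rw [Algebra.algebraMap_eq_smul_one]; rfl
    rw [this, CStarMatrix.one_apply]
    split_ifs
    exacts [K.smul_mem (one_mem K) r, K.smul_mem (zero_mem K) r]

theorem isClosed_matSubalgebra [PartialOrder D] [StarOrderedRing D] (n : ℕ) {K : Subalgebra ℂ D}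
    (hK : IsClosed (K : Set D)) : IsClosed (matSubalgebra n K : Set (Mat n D)) := by
  have : (matSubalgebra n K : Set (Mat n D)) = ⋂ i, ⋂ j, (fun M : Mat n D => M i j) ⁻¹' K := by
    ext M
    simp only [Set.mem_iInter]
    rfl
  rw [this]
  exact isClosed_iInter fun i => isClosed_iInter fun j => hK.preimage (continuous_entry i j)

theorem amp_mem_matSubalgebra (n : ℕ) {K : Subalgebra ℂ D} {x : D} (hx : x ∈ K) :
    amp n x ∈ matSubalgebra n K := fun i j => by
  rw [amp_apply]
  split_ifs
  exacts [hx, zero_mem K]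

/-- The inverse is a norm limit of polynomials in z − x, so it stays in the closed subalgebra; K
need not be stable under adjoints. -/
theorem matResolvent_mem {B : Type*} [CStarAlgebra B] [PartialOrder B] [StarOrderedRing B]
    [PartialOrder D] [StarOrderedRing D] (j : B →⋆ₐ[ℂ] D) {x : D} (hx : IsSelfAdjoint x) {n : ℕ}
    (z : upperHalf B n) {K : Subalgebra ℂ D} (hK : IsClosed (K : Set D)) (hj : ∀ b, j b ∈ K)
    (hxK : x ∈ K) (i k : Fin n) : matResolvent j x z.1 i k ∈ K := by
  obtain ⟨ε, hε, hz⟩ := z.2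
  obtain ⟨v, h1, h2, h3⟩ := exists_inverse_of_le_im hε (smul_one_le_im_sub_amp j hx hz)
  rw [matResolvent, ringInverse_eq h1 h2]
  exact h3 (matSubalgebra n K) (isClosed_matSubalgebra n hK)
    (sub_mem (fun i k => hj _) (amp_mem_matSubalgebra n hxK)) i k

/-- The resolvent identity, entrywise. -/
theorem sandwich_matResolvent {B : Type*} [CStarAlgebra B] [PartialOrder B] [StarOrderedRing B]
    [PartialOrder D] [StarOrderedRing D] (j : B →⋆ₐ[ℂ] D) {x x' : D} (hx : IsSelfAdjoint x)
    (hx' : IsSelfAdjoint x') {v v' a : D} (h : x - x' = v' * a * v) {n : ℕ} (z : upperHalf B n)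
    (i k : Fin n) : v * matResolvent j x z.1 i k * v' = v * matResolvent j x' z.1 i k * v'
      + ∑ l, v * matResolvent j x' z.1 i l * v' * a * (v * matResolvent j x z.1 l k * v') := by
  have h' : (z.1.map j - amp n x') - (z.1.map j - amp n x) = amp n v' * amp n a * amp n v := by
    rw [amp_mul_amp, amp_mul_amp, ← h, sub_sub_sub_cancel_left, amp_sub]
  have := congrArg (fun M : Mat n D => M i k)
    (sandwich_inverse (isUnit_sub_amp j hx z) (isUnit_sub_amp j hx' z) h')
  have e := CStarMatrix.mul_apply (M := amp n v * matResolvent j x' z.1 * amp n v' * amp n a)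
    (N := amp n v * matResolvent j x z.1 * amp n v') (i := i) (k := k)
  simp only [mul_amp_apply, amp_mul_apply] at e
  rw [← e, ← amp_mul_apply, ← mul_amp_apply, ← amp_mul_apply, ← mul_amp_apply]
  exact this

/-- Transfers an inverse between two algebras mapped into a common third one. It carries the
resolvent from the adjointable operators, where C⋆-arguments apply, to the free product algebra. -/
theorem mul_eq_one_of_map_eq {R R' R'' : Type*} [Ring R] [Ring R'] [Ring R''] {f : R →+* R''}
    (hf : Function.Injective f) (g : R' →+* R'') {n : ℕ} {M N : Mat n R} {M' N' : Mat n R'}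
    (hM : M.map f = M'.map g) (hN : N.map f = N'.map g) (h : M' * N' = 1) : M * N = 1 := by
  have h1 : mapRingHom n f (M * N) = mapRingHom n f 1 := by
    rw [map_mul, mapRingHom_apply, mapRingHom_apply, hM, hN, ← mapRingHom_apply,
      ← mapRingHom_apply, ← map_mul, h, map_one, map_one]
  ext1 i k
  exact hf (congrFun (congrFun h1 i) k)

end Entries

/-! ### The subordination function -/

section Main

set_option linter.unusedSectionVars false

variable {B : Type*} [CStarAlgebra B] [PartialOrder B] [StarOrderedRing B]
  {A H : Fin 2 → Type*} [∀ i, CStarAlgebra (A i)]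
  [∀ i, NormedAddCommGroup (H i)] [∀ i, NormedSpace ℂ (H i)] [∀ i, CompleteSpace (H i)]
  [∀ i, Module Bᵐᵒᵖ (H i)] [∀ i, RightHilbertModule B (H i)] {S : ∀ i, ValuedProbSpace B (A i)}
  (C : ∀ i, PointedCorrespondence (S i) (H i))

theorem vacuum_eq_emb (i : Fin 2) : vacuum C = emb C i (C i).ξ :=
  vec_eq_emb (w := nilWord C) (by simp [split, nilWord])

/-- The action of `B` on the free product. -/
noncomputable def baseHom : B →⋆ₐ[ℂ] adjointable B (FreeProd C) := (actHom C 0).comp (S 0).incl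

variable (X : A 0) (V : A 1)

/-- The operator `V⋆ X V`. -/
noncomputable def sandwich : adjointable B (FreeProd C) :=
  star (actHom C 1 V) * actHom C 0 X * actHom C 1 V

/-- The operator `V⋆ X (1 - P) V`, where `P` is the projection onto `H₁`. -/
noncomputable def truncated : adjointable B (FreeProd C) :=
  star (actHom C 1 V) * (actHom C 0 X * (1 - embProj C 0)) * actHom C 1 V

/-- The vector `V⋆ ξ`. -/
noncomputable def compressedVector : FreeProd C := (star (actHom C 1 V)).1 (vacuum C)

variable {X} in
theorem isSelfAdjoint_sandwich (hX : IsSelfAdjoint X) : IsSelfAdjoint (sandwich C X V) :=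
  (hX.map (actHom C 0)).conjugate' _

variable {X} in
-- X and 1 − P are commuting self-adjoint operators, so their product is self-adjoint, and
-- conjugation by V keeps it so.
theorem isSelfAdjoint_truncated (hX : IsSelfAdjoint X) : IsSelfAdjoint (truncated C X V) := by
  refine IsSelfAdjoint.conjugate' ?_ _
  exact ((hX.map (actHom C 0)).commute_iff ((IsSelfAdjoint.one _).sub
    (isSelfAdjoint_embProj C 0))).1 ((Commute.one_right _).sub_right (commute_actHom_embProj C 0 X))

/-- The perturbation passes through P = J J⋆, which closes up the resolvent identity after
compression to H₁. -/
theorem sandwich_sub_truncated : sandwich C X V - truncated C X V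
    = star (actHom C 1 V) * (actHom C 0 X * embProj C 0) * actHom C 1 V := by
  rw [sandwich, truncated]
  noncomm_ring

variable {V} in
-- The inner product is ⟨ξ, VV⋆ξ⟩, computed inside the second factor. It makes the vector state of
-- V⋆ξ unital.
theorem inner_compressedVector (hV : (S 1).expect (V * star V) = 1) :
    (inner B (compressedVector C V) (compressedVector C V) : B) = 1 := by
  rw [compressedVector, fock_adjoint, star_star]
  change (inner B (vacuum C) ((actHom C 1 V * star (actHom C 1 V)).1 (vacuum C)) : B) = 1
  rw [← map_star, ← map_mul, coe_actHom, vacuum_eq_emb C 1, act_emb, inner_emb, proj_emb,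
    inner_rep_ξ, hV]

theorem vectorState_compressedVector (T : adjointable B (FreeProd C)) :
    vectorState B (compressedVector C V) T
      = inner B (vacuum C) ((actHom C 1 V * T * star (actHom C 1 V)).1 (vacuum C)) := by
  rw [vectorState_apply, compressedVector]
  exact (fock_adjoint _ _ _).trans (by rw [star_star]; rfl)

variable {X V}

/-- The compression of `V (z - V⋆ X (1 - P) V)⁻¹ V⋆` to `H₁` is a matrix over `B`. -/
theorem proj_truncated_resolvent (hX : IsSelfAdjoint X) {n : ℕ} (z : upperHalf B n) (i k : Fin n)
    (h : H 0) :
    proj C 0 ((actHom C 1 V * matResolvent (baseHom C) (truncated C X V) z.1 i k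
        * star (actHom C 1 V)).1 (emb C 0 h))
      = (C 0).left (cauchyTransform (baseHom C) (vectorState B (compressedVector C V))
          (truncated C X V) z.1 i k) h := by
  have hk : (1 : Fin 2) ≠ 0 := one_ne_zero
  set K := (preserving C hk).topologicalClosure
  have hle : preserving C hk ≤ K := Subalgebra.le_topologicalClosure _
  have h1 : ∀ a, actHom C 1 a ∈ K := fun a => hle (preservesAppend_act hk a)
  have h1' : star (actHom C 1 V) ∈ K := by
    rw [← map_star]
    exact h1 _
  have h2 : actHom C 0 X * (1 - embProj C 0) ∈ K := hle (preservesAppend_act_compl X)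
  have h3 := matResolvent_mem (baseHom C) (isSelfAdjoint_truncated C V hX) z
    (Subalgebra.isClosed_topologicalClosure _)
    -- By definition B acts through the first factor, whose operators need not respect the
    -- relations; it acts in the same way through the second factor, whose operators do.
    (fun b => by
      have : baseHom C b = actHom C 1 ((S 1).incl b) := Subtype.ext (act_incl_eq C 0 1 b)
      rw [this]
      exact h1 _)
    (mul_mem (mul_mem h1' h2) (h1 V)) i k
  rw [proj_emb_of_mem_closure hk (mul_mem (mul_mem (h1 V) h3) h1') h, cauchyTransform,
    CStarMatrix.map_apply, vectorState_compressedVector]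

/-- The compression of an operator to `H₁`. -/
noncomputable def compression (T : adjointable B (FreeProd C)) : H 0 →L[ℂ] H 0 :=
  (proj C 0).comp (T.1.comp (emb C 0))

theorem compression_add (T T' : adjointable B (FreeProd C)) :
    compression C (T + T') = compression C T + compression C T' :=
  ContinuousLinearMap.ext fun _ => map_add (proj C 0) _ _

/-- Insert P = J J⋆ and use aJ = J a: the projection cuts the compression of a product into a
product of compressions. -/
theorem compression_mul_embProj_mul (T T' : adjointable B (FreeProd C)) (a : A 0) :
    compression C (T * (actHom C 0 a * embProj C 0) * T')
      = compression C T * (C 0).rep a * compression C T' := by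
  refine ContinuousLinearMap.ext fun h => ?_
  change proj C 0 (T.1 (act C 0 a (emb C 0 (proj C 0 (T'.1 (emb C 0 h)))))) = _
  rw [act_emb]
  rfl

theorem compression_sum {κ : Type*} (s : Finset κ) (T : κ → adjointable B (FreeProd C)) :
    compression C (∑ k ∈ s, T k) = ∑ k ∈ s, compression C (T k) :=
  map_sum (AddMonoidHom.mk' (compression C) (compression_add C)) T s

/-- The compressed resolvent identity W = Q + Q X W, multiplied by F = Q⁻¹, reads (F − X)W = 1. The
resolvent of X at F is a left inverse of F − X, hence equals W. -/
theorem map_compression_resolvent (hX : IsSelfAdjoint X)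
    (hV : (S 1).expect (V * star V) = 1) {n : ℕ} (z : upperHalf B n) :
    CStarMatrix.ofMatrix (Matrix.of fun i k => compression C
        (actHom C 1 V * matResolvent (baseHom C) (sandwich C X V) z.1 i k * star (actHom C 1 V)))
      = (matResolvent (S 0).incl X (reciprocal (baseHom C)
          (isUCP_vectorState (inner_compressedVector C hV))
          (isSelfAdjoint_truncated C V hX) n z).1).map (C 0).rep := by
  -- No order on A₁ is given; the estimates for imaginary parts use the canonical one.
  let _ := CStarAlgebra.spectralOrder (A 0)
  let _ := CStarAlgebra.spectralOrderedRing (A 0)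
  set F := reciprocal (baseHom C) (isUCP_vectorState (inner_compressedVector C hV))
    (isSelfAdjoint_truncated C V hX) n z with hF
  set Q := cauchyTransform (baseHom C) (vectorState B (compressedVector C V))
    (truncated C X V) z.1 with hQ
  set L : Mat n B →+* Mat n (H 0 →L[ℂ] H 0) := (mapRingHom n (C 0).rep.toRingHom).comp
    (mapRingHom n ((S 0).incl : B →+* A 0)) with hL
  have hq : ∀ i k, compression C (actHom C 1 V * matResolvent (baseHom C) (truncated C X V) z.1 i k
      * star (actHom C 1 V)) = L Q i k := fun i k =>
    ContinuousLinearMap.ext fun h => proj_truncated_resolvent C (V := V) hX z i k h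
  set W : Mat n (H 0 →L[ℂ] H 0) := CStarMatrix.ofMatrix (Matrix.of fun i k => compression C
    (actHom C 1 V * matResolvent (baseHom C) (sandwich C X V) z.1 i k * star (actHom C 1 V)))
    with hW
  have hWW : W = L Q + L Q * amp n ((C 0).rep X) * W := by
    ext1 i k
    have e1 := congrArg (compression C) (sandwich_matResolvent (baseHom C)
      (isSelfAdjoint_sandwich C V hX) (isSelfAdjoint_truncated C V hX)
      (sandwich_sub_truncated C X V) z i k)
    rw [compression_add, compression_sum, hq] at e1
    rw [CStarMatrix.add_apply, CStarMatrix.mul_apply]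
    refine e1.trans (congrArg _ (Finset.sum_congr rfl fun l _ => ?_))
    rw [mul_amp_apply, compression_mul_embProj_mul, hq]
    rfl
  have hQu : IsUnit Q := isUnit_cauchyTransform (baseHom C)
    (isUCP_vectorState (inner_compressedVector C hV)) (isSelfAdjoint_truncated C V hX) z
  have hFQ : F.1 * Q = 1 := Ring.inverse_mul_cancel _ hQu
  have h1 : (L F.1 - amp n ((C 0).rep X)) * W = 1 := by
    have h2 : L F.1 * W = 1 + amp n ((C 0).rep X) * W := by
      conv_lhs => rw [hWW]
      rw [mul_add, ← mul_assoc, ← mul_assoc, ← map_mul, hFQ, map_one, one_mul]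
    rw [sub_mul, h2, add_sub_cancel_right]
  have hFu := isUnit_sub_amp (S 0).incl hX F
  have h3 : (matResolvent (S 0).incl X F.1).map (C 0).rep * (L F.1 - amp n ((C 0).rep X)) = 1 := by
    have e : L F.1 - amp n ((C 0).rep X)
        = mapRingHom n (C 0).rep.toRingHom (F.1.map (S 0).incl - amp n X) := by
      rw [map_sub, mapRingHom_amp]
      rfl
    rw [e]
    change mapRingHom n (C 0).rep.toRingHom (matResolvent (S 0).incl X F.1) * _ = 1
    rw [← map_mul, matResolvent, Ring.inverse_mul_cancel _ hFu, map_one]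
  exact (left_inv_eq_right_inv h3 h1).symm

theorem coe_compressed : (compressed C X V).1 = (sandwich C X V).1 := by
  rw [sandwich, ← map_star]
  rfl

/-- The resolvent of `V⋆ X V` in the free product algebra. -/
theorem exists_inverse_compressed (hX : IsSelfAdjoint X) {n : ℕ} (z : upperHalf B n) :
    ∃ R : Mat n (freeProductAlgebra C),
      (∀ i k, (R i k).1 = (matResolvent (baseHom C) (sandwich C X V) z.1 i k).1) ∧
      (z.1.map (freeBase C) - amp n (compressed C X V)) * R = 1 ∧
      R * (z.1.map (freeBase C) - amp n (compressed C X V)) = 1 := by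
  set Λ := matResolvent (baseHom C) (sandwich C X V) z.1 with hΛ
  -- The free product algebra is a bare algebra of bounded operators. Its preimage among the
  -- adjointable operators is a closed subalgebra of a C⋆-algebra, in which the resolvent is shown
  -- to lie.
  let K : Subalgebra ℂ (adjointable B (FreeProd C)) :=
    (freeProductAlgebra C).comap (adjointable B (FreeProd C)).val
  have hK : IsClosed (K : Set (adjointable B (FreeProd C))) :=
    (Subalgebra.isClosed_topologicalClosure _).preimage continuous_subtype_val
  have ha : ∀ i a, actHom C i a ∈ K := fun i a => (freeIncl C i a).2
  have hmem : ∀ i k, Λ i k ∈ K := matResolvent_mem (baseHom C) (isSelfAdjoint_sandwich C V hX) z hK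
    (fun b => ha 0 _) (by
      rw [sandwich, ← map_star]
      exact mul_mem (mul_mem (ha 1 _) (ha 0 _)) (ha 1 _))
  let R : Mat n (freeProductAlgebra C) :=
    CStarMatrix.ofMatrix (Matrix.of fun i k => ⟨(Λ i k).1, hmem i k⟩)
  have hinj : Function.Injective (freeProductAlgebra C).val.toRingHom := Subtype.val_injective
  have hw : (z.1.map (freeBase C) - amp n (compressed C X V)).map
      (freeProductAlgebra C).val.toRingHom = (z.1.map (baseHom C) - amp n (sandwich C X V)).map
        (adjointable B (FreeProd C)).val.toRingHom := by
    ext1 i k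
    rw [CStarMatrix.map_apply, CStarMatrix.map_apply, CStarMatrix.sub_apply, CStarMatrix.sub_apply,
      amp_apply, amp_apply, map_sub, map_sub]
    refine congrArg₂ (· - ·) rfl ?_
    split_ifs
    · exact coe_compressed C
    · rfl
  have hR : R.map (freeProductAlgebra C).val.toRingHom
      = Λ.map (adjointable B (FreeProd C)).val.toRingHom := rfl
  have hu := isUnit_sub_amp (baseHom C) (isSelfAdjoint_sandwich C V hX) z
  exact ⟨R, fun i k => rfl,
    mul_eq_one_of_map_eq hinj _ hw hR (Ring.mul_inverse_cancel _ hu),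
    mul_eq_one_of_map_eq hinj _ hR hw (Ring.inverse_mul_cancel _ hu)⟩

theorem isUnit_sub_amp_compressed (hX : IsSelfAdjoint X) {n : ℕ} (z : upperHalf B n) :
    IsUnit (z.1.map (freeBase C) - amp n (compressed C X V)) := by
  obtain ⟨R, -, h1, h2⟩ := exists_inverse_compressed C (V := V) hX z
  exact ⟨⟨_, R, h1, h2⟩, rfl⟩

theorem condExpFormula_reciprocal (hX : IsSelfAdjoint X) (hV : (S 1).expect (V * star V) = 1) :
    CondExpFormula C X V (reciprocal (baseHom C)
      (isUCP_vectorState (inner_compressedVector C hV)) (isSelfAdjoint_truncated C V hX)) := by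
  intro n z
  rw [← map_compression_resolvent C hX hV]
  obtain ⟨R, h, h1, h2⟩ := exists_inverse_compressed C (V := V) hX z
  rw [matResolvent, ringInverse_eq h1 h2, ← map_star]
  ext1 i k
  rw [CStarMatrix.map_apply, mul_amp_apply, amp_mul_apply, condExp]
  change (proj C 0).comp ((act C 1 V * (R i k).1 * act C 1 (star V)).comp (emb C 0)) = _
  rw [h]
  rfl

variable {C}

/-- The formula for the conditional expectation implies the subordination of the Cauchy
transforms. -/
theorem CondExpFormula.subordination {F : ∀ n, upperHalf B n → upperHalf B n}
    (hF : CondExpFormula C X V F) (n : ℕ) (z : upperHalf B n) :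
    cauchyTransform (freeBase C) (compressedExpect C V) (compressed C X V) z.1
      = cauchyTransform (S 0).incl (S 0).expect X (F n z).1 := by
  ext1 i k
  -- Evaluate both sides in the vector state of ξ₁: since Jξ₁ = ξ, the compression followed by this
  -- state is E.
  have h := congrArg (fun T => (inner B (C 0).ξ (T (C 0).ξ) : B)) (congrFun (congrFun (hF n z) i) k)
  simp only [CStarMatrix.map_apply, mul_amp_apply, amp_mul_apply, inner_rep_ξ] at h
  rw [cauchyTransform, cauchyTransform, CStarMatrix.map_apply, CStarMatrix.map_apply, ← h,
    compressedExpect, freeExpect, vacuum_eq_emb C 0, inner_emb]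
  rfl

/-- Equal images of the resolvents have equal inverses, and the image of X cancels. The
representation of A₁ need not be faithful: entries in B are recovered from ⟨ξ₁, bξ₁⟩ = b. -/
theorem CondExpFormula.unique (hX : IsSelfAdjoint X) {F F' : ∀ n, upperHalf B n → upperHalf B n}
    (hF : CondExpFormula C X V F) (hF' : CondExpFormula C X V F') : F' = F := by
  let _ := CStarAlgebra.spectralOrder (A 0)
  let _ := CStarAlgebra.spectralOrderedRing (A 0)
  funext n z
  have h := (hF' n z).symm.trans (hF n z)
  have hu := isUnit_sub_amp (S 0).incl hX (F n z)
  have hu' := isUnit_sub_amp (S 0).incl hX (F' n z)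
  set f : Mat n (A 0) →+* Mat n (H 0 →L[ℂ] H 0) := mapRingHom n (C 0).rep.toRingHom with hf
  have h1 : f ((F' n z).1.map (S 0).incl - amp n X) = f ((F n z).1.map (S 0).incl - amp n X) := by
    refine left_inv_eq_right_inv (a := f (matResolvent (S 0).incl X (F n z).1)) ?_ ?_
    · have : f (matResolvent (S 0).incl X (F n z).1) = f (matResolvent (S 0).incl X (F' n z).1) :=
        h.symm
      rw [this, ← map_mul, matResolvent, Ring.mul_inverse_cancel _ hu', map_one]
    · rw [← map_mul, matResolvent, Ring.inverse_mul_cancel _ hu, map_one]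
  rw [map_sub, map_sub, sub_left_inj] at h1
  refine Subtype.ext (CStarMatrix.ext fun i k => ?_)
  have h2 : (C 0).left ((F' n z).1 i k) = (C 0).left ((F n z).1 i k) :=
    congrFun (congrFun h1 i) k
  rw [← (C 0).inner_ξ_left ((F' n z).1 i k), h2, inner_ξ_left]

end Main

end OpValFree
-- Existence and uniqueness of the subordination function
theorem theorem4p1 {B : Type*} [CStarAlgebra B] [PartialOrder B] [StarOrderedRing B]
    {A H : Fin 2 → Type*} [∀ i, CStarAlgebra (A i)] [∀ i, NormedAddCommGroup (H i)]
    [∀ i, NormedSpace ℂ (H i)] [∀ i, CompleteSpace (H i)] [∀ i, Module Bᵐᵒᵖ (H i)]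
    [∀ i, RightHilbertModule B (H i)] (S : ∀ i, ValuedProbSpace B (A i))
    (C : ∀ i, PointedCorrespondence (S i) (H i))
    (X : A 0) (hX : IsSelfAdjoint X) (V : A 1) (η : B →ₗ[ℂ] B)
    (hV₁ : ∀ b₁ b₂ : B, V * (S 1).incl b₁ * star V * (S 1).incl b₂ * V
      = V * (S 1).incl b₁ * (S 1).incl (η b₂))
    (hV₂ : ∀ b : B, (S 1).expect (V * (S 1).incl b * star V) = b) :
    (∀ (n : ℕ) (z : upperHalf B n),
      IsUnit (z.1.map (freeBase C) - amp n (compressed C X V)) ∧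
      IsUnit (z.1.map (S 0).incl - amp n X)) ∧
    ∃ F : ∀ n, upperHalf B n → upperHalf B n,
      IsSubordination (fun _ => cauchyTransform (S 0).incl (S 0).expect X)
        (fun _ => cauchyTransform (freeBase C) (compressedExpect C V) (compressed C X V)) F ∧
      CondExpFormula C X V F ∧
      (∀ F' : ∀ n, upperHalf B n → upperHalf B n,
        IsSubordination (fun _ => cauchyTransform (S 0).incl (S 0).expect X)
          (fun _ => cauchyTransform (freeBase C) (compressedExpect C V) (compressed C X V)) F' →
        F' = F) ∧
      (∀ F' : ∀ n, upperHalf B n → upperHalf B n, CondExpFormula C X V F' → F' = F) := by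
  let _ := CStarAlgebra.spectralOrder (A 0)
  let _ := CStarAlgebra.spectralOrderedRing (A 0)
  -- The case b = 1 of (3.2), the normalization of the vector V⋆ξ.
  have hV : (S 1).expect (V * star V) = 1 := by
    simpa using hV₂ 1
  have hF := condExpFormula_reciprocal C hX hV
  have hsub : IsSubordination (fun _ => cauchyTransform (S 0).incl (S 0).expect X)
      (fun _ => cauchyTransform (freeBase C) (compressedExpect C V) (compressed C X V)) _ :=
    ⟨isFullyMatricial_reciprocal (baseHom C) (isUCP_vectorState (inner_compressedVector C hV))
      (isSelfAdjoint_truncated C V hX), hF.subordination, normalizedAtInfinity_reciprocal _ _ _⟩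
  exact ⟨fun n z => ⟨isUnit_sub_amp_compressed C hX z, isUnit_sub_amp (S 0).incl hX z⟩, _, hsub, hF,
    fun F' hF' => IsSubordination.unique (fun n => exists_cauchyTransform_injective (S 0).incl
      (S 0).expect_incl (S 0).completely_positive hX n) hsub hF',
    fun F' hF' => hF.unique hX hF'⟩
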